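/- **Setting.** Let $n\ge 1$ and let $(V^{n+1},\langle\cdot,\cdot\rangle)$ be a smooth Lorentzian manifold of constant sectional curvature, with Levi-Civita connection $D$. Let $Q$ be a smooth conformal Killing-Yano two-form on $V$, i.e. with $\xi=\mathrm{div}_V Q$ (so $\langle\xi,Z\rangle$ is the metric trace of $(X,Y)\mapsto (D_XQ)(Y,Z)$), $$(D_XQ)(Y,Z)+(D_YQ)(X,Z)=\tfrac2n\left(\langle X,Y\rangle\langle\xi,Z\rangle-\tfrac12\langle X,Z\rangle\langle\xi,Y\rangle-\tfrac12\langle Y,Z\rangle\langle\xi,X\rangle\right),$$ and write $\frac{\partial}{\partial t}=-\frac1n\xi$. (For the static metric $-(1-\kappa\rho^2)dt^2+\frac{d\rho^2}{1-\kappa\rho^2}+\rho^2g_{\mathbb S^{n-1}}$ of constant curvature $\kappa$ and $Q=\rho\,d\rho\wedge dt$, this is the coordinate field of $t$.) Let $F:\Sigma^{n-1}\to V$ be a smooth spacelike immersion of a closed (compact, without boundary) manifold, with induced Riemannian metric $\sigma$, measure $d\mu$ and gradient $\nabla$. A null frame of $\Sigma$ is a pair of smooth null normal fields $L,\underline L$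 along $\Sigma$ with $\langle L,\underline L\rangle=-2$. For a null frame put, for tangent vectors of a frame $\{e_a\}$ of $\Sigma$, $$\chi_{ab}=\langle D_{e_a}L,e_b\rangle,\qquad \underline\chi_{ab}=\langle D_{e_a}\underline L,e_b\rangle,\qquad \zeta_L(e_a)=\tfrac12\langle D_{e_a}L,\underline L\rangle .$$ For integers $r,s\ge0$ with $r+s\le n-1$ the mixed higher order mean curvatures $P_{r,s}=P_{r,s}(\chi,\underline\chi)$ are defined, with components taken in an orthonormal frame, by $$\det(\sigma+y\chi+\underline y\,\underline\chi)=\sum_{0\le r+s\le n-1}\frac{(r+s)!}{r!\,s!}\,y^r\underline y^s P_{r,s},$$ and the mixed Newton tensors by $T_{r,s}^{ab}=\partial P_{r,s}/\partial\chi_{ab}$ and $\underline T_{r,s}^{ab}=\partial P_{r,s}/\partial\underline\chi_{ab}$; they act on tangent vectors by $T(X)=T^{ab}\langle e_a,X\rangle e_b$. **Theorem.** Suppose that $\Sigma$ has a null frame $(L_0,\underline L_0)$ whose connection one-form $\zeta=\zeta_{L_0}$ satisfies $d\zeta=0$ and $[\zeta]=0\in H^1_{dR}(\Sigma)$. Then: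 (a) there is a positive function $u$ on $\Sigma$ such that $(uL_0,u^{-1}\underline L_0)$ is a (smooth) null frame with $\zeta_{uL_0}=0$; (b) for every null frame $(L,\underline L)$ with $\zeta_L=0$, every $f\in C^\infty(\Sigma)$ and all integers $r,s\ge0$ with $1\le r+s\le n-1$, $$\frac{r(n-r-s)}{r+s}\int_\Sigma fP_{r-1,s}\left\langle L,\frac{\partial}{\partial t}\right\rangle d\mu+\frac12 r\int_\Sigma fP_{r,s}\,Q(L,\underline L)\,d\mu+\int_\Sigma Q\big(L,T_{r,s}(\nabla f)\big)\,d\mu=0$$ and $$\frac{s(n-r-s)}{r+s}\int_\Sigma fP_{r,s-1}\left\langle\underline L,\frac{\partial}{\partial t}\right\rangle d\mu-\frac12 s\int_\Sigma fP_{r,s}\,Q(L,\underline L)\,d\mu+\int_\Sigma Q\big(\underline L,\underline T_{r,s}(\nabla f)\big)\,d\mu=0,$$ where the first term of the first (second) formula is read as $0$ if $r=0$ ($s=0$). -/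

import Mathlib

open scoped Manifold ContDiff Nat

noncomputable section

/-! ## Tensors in coordinates: the Levi-Civita connection on an open subset of `ℝᵈ` -/

namespace Coord

variable {d : ℕ}

/-- Christoffel symbols of the first kind of the metric `h` at `y`:
`⟨Γ(u, v), w⟩ = ½ (∂ᵤ h(v, w) + ∂ᵥ h(u, w) - ∂_w h(u, v))`, as a linear form in `w`. -/
def christoffelFirst
    (h : EuclideanSpace ℝ (Fin d) →
      EuclideanSpace ℝ (Fin d) →L[ℝ] EuclideanSpace ℝ (Fin d) →L[ℝ] ℝ)
    (y u v : EuclideanSpace ℝ (Fin d)) : EuclideanSpace ℝ (Fin d) →L[ℝ] ℝ :=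
  (1 / 2 : ℝ) • (fderiv ℝ h y u v + fderiv ℝ h y v u - ((fderiv ℝ h y).flip u).flip v)

/-- The vector metrically dual to a linear form (the index is raised with `h y`). -/
def sharp
    (h : EuclideanSpace ℝ (Fin d) →
      EuclideanSpace ℝ (Fin d) →L[ℝ] EuclideanSpace ℝ (Fin d) →L[ℝ] ℝ)
    (y : EuclideanSpace ℝ (Fin d)) (α : EuclideanSpace ℝ (Fin d) →L[ℝ] ℝ) :
    EuclideanSpace ℝ (Fin d) :=
  (h y).inverse α

/-- Christoffel symbols of the second kind: `D_u v = Γ(u, v)` at `y` for constant fields. -/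
def christoffel
    (h : EuclideanSpace ℝ (Fin d) →
      EuclideanSpace ℝ (Fin d) →L[ℝ] EuclideanSpace ℝ (Fin d) →L[ℝ] ℝ)
    (y u v : EuclideanSpace ℝ (Fin d)) : EuclideanSpace ℝ (Fin d) :=
  sharp h y (christoffelFirst h y u v)

/-- The curvature `R(u, v) w = D_u D_v w - D_v D_u w - D_{[u, v]} w` in coordinates. -/
def curvature
    (h : EuclideanSpace ℝ (Fin d) →
      EuclideanSpace ℝ (Fin d) →L[ℝ] EuclideanSpace ℝ (Fin d) →L[ℝ] ℝ)
    (y u v w : EuclideanSpace ℝ (Fin d)) : EuclideanSpace ℝ (Fin d) :=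
  fderiv ℝ (fun z => christoffel h z v w) y u - fderiv ℝ (fun z => christoffel h z u w) y v
    + christoffel h y u (christoffel h y v w) - christoffel h y v (christoffel h y u w)

/-- The covariant derivative `(D_u q)(v, w)` of a bilinear form field `q`. -/
def covDerivForm
    (h q : EuclideanSpace ℝ (Fin d) →
      EuclideanSpace ℝ (Fin d) →L[ℝ] EuclideanSpace ℝ (Fin d) →L[ℝ] ℝ)
    (y u v w : EuclideanSpace ℝ (Fin d)) : ℝ :=
  fderiv ℝ q y u v w - q y (christoffel h y u v) w - q y v (christoffel h y u w)

/-- The metric dual `e^i` of the `i`-th coordinate form, so that `⟨e^i, e_j⟩ = δ_ij`. -/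
def dualVec
    (h : EuclideanSpace ℝ (Fin d) →
      EuclideanSpace ℝ (Fin d) →L[ℝ] EuclideanSpace ℝ (Fin d) →L[ℝ] ℝ)
    (y : EuclideanSpace ℝ (Fin d)) (i : Fin d) : EuclideanSpace ℝ (Fin d) :=
  sharp h y (EuclideanSpace.proj i)

/-- The divergence of a bilinear form field `q`, as a vector: `⟨div q, w⟩` is the metric trace
over the first two slots of `(D q)(·, ·, w)`, that is `∑ i, (D_{e_i} q)(e^i, w)`. -/
def divForm
    (h q : EuclideanSpace ℝ (Fin d) →
      EuclideanSpace ℝ (Fin d) →L[ℝ] EuclideanSpace ℝ (Fin d) →L[ℝ] ℝ)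
    (y : EuclideanSpace ℝ (Fin d)) : EuclideanSpace ℝ (Fin d) :=
  ∑ j : Fin d, (∑ i : Fin d, covDerivForm h q y (EuclideanSpace.single i 1) (dualVec h y i)
    (EuclideanSpace.single j 1)) • dualVec h y j

end Coord

/-! ## Lorentzian manifolds and conformal Killing-Yano two-forms -/

namespace Spacetime

variable {d : ℕ} {M : Type*} [TopologicalSpace M] [ChartedSpace (EuclideanSpace ℝ (Fin d)) M]

/-- The pull-back `(u, v) ↦ b(A u, A v)` of a bilinear form by a linear map. -/
def pullForm {k l : ℕ}
    (b : EuclideanSpace ℝ (Fin l) →L[ℝ] EuclideanSpace ℝ (Fin l) →L[ℝ] ℝ)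
    (A : EuclideanSpace ℝ (Fin k) →L[ℝ] EuclideanSpace ℝ (Fin l)) :
    EuclideanSpace ℝ (Fin k) →L[ℝ] EuclideanSpace ℝ (Fin k) →L[ℝ] ℝ :=
  ContinuousLinearMap.bilinearComp b A A

/-- The expression, in the chart around `c`, of a field `b` of bilinear forms on `M`
(the pull-back of `b` by the inverse of the chart). -/
def chartForm
    (b : ∀ x : M, TangentSpace (𝓡 d) x →L[ℝ] TangentSpace (𝓡 d) x →L[ℝ] ℝ) (c : M)
    (y : EuclideanSpace ℝ (Fin d)) :
    EuclideanSpace ℝ (Fin d) →L[ℝ] EuclideanSpace ℝ (Fin d) →L[ℝ] ℝ :=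
  pullForm (b ((extChartAt (𝓡 d) c).symm y))
    (mfderiv 𝓘(ℝ, EuclideanSpace ℝ (Fin d)) (𝓡 d) (extChartAt (𝓡 d) c).symm y)

/-- A field of bilinear forms is smooth if all its chart expressions are. -/
def IsSmoothForm
    (b : ∀ x : M, TangentSpace (𝓡 d) x →L[ℝ] TangentSpace (𝓡 d) x →L[ℝ] ℝ) : Prop :=
  ∀ c : M, ContDiffOn ℝ ∞ (chartForm b c) (extChartAt (𝓡 d) c).target

/-- `g` is a smooth Lorentzian metric, of signature `(-, +, …, +)`. -/
structure IsLorentzMetric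
    (g : ∀ x : M, TangentSpace (𝓡 d) x →L[ℝ] TangentSpace (𝓡 d) x →L[ℝ] ℝ) : Prop where
  smooth : IsSmoothForm g
  symm : ∀ (x : M) (u v : TangentSpace (𝓡 d) x), g x u v = g x v u
  signature : ∀ x : M, ∃ τ : TangentSpace (𝓡 d) x, g x τ τ < 0 ∧
    ∀ v : TangentSpace (𝓡 d) x, g x τ v = 0 → v ≠ 0 → 0 < g x v v

/-- The metric `g` has constant sectional curvature `κ`:
`R(u, v) w = κ (⟨v, w⟩ u - ⟨u, w⟩ v)`. -/
def HasConstantCurvature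
    (g : ∀ x : M, TangentSpace (𝓡 d) x →L[ℝ] TangentSpace (𝓡 d) x →L[ℝ] ℝ) (κ : ℝ) : Prop :=
  ∀ c : M, ∀ y ∈ (extChartAt (𝓡 d) c).target, ∀ u v w : EuclideanSpace ℝ (Fin d),
    Coord.curvature (chartForm g c) y u v w
      = κ • (chartForm g c y v w • u - chartForm g c y u w • v)

/-- The divergence vector field `ξ = div Q` of a two-form. The chart around `x` is used at `x`;
the tangent space at `x` is identified with the model space through that chart. -/
def divTwoForm
    (g Q : ∀ x : M, TangentSpace (𝓡 d) x →L[ℝ] TangentSpace (𝓡 d) x →L[ℝ] ℝ) (x : M) :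
    TangentSpace (𝓡 d) x :=
  Coord.divForm (chartForm g x) (chartForm Q x) (extChartAt (𝓡 d) x x)

/-- `Q` is a conformal Killing-Yano two-form on the `d`-dimensional manifold `M`: with `d = n + 1`
and `ξ = div Q`,
`(D_X Q)(Y, Z) + (D_Y Q)(X, Z) = (2/n) (⟨X, Y⟩⟨ξ, Z⟩ - ½ ⟨X, Z⟩⟨ξ, Y⟩ - ½ ⟨Y, Z⟩⟨ξ, X⟩)`. -/
structure IsConformalKillingYano
    (g Q : ∀ x : M, TangentSpace (𝓡 d) x →L[ℝ] TangentSpace (𝓡 d) x →L[ℝ] ℝ) : Prop where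
  smooth : IsSmoothForm Q
  alt : ∀ (x : M) (u v : TangentSpace (𝓡 d) x), Q x u v = - Q x v u
  eqn : ∀ c : M, ∀ y ∈ (extChartAt (𝓡 d) c).target, ∀ X Y Z : EuclideanSpace ℝ (Fin d),
    Coord.covDerivForm (chartForm g c) (chartForm Q c) y X Y Z
        + Coord.covDerivForm (chartForm g c) (chartForm Q c) y Y X Z
      = 2 / ((d : ℝ) - 1) *
        (chartForm g c y X Y
            * chartForm g c y (Coord.divForm (chartForm g c) (chartForm Q c) y) Z
          - 1 / 2 * (chartForm g c y X Z
            * chartForm g c y (Coord.divForm (chartForm g c) (chartForm Q c) y) Y)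
          - 1 / 2 * (chartForm g c y Y Z
            * chartForm g c y (Coord.divForm (chartForm g c) (chartForm Q c) y) X))

/-- The vector field `∂/∂t` attached to `Q`, normalised by `div Q = -n ∂/∂t` with `n = d - 1`.
For the static metric `-(1 - κ r²) dt² + dr² / (1 - κ r²) + r² g_{S^{n-1}}` of constant curvature
`κ` and `Q = r dr ∧ dt` it is the coordinate field of the static time `t`. -/
def timeField
    (g Q : ∀ x : M, TangentSpace (𝓡 d) x →L[ℝ] TangentSpace (𝓡 d) x →L[ℝ] ℝ) (x : M) :
    TangentSpace (𝓡 d) x :=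
  (-(1 / ((d : ℝ) - 1))) • divTwoForm g Q x

end Spacetime

/-! ## Mixed higher order mean curvatures and Newton tensors of matrices -/

/-- `P_{r,s}` as a function of the components `A = (χ_ab)`, `B = (χ̲_ab)` of two symmetric
two-tensors in a frame in which the metric has components `G = (σ_ab)`:
`det(G)⁻¹ det(G + y A + y̲ B) = ∑ (r+s)!/(r! s!) yʳ y̲ˢ P_{r,s}`.
In an orthonormal frame, `G = 1` and the factor `det(G)⁻¹` is `1`; with the factor, the value
does not depend on the frame. -/
def mixedCurvature {m : ℕ} (G A B : Matrix (Fin m) (Fin m) ℝ) (r s : ℕ) : ℝ :=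
  ((r ! : ℝ) * (s ! : ℝ) / ((r + s) ! : ℝ)) *
    (MvPolynomial.coeff (Finsupp.single (0 : Fin 2) r + Finsupp.single (1 : Fin 2) s)
      (Matrix.det (Matrix.of fun a b : Fin m =>
        (MvPolynomial.C (G a b) + MvPolynomial.X 0 * MvPolynomial.C (A a b)
          + MvPolynomial.X 1 * MvPolynomial.C (B a b) : MvPolynomial (Fin 2) ℝ))) / G.det)

/-- The mixed Newton tensor `T_{r,s}^{ab} = ∂P_{r,s} / ∂χ_ab`. -/
def mixedNewton {m : ℕ} (G A B : Matrix (Fin m) (Fin m) ℝ) (r s : ℕ) (a b : Fin m) : ℝ :=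
  deriv (fun t : ℝ => mixedCurvature G (A + t • Matrix.single a b 1) B r s) 0

/-- The mixed Newton tensor `T̲_{r,s}^{ab} = ∂P_{r,s} / ∂χ̲_ab`. -/
def mixedNewtonBar {m : ℕ} (G A B : Matrix (Fin m) (Fin m) ℝ) (r s : ℕ) (a b : Fin m) : ℝ :=
  deriv (fun t : ℝ => mixedCurvature G A (B + t • Matrix.single a b 1) r s) 0

/-! ## Geometry of a spacelike submanifold of codimension two -/

namespace Submanifold

open MeasureTheory

variable {m d : ℕ} {S : Type*} [TopologicalSpace S] [ChartedSpace (EuclideanSpace ℝ (Fin m)) S]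
  {V : Type*} [TopologicalSpace V] [ChartedSpace (EuclideanSpace ℝ (Fin d)) V]

/-- The induced metric `σ = F^* g`. -/
def inducedMetric
    (g : ∀ x : V, TangentSpace (𝓡 d) x →L[ℝ] TangentSpace (𝓡 d) x →L[ℝ] ℝ) (F : S → V) (p : S) :
    TangentSpace (𝓡 m) p →L[ℝ] TangentSpace (𝓡 m) p →L[ℝ] ℝ :=
  Spacetime.pullForm (g (F p)) (mfderiv (𝓡 m) (𝓡 d) F p)

/-- `F` is a smooth spacelike immersion: the induced metric is positive definite
(which implies that `dF` is injective). -/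
structure IsSpacelikeImmersion
    (g : ∀ x : V, TangentSpace (𝓡 d) x →L[ℝ] TangentSpace (𝓡 d) x →L[ℝ] ℝ) (F : S → V) :
    Prop where
  smooth : ContMDiff (𝓡 m) (𝓡 d) ∞ F
  pos : ∀ (p : S) (X : TangentSpace (𝓡 m) p), X ≠ 0 → 0 < inducedMetric (m := m) g F p X X

/-- The expression near `p`, in the chart around `F p`, of a vector field `L` along `F`. -/
def fieldInChart (F : S → V) (L : ∀ p : S, TangentSpace (𝓡 d) (F p)) (p q : S) :
    EuclideanSpace ℝ (Fin d) :=
  mfderiv (𝓡 d) 𝓘(ℝ, EuclideanSpace ℝ (Fin d)) (extChartAt (𝓡 d) (F p)) (F q) (L q)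

/-- The covariant derivative `D_X L` at `p` of a vector field `L` along `F` in direction `dF(X)`,
computed in the chart around `F p`. -/
def covDeriv
    (g : ∀ x : V, TangentSpace (𝓡 d) x →L[ℝ] TangentSpace (𝓡 d) x →L[ℝ] ℝ) (F : S → V)
    (L : ∀ p : S, TangentSpace (𝓡 d) (F p)) (p : S) (X : TangentSpace (𝓡 m) p) :
    TangentSpace (𝓡 d) (F p) :=
  let DL : EuclideanSpace ℝ (Fin d) :=
    mfderiv (𝓡 m) 𝓘(ℝ, EuclideanSpace ℝ (Fin d)) (fieldInChart F L p) p X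
  DL + Coord.christoffel (Spacetime.chartForm g (F p)) (extChartAt (𝓡 d) (F p) (F p))
    (mfderiv (𝓡 m) (𝓡 d) F p X) (L p)

/-- `(L, L̲)` is a smooth null frame of the normal bundle with `⟨L, L̲⟩ = -2`. -/
structure IsNullFrame [IsManifold (𝓡 d) 1 V]
    (g : ∀ x : V, TangentSpace (𝓡 d) x →L[ℝ] TangentSpace (𝓡 d) x →L[ℝ] ℝ) (F : S → V)
    (L Lb : ∀ p : S, TangentSpace (𝓡 d) (F p)) : Prop where
  smooth_left : ContMDiff (𝓡 m) (𝓡 d).tangent ∞ fun p => (⟨F p, L p⟩ : TangentBundle (𝓡 d) V)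
  smooth_right : ContMDiff (𝓡 m) (𝓡 d).tangent ∞ fun p => (⟨F p, Lb p⟩ : TangentBundle (𝓡 d) V)
  normal_left : ∀ (p : S) (X : TangentSpace (𝓡 m) p), g (F p) (L p) (mfderiv (𝓡 m) (𝓡 d) F p X) = 0
  normal_right : ∀ (p : S) (X : TangentSpace (𝓡 m) p),
    g (F p) (Lb p) (mfderiv (𝓡 m) (𝓡 d) F p X) = 0
  null_left : ∀ p : S, g (F p) (L p) (L p) = 0
  null_right : ∀ p : S, g (F p) (Lb p) (Lb p) = 0
  pairing : ∀ p : S, g (F p) (L p) (Lb p) = -2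

/-- The null second fundamental form `χ(X, Y) = ⟨D_X L, Y⟩` with respect to `L`. -/
def nullForm
    (g : ∀ x : V, TangentSpace (𝓡 d) x →L[ℝ] TangentSpace (𝓡 d) x →L[ℝ] ℝ) (F : S → V)
    (L : ∀ p : S, TangentSpace (𝓡 d) (F p)) (p : S) (X Y : TangentSpace (𝓡 m) p) : ℝ :=
  g (F p) (covDeriv g F L p X) (mfderiv (𝓡 m) (𝓡 d) F p Y)

/-- The connection one-form `ζ_L(X) = ½ ⟨D_X L, L̲⟩`. -/
def torsion
    (g : ∀ x : V, TangentSpace (𝓡 d) x →L[ℝ] TangentSpace (𝓡 d) x →L[ℝ] ℝ) (F : S → V)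
    (L Lb : ∀ p : S, TangentSpace (𝓡 d) (F p)) (p : S) (X : TangentSpace (𝓡 m) p) : ℝ :=
  1 / 2 * g (F p) (covDeriv g F L p X) (Lb p)

/-- `Σ` is torsion-free with respect to the null frame: `ζ_L = 0`. -/
def IsTorsionFree
    (g : ∀ x : V, TangentSpace (𝓡 d) x →L[ℝ] TangentSpace (𝓡 d) x →L[ℝ] ℝ) (F : S → V)
    (L Lb : ∀ p : S, TangentSpace (𝓡 d) (F p)) : Prop :=
  ∀ (p : S) (X : TangentSpace (𝓡 m) p), torsion g F L Lb p X = 0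

/-- The expression `y ↦ α_y(u)` of a one-form in the chart around `c`. -/
def chartOneForm (α : ∀ p : S, TangentSpace (𝓡 m) p → ℝ) (c : S)
    (u y : EuclideanSpace ℝ (Fin m)) : ℝ :=
  α ((extChartAt (𝓡 m) c).symm y)
    (mfderiv 𝓘(ℝ, EuclideanSpace ℝ (Fin m)) (𝓡 m) (extChartAt (𝓡 m) c).symm y u)

/-- `dα = 0`: in every chart, `∂ᵤ α(v) - ∂ᵥ α(u) = 0`. -/
def IsClosedOneForm (α : ∀ p : S, TangentSpace (𝓡 m) p → ℝ) : Prop :=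
  ∀ c : S, ∀ y ∈ (extChartAt (𝓡 m) c).target, ∀ u v : EuclideanSpace ℝ (Fin m),
    fderiv ℝ (chartOneForm α c v) y u - fderiv ℝ (chartOneForm α c u) y v = 0

/-- `α = dh` for a smooth function `h`; for a closed form this says `[α] = 0` in `H¹_dR`. -/
def IsExactOneForm (α : ∀ p : S, TangentSpace (𝓡 m) p → ℝ) : Prop :=
  ∃ h : S → ℝ, ContMDiff (𝓡 m) 𝓘(ℝ, ℝ) ∞ h ∧
    ∀ (p : S) (X : TangentSpace (𝓡 m) p), (mfderiv (𝓡 m) 𝓘(ℝ, ℝ) h p X : ℝ) = α p X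

/-- The coordinate basis of the tangent space at `p`. -/
def frame (p : S) (a : Fin m) : TangentSpace (𝓡 m) p :=
  (EuclideanSpace.single a (1 : ℝ) : EuclideanSpace ℝ (Fin m))

/-- The matrix of components `(σ_ab)`. -/
def metricMatrix
    (g : ∀ x : V, TangentSpace (𝓡 d) x →L[ℝ] TangentSpace (𝓡 d) x →L[ℝ] ℝ) (F : S → V) (p : S) :
    Matrix (Fin m) (Fin m) ℝ :=
  Matrix.of fun a b => inducedMetric (m := m) g F p (frame p a) (frame p b)

/-- The matrix of components `(χ_ab)` of the null second fundamental form with respect to `L`. -/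
def nullMatrix
    (g : ∀ x : V, TangentSpace (𝓡 d) x →L[ℝ] TangentSpace (𝓡 d) x →L[ℝ] ℝ) (F : S → V)
    (L : ∀ p : S, TangentSpace (𝓡 d) (F p)) (p : S) : Matrix (Fin m) (Fin m) ℝ :=
  Matrix.of fun a b => nullForm (m := m) g F L p (frame p a) (frame p b)

/-- The mixed higher order mean curvature `P_{r,s}(χ, χ̲)` at `p`. -/
def meanCurv (m : ℕ) [ChartedSpace (EuclideanSpace ℝ (Fin m)) S]
    (g : ∀ x : V, TangentSpace (𝓡 d) x →L[ℝ] TangentSpace (𝓡 d) x →L[ℝ] ℝ) (F : S → V)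
    (L Lb : ∀ p : S, TangentSpace (𝓡 d) (F p)) (r s : ℕ) (p : S) : ℝ :=
  mixedCurvature (metricMatrix (m := m) g F p) (nullMatrix g F L p) (nullMatrix g F Lb p) r s

/-- A `(2,0)`-tensor `T^{ab}` applied to a tangent vector: `T(X) = T^{ab} ⟨e_a, X⟩ e_b`. -/
def applyTensor
    (g : ∀ x : V, TangentSpace (𝓡 d) x →L[ℝ] TangentSpace (𝓡 d) x →L[ℝ] ℝ) (F : S → V) (p : S)
    (T : Fin m → Fin m → ℝ) (X : TangentSpace (𝓡 m) p) : TangentSpace (𝓡 m) p :=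
  ∑ a : Fin m, ∑ b : Fin m, (T a b * inducedMetric g F p (frame p a) X) • frame p b

/-- The mixed Newton tensor `T_{r,s}(χ, χ̲)` at `p`, as an endomorphism of the tangent space. -/
def newton
    (g : ∀ x : V, TangentSpace (𝓡 d) x →L[ℝ] TangentSpace (𝓡 d) x →L[ℝ] ℝ) (F : S → V)
    (L Lb : ∀ p : S, TangentSpace (𝓡 d) (F p)) (r s : ℕ) (p : S)
    (X : TangentSpace (𝓡 m) p) : TangentSpace (𝓡 m) p :=
  applyTensor g F p
    (mixedNewton (metricMatrix (m := m) g F p) (nullMatrix g F L p) (nullMatrix g F Lb p) r s) X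

/-- The mixed Newton tensor `T̲_{r,s}(χ, χ̲)` at `p`, as an endomorphism of the tangent space. -/
def newtonBar
    (g : ∀ x : V, TangentSpace (𝓡 d) x →L[ℝ] TangentSpace (𝓡 d) x →L[ℝ] ℝ) (F : S → V)
    (L Lb : ∀ p : S, TangentSpace (𝓡 d) (F p)) (r s : ℕ) (p : S)
    (X : TangentSpace (𝓡 m) p) : TangentSpace (𝓡 m) p :=
  applyTensor g F p
    (mixedNewtonBar (metricMatrix (m := m) g F p) (nullMatrix g F L p) (nullMatrix g F Lb p) r s) X

/-- The gradient `∇f` with respect to the induced metric: `⟨∇f, X⟩ = df(X)`. -/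
def gradient (m : ℕ) [ChartedSpace (EuclideanSpace ℝ (Fin m)) S]
    (g : ∀ x : V, TangentSpace (𝓡 d) x →L[ℝ] TangentSpace (𝓡 d) x →L[ℝ] ℝ) (F : S → V)
    (f : S → ℝ) (p : S) : TangentSpace (𝓡 m) p :=
  (inducedMetric (m := m) g F p).inverse (mfderiv (𝓡 m) 𝓘(ℝ, ℝ) f p)

/-- The Riemannian measure `√det(σ_ab) dy` of the induced metric inside the chart around `c`. -/
def chartMeasure (m : ℕ) [ChartedSpace (EuclideanSpace ℝ (Fin m)) S] [MeasurableSpace S]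
    (g : ∀ x : V, TangentSpace (𝓡 d) x →L[ℝ] TangentSpace (𝓡 d) x →L[ℝ] ℝ) (F : S → V) (c : S) :
    Measure S :=
  Measure.map (extChartAt (𝓡 m) c).symm
    (((volume : Measure (EuclideanSpace ℝ (Fin m))).restrict
        (extChartAt (𝓡 m) c).target).withDensity
      fun y => ENNReal.ofReal (Real.sqrt (Matrix.det (Matrix.of fun a b : Fin m =>
        Spacetime.chartForm (inducedMetric (m := m) g F) c y
          (EuclideanSpace.single a 1) (EuclideanSpace.single b 1)))))

/-- The Riemannian measure `dμ` of the induced metric on `Σ`. The measures `chartMeasure` are its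
restrictions to the chart domains, so that it is their least upper bound. -/
def riemannianMeasure (m : ℕ) [ChartedSpace (EuclideanSpace ℝ (Fin m)) S] [MeasurableSpace S]
    (g : ∀ x : V, TangentSpace (𝓡 d) x →L[ℝ] TangentSpace (𝓡 d) x →L[ℝ] ℝ) (F : S → V) :
    Measure S :=
  ⨆ c : S, chartMeasure m g F c

end Submanifold

end

/-!
Rescaling `L` by a positive function `u` changes the connection one-form by `- d log u`
(`torsion_smul`), so a primitive `h` of `ζ` gives the torsion-free frame with `u = exp h`
(`exists_isTorsionFree_smul`).

The first integral formula is the divergence theorem for the vector field `f T_{r,s}(Q(L, ·)^♯)`,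
and the point is the divergence of `T_{r,s}(Q(L, ·)^♯)`. All the Newton tensors are treated at once:
they are the coefficients of the adjugate of the pencil `M = σ + y χ + y̲ χ̲`, up to factorials
(`mixedNewton_eq`), so it suffices to differentiate `adj M` contracted with `Q(L, ·)` for fixed
`(y, y̲)` (`sum_fderiv_adjugate`). In coordinates, `M` consists of the components of the tangential
moving frame `𝓔_a = E_a + y D_a L + y̲ D_a L̲`. Constant curvature and `ζ = 0` give the Codazzi
equations `D_a 𝓔_b = D_b 𝓔_a` (`alongDeriv_movingVec_symm`), so the divergence of `adj M Q(L, ·)`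
contains no derivative of `χ` or `χ̲` (`sum_fderiv_density_mul`). Three terms are left:

* `(D Q)(L, ·)` contracted with the symmetric tensor `adj M`, for which the conformal
  Killing-Yano equation gives `tr (adj M σ) ⟨L, ∂/∂t⟩` (`sum_symm_mul_covDerivForm`);
* `Q(D_a L, ·)`, which contributes nothing: by the Ricci equation `χ` and `χ̲` commute
  (`second_commute`), so that an antisymmetric form is contracted with a symmetric one
  (`sum_adjugate_mul_form_left`);
* `½ tr (adj M χ) Q(L, L̲)`, the normal part of `D_a` of the dual of `Q(L, ·)`
  (`form_alongDeriv_dual`).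

The terms are matched with `P_{r-1,s}` and `P_{r,s}` by comparing coefficients in `(y, y̲)`, using
Jacobi's formula for `∂_y det M` and Euler's identity for the homogeneous polynomial `det M` in
`σ, χ, χ̲` (`coeff_trace_mul_snd`, `coeff_trace_mul_fst`). The result is `sum_fderiv_newtonTensor`.

This computation is done in one chart of the submanifold and one of the ambient manifold. To pass to
the manifold, one uses that the covariant derivative along `F` may be computed in any charts
(`fwd_covDeriv`), that `⟨L, ∂/∂t⟩` may as well, because the conformal Killing-Yano equation itself
determines it (`form_timeVec_trans`), that the Riemannian measure restricts to the chart measure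
on every chart domain (`restrict_riemannianMeasure`), and a partition of unity
(`ChartCalc.integral_formula`). The second formula is the first one with the null fields and the
indices `r`, `s` exchanged (`integral_formula_bar`).
-/


set_option maxSynthPendingDepth 3

noncomputable section

/-! ### Jacobi's formula and the pencil `σ + y χ + y̲ χ̲` -/

section Jacobi

variable {ι R : Type*} [Fintype ι] [DecidableEq ι] [CommRing R]

/-- The Leibniz expansion of a derivative of `det M`, resummed as a trace against the adjugate. -/
theorem Matrix.sum_sign_prod_erase_mul (M M' : Matrix ι ι R) :
    ∑ σ : Equiv.Perm ι, (Equiv.Perm.sign σ : ℤ) •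
      ∑ i : ι, (∏ j ∈ Finset.univ.erase i, M (σ j) j) * M' (σ i) i
      = Matrix.trace (M.adjugate * M') := by
  have h1 : ∀ i, (M.adjugate * M') i i = (M.updateCol i fun j => M' j i).det := by
    intro i
    rw [← Matrix.cramer_apply, Matrix.cramer_eq_adjugate_mulVec]
    rfl
  simp only [Matrix.trace, Matrix.diag, h1]
  simp only [Matrix.det_apply, Finset.smul_sum]
  rw [Finset.sum_comm]
  refine Finset.sum_congr rfl fun i _ => Finset.sum_congr rfl fun σ _ => ?_
  rw [← Finset.mul_prod_erase Finset.univ _ (Finset.mem_univ i)]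
  have : ∏ x ∈ Finset.univ.erase i, (M.updateCol i fun j => M' j i) (σ x) x
      = ∏ j ∈ Finset.univ.erase i, M (σ j) j := by
    refine Finset.prod_congr rfl fun j hj => ?_
    rw [Matrix.updateCol_ne (Finset.ne_of_mem_erase hj)]
  rw [this, Matrix.updateCol_self, mul_comm]
  rfl

theorem Derivation.map_finset_prod {κ A B : Type*} [DecidableEq κ] [CommRing A] [CommRing B]
    [Algebra A B]
    (D : Derivation A B B) (s : Finset κ) (f : κ → B) :
    D (∏ i ∈ s, f i) = ∑ i ∈ s, (∏ j ∈ s.erase i, f j) * D (f i) := by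
  induction s using Finset.induction_on with
  | empty => simp
  | insert a s ha ih =>
    rw [Finset.prod_insert ha, Derivation.leibniz, ih, Finset.sum_insert ha,
      Finset.erase_insert ha, add_comm, smul_eq_mul, smul_eq_mul, Finset.mul_sum]
    congr 1
    refine Finset.sum_congr rfl fun i hi => ?_
    have hne : a ≠ i := fun h => ha (h ▸ hi)
    rw [Finset.erase_insert_of_ne hne, Finset.prod_insert (by simp [ha]), mul_assoc]

/-- Jacobi's formula for a derivation. -/
theorem Derivation.map_det {A B : Type*} [CommRing A] [CommRing B] [Algebra A B]
    (D : Derivation A B B) (M : Matrix ι ι B) :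
    D M.det = Matrix.trace (M.adjugate * M.map D) := by
  rw [← Matrix.sum_sign_prod_erase_mul, Matrix.det_apply, map_sum]
  refine Finset.sum_congr rfl fun σ _ => ?_
  rw [Units.smul_def, map_zsmul, Derivation.map_finset_prod]
  rfl

/-- Jacobi's formula for a differentiable matrix-valued function. -/
theorem HasFDerivAt.matrix_det {E : Type*} [NormedAddCommGroup E] [NormedSpace ℝ E]
    {M : E → Matrix ι ι ℝ} {M' : ι → ι → E →L[ℝ] ℝ} {x : E}
    (hM : ∀ i j, HasFDerivAt (fun z => M z i j) (M' i j) x) :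
    HasFDerivAt (fun z => (M z).det) (∑ i, ∑ j, (M x).adjugate i j • M' j i) x := by
  have key : HasFDerivAt (fun z => ∑ σ : Equiv.Perm ι, ((Equiv.Perm.sign σ : ℤ) : ℝ) •
      ∏ i, M z (σ i) i)
      (∑ σ : Equiv.Perm ι, ((Equiv.Perm.sign σ : ℤ) : ℝ) •
        ∑ i : ι, (∏ j ∈ Finset.univ.erase i, M x (σ j) j) • M' (σ i) i) x :=
    HasFDerivAt.fun_sum fun σ _ =>
      (HasFDerivAt.finsetProd (u := Finset.univ) fun i _ => hM (σ i) i).fun_const_smul _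
  convert key using 1
  · funext z
    rw [Matrix.det_apply]
    refine Finset.sum_congr rfl fun σ _ => ?_
    rw [Units.smul_def, ← Int.cast_smul_eq_zsmul ℝ]
  · ext u
    have h := Matrix.sum_sign_prod_erase_mul (M x) (Matrix.of fun i j => M' i j u)
    simp only [Matrix.of_apply, Matrix.trace, Matrix.diag, Matrix.mul_apply] at h
    simp only [sum_apply, smul_apply, smul_eq_mul]
    rw [← h]
    refine Finset.sum_congr rfl fun σ _ => ?_
    rw [← Int.cast_smul_eq_zsmul ℝ, smul_eq_mul]

end Jacobi

open MvPolynomial in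
/-- The matrix of polynomials `G + y A + y̲ B`. -/
def pencil {m : ℕ} (G A B : Matrix (Fin m) (Fin m) ℝ) :
    Matrix (Fin m) (Fin m) (MvPolynomial (Fin 2) ℝ) :=
  Matrix.of fun a b => C (G a b) + X 0 * C (A a b) + X 1 * C (B a b)

/-- The exponent of the monomial `yʳ y̲ˢ`. -/
def expo (r s : ℕ) : Fin 2 →₀ ℕ :=
  Finsupp.single (0 : Fin 2) r + Finsupp.single (1 : Fin 2) s

theorem expo_zero (r s : ℕ) : expo r s 0 = r := by simp [expo]
theorem expo_one (r s : ℕ) : expo r s 1 = s := by simp [expo]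

theorem coeff_expo_succ_X_mul (r s : ℕ) (p : MvPolynomial (Fin 2) ℝ) :
    MvPolynomial.coeff (expo (r + 1) s) (MvPolynomial.X 0 * p)
      = MvPolynomial.coeff (expo r s) p := by
  rw [expo, add_comm r 1, Finsupp.single_add, add_assoc, MvPolynomial.coeff_X_mul, expo]

/-- The combinatorial factor `r! s! / (r + s)!`. -/
def mixedFactor (r s : ℕ) : ℝ := (r ! : ℝ) * (s ! : ℝ) / ((r + s) ! : ℝ)

namespace pencil
open MvPolynomial Matrix

variable {m : ℕ} (G A B : Matrix (Fin m) (Fin m) ℝ)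

theorem mixedCurvature_eq (r s : ℕ) : mixedCurvature G A B r s
    = mixedFactor r s * (coeff (expo r s) (pencil G A B).det / G.det) := rfl

theorem eq_map : pencil G A B = G.map C + (X 0 : MvPolynomial (Fin 2) ℝ) • A.map C
    + (X 1 : MvPolynomial (Fin 2) ℝ) • B.map C := by
  ext a b : 2
  simp [pencil, smul_eq_mul]

theorem eval_map (v : Fin 2 → ℝ) :
    (pencil G A B).map (eval v) = G + v 0 • A + v 1 • B := by
  ext a b
  simp [pencil]

theorem congr_eq (P : Matrix (Fin m) (Fin m) ℝ) :
    pencil (Pᵀ * G * P) (Pᵀ * A * P) (Pᵀ * B * P)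
      = (P.map C)ᵀ * pencil G A B * P.map C := by
  simp only [eq_map, Matrix.map_mul, Matrix.transpose_map, Matrix.mul_add, Matrix.add_mul,
    Matrix.mul_smul, Matrix.smul_mul]

theorem det_map_C (P : Matrix (Fin m) (Fin m) ℝ) :
    (P.map (C : ℝ →+* MvPolynomial (Fin 2) ℝ)).det = C P.det :=
  ((C : ℝ →+* MvPolynomial (Fin 2) ℝ).map_det P).symm

theorem mixedCurvature_congr {P : Matrix (Fin m) (Fin m) ℝ} (hP : P.det ≠ 0) (r s : ℕ) :
    mixedCurvature (Pᵀ * G * P) (Pᵀ * A * P) (Pᵀ * B * P) r s = mixedCurvature G A B r s := by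
  rw [mixedCurvature_eq, mixedCurvature_eq, congr_eq]
  simp only [det_mul, det_transpose, det_map_C]
  rw [mul_right_comm, ← C_mul, coeff_C_mul]
  field_simp

theorem det_add_single (t : ℝ) (a b : Fin m) :
    (pencil G (A + t • Matrix.single a b 1) B).det
      = (pencil G A B).det + C t * (X 0 * (pencil G A B).adjugate b a) := by
  have h : pencil G (A + t • Matrix.single a b 1) B
      = (pencil G A B).updateRow a
        (pencil G A B a + (C t * X 0 : MvPolynomial (Fin 2) ℝ) • Pi.single b 1) := by
    refine Matrix.ext fun i j => ?_
    by_cases hi : i = a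
    · subst hi
      by_cases hj : j = b
      · subst hj
        simp [pencil]
        ring
      · simp [pencil, Pi.single_eq_of_ne hj, Matrix.single_apply_of_col_ne _ _ (Ne.symm hj)]
    · rw [Matrix.updateRow_ne hi]
      simp [pencil, Matrix.single_apply_of_row_ne (Ne.symm hi)]
  rw [h, det_updateRow_add, det_updateRow_smul, updateRow_eq_self, adjugate_apply, mul_assoc]

theorem mixedNewton_eq (r s : ℕ) (a b : Fin m) : mixedNewton G A B r s a b
    = mixedFactor r s * (coeff (expo r s) (X 0 * (pencil G A B).adjugate b a) / G.det) := by
  have h : (fun t : ℝ => mixedCurvature G (A + t • Matrix.single a b 1) B r s)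
      = fun t : ℝ => mixedCurvature G A B r s + t * (mixedFactor r s *
        (coeff (expo r s) (X 0 * (pencil G A B).adjugate b a) / G.det)) := by
    funext t
    rw [mixedCurvature_eq, mixedCurvature_eq, det_add_single, coeff_add, coeff_C_mul]
    ring
  rw [mixedNewton, h]
  simp

theorem mixedNewton_zero (s : ℕ) (a b : Fin m) : mixedNewton G A B 0 s a b = 0 := by
  rw [mixedNewton_eq, coeff_X_mul']
  simp [expo]

theorem mixedNewton_succ (r s : ℕ) (a b : Fin m) : mixedNewton G A B (r + 1) s a b
    = mixedFactor (r + 1) s * (coeff (expo r s) ((pencil G A B).adjugate b a) / G.det) := by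
  rw [mixedNewton_eq, coeff_expo_succ_X_mul]

/-- The Newton tensors are contravariant under a change of frame. -/
theorem mixedNewton_congr {P : Matrix (Fin m) (Fin m) ℝ} (hP : P.det ≠ 0) (r s : ℕ)
    (a b : Fin m) : mixedNewton G A B r s a b = ∑ a', ∑ b', P a a' * P b b' *
      mixedNewton (Pᵀ * G * P) (Pᵀ * A * P) (Pᵀ * B * P) r s a' b' := by
  have h : ∑ a', ∑ b', C (P a a' * P b b') *
      (X 0 * (pencil (Pᵀ * G * P) (Pᵀ * A * P) (Pᵀ * B * P)).adjugate b' a')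
      = C (P.det * P.det) * (X 0 * (pencil G A B).adjugate b a) := by
    have h2 : P.map C * (pencil (Pᵀ * G * P) (Pᵀ * A * P) (Pᵀ * B * P)).adjugate * (P.map C)ᵀ
        = (C (P.det * P.det) : MvPolynomial (Fin 2) ℝ) • (pencil G A B).adjugate := by
      rw [congr_eq, adjugate_mul_distrib, adjugate_mul_distrib]
      simp only [← Matrix.mul_assoc]
      rw [Matrix.mul_adjugate, Matrix.smul_mul, Matrix.one_mul, Matrix.smul_mul, Matrix.smul_mul,
        Matrix.mul_assoc (adjugate _), Matrix.adjugate_mul, det_transpose, det_map_C,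
        Matrix.mul_smul, Matrix.mul_one, smul_smul, ← C_mul]
    have h3 := congrFun (congrFun h2 b) a
    simp only [Matrix.mul_apply, Matrix.smul_apply, smul_eq_mul, Matrix.map_apply,
      Matrix.transpose_apply] at h3
    rw [mul_left_comm, ← h3, Finset.mul_sum]
    refine Finset.sum_congr rfl fun a' _ => ?_
    rw [Finset.sum_mul, Finset.mul_sum]
    refine Finset.sum_congr rfl fun b' _ => ?_
    rw [C_mul]
    ring
  have h4 := congrArg (coeff (expo r s)) h
  simp only [coeff_sum, coeff_C_mul] at h4
  simp only [mixedNewton_eq, det_mul, det_transpose]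
  have h5 : (coeff (expo r s)) (X 0 * (pencil G A B).adjugate b a)
      = (∑ a', ∑ b', P a a' * P b b' * coeff (expo r s)
        (X 0 * (pencil (Pᵀ * G * P) (Pᵀ * A * P) (Pᵀ * B * P)).adjugate b' a'))
          / (P.det * P.det) := by
    rw [h4]
    field_simp
  rw [h5, Finset.sum_div, Finset.sum_div, Finset.mul_sum]
  refine Finset.sum_congr rfl fun a' _ => ?_
  rw [Finset.sum_div, Finset.sum_div, Finset.mul_sum]
  refine Finset.sum_congr rfl fun b' _ => ?_
  field_simp

theorem pderiv_map (i : Fin 2) :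
    (pencil G A B).map (pderiv i) = (if i = 0 then A else B).map C := by
  refine Matrix.ext fun a b => ?_
  simp only [Matrix.map_apply, pencil, of_apply, map_add, Derivation.leibniz, pderiv_C, pderiv_X,
    zero_add, smul_eq_mul, Pi.single_apply]
  fin_cases i <;> simp

theorem pderiv_zero_det :
    pderiv 0 (pencil G A B).det = trace ((pencil G A B).adjugate * A.map C) := by
  rw [Derivation.map_det, pderiv_map]
  simp

theorem pderiv_one_det :
    pderiv 1 (pencil G A B).det = trace ((pencil G A B).adjugate * B.map C) := by
  rw [Derivation.map_det, pderiv_map]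
  simp

theorem coeff_X_mul_pderiv (k : Fin 2 →₀ ℕ) (i : Fin 2) (p : MvPolynomial (Fin 2) ℝ) :
    coeff k (X i * pderiv i p) = k i * coeff k p := by
  classical
  induction p using MvPolynomial.induction_on' with
  | monomial u a =>
    rw [pderiv_monomial, X, monomial_mul, coeff_monomial, coeff_monomial]
    by_cases hu : u i = 0
    · by_cases h : u = k
      · subst h; simp [hu]
      · simp [hu, h]
    · have h1 : Finsupp.single i 1 + (u - Finsupp.single i 1) = u := by
        ext j
        by_cases hj : j = i
        · subst hj
          simp
          omega
        · simp [Ne.symm hj]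
      rw [h1]
      split_ifs with h
      · subst h; ring
      · ring
  | add p q hp hq => simp only [map_add, mul_add, coeff_add, hp, hq]

/-- `T_{r+1,s}^{ab} χ_ab = (r + 1) P_{r+1,s}`, at the level of the generating polynomial. -/
theorem coeff_trace_mul_snd (r s : ℕ) :
    coeff (expo r s) (trace ((pencil G A B).adjugate * A.map C))
      = (r + 1) * coeff (expo (r + 1) s) (pencil G A B).det := by
  have h := coeff_X_mul_pderiv (expo (r + 1) s) 0 (pencil G A B).det
  rw [expo_zero, pderiv_zero_det, coeff_expo_succ_X_mul] at h
  rw [h]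
  push_cast
  rfl

/-- `σ_ab T_{r+1,s}^{ab}` in terms of `P_{r,s}`, at the level of the generating polynomial; this is
Euler's identity for `det (σ + y χ + y̲ χ̲)`. -/
theorem coeff_trace_mul_fst (r s : ℕ) :
    coeff (expo r s) (trace ((pencil G A B).adjugate * G.map C))
      = ((m : ℝ) - r - s) * coeff (expo r s) (pencil G A B).det := by
  have h : trace ((pencil G A B).adjugate * G.map C)
      = C (m : ℝ) * (pencil G A B).det - X 0 * pderiv 0 (pencil G A B).det
        - X 1 * pderiv 1 (pencil G A B).det := by
    have h1 : trace ((pencil G A B).adjugate * pencil G A B) = C (m : ℝ) * (pencil G A B).det := by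
      rw [adjugate_mul, trace_smul, trace_one]
      simp [mul_comm]
    rw [← h1, pderiv_zero_det, pderiv_one_det]
    nth_rewrite 3 [eq_map]
    rw [Matrix.mul_add, Matrix.mul_add, trace_add, trace_add, Matrix.mul_smul, Matrix.mul_smul,
      trace_smul, trace_smul, smul_eq_mul, smul_eq_mul]
    ring
  rw [h, coeff_sub, coeff_sub, coeff_C_mul, coeff_X_mul_pderiv, coeff_X_mul_pderiv, expo_zero,
    expo_one]
  ring

theorem mixedCurvature_swap (r s : ℕ) : mixedCurvature G A B r s = mixedCurvature G B A s r := by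
  have h : (pencil G B A).det = rename (Equiv.swap (0 : Fin 2) 1) (pencil G A B).det := by
    rw [AlgHom.map_det]
    congr 1
    refine Matrix.ext fun a b => ?_
    simp [pencil]
    ring
  have h2 : expo s r = (expo r s).mapDomain (Equiv.swap (0 : Fin 2) 1) := by
    simp [expo, Finsupp.mapDomain_add, Finsupp.mapDomain_single, add_comm]
  rw [mixedCurvature_eq, mixedCurvature_eq, h, h2,
    coeff_rename_mapDomain _ (Equiv.swap (0 : Fin 2) 1).injective]
  simp only [mixedFactor, mul_comm (r ! : ℝ), add_comm r s]

theorem mixedNewtonBar_eq (r s : ℕ) (a b : Fin m) :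
    mixedNewtonBar G A B r s a b = mixedNewton G B A s r a b := by
  simp only [mixedNewtonBar, mixedNewton, mixedCurvature_swap G A]

end pencil

theorem mixedFactor_succ (r s : ℕ) :
    mixedFactor (r + 1) s = mixedFactor r s * ((r + 1) / (r + 1 + s)) := by
  have h1 : ((r + 1 + s) ! : ℝ) = (r + 1 + s) * ((r + s) ! : ℝ) := by
    rw [show r + 1 + s = (r + s) + 1 by ring, Nat.factorial_succ]
    push_cast
    ring
  have h2 : ((r + s) ! : ℝ) ≠ 0 := by positivity
  have h3 : (r + 1 + s : ℝ) ≠ 0 := by positivity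
  rw [mixedFactor, mixedFactor, h1, Nat.factorial_succ]
  push_cast
  field_simp

/-! ### The Levi-Civita connection in coordinates -/

/-- The model space `ℝᵏ`. -/
abbrev Model (k : ℕ) : Type := EuclideanSpace ℝ (Fin k)

/-- A field of bilinear forms on (a subset of) `ℝᵈ`. -/
abbrev FormField (d : ℕ) : Type := Model d → Model d →L[ℝ] Model d →L[ℝ] ℝ

theorem two_le_infty : minSmoothness ℝ 2 ≤ (∞ : WithTop ℕ∞) := by
  rw [minSmoothness_of_isRCLikeNormedField]
  exact WithTop.coe_le_coe.2 (le_top : (2 : ℕ∞) ≤ ⊤)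

namespace Coord

variable {m d : ℕ}

/-- `h` is a smooth nondegenerate symmetric form on the open set `Ω`. -/
structure IsMetricOn (h : FormField d) (Ω : Set (Model d)) : Prop where
  isOpen : IsOpen Ω
  smooth : ContDiffOn ℝ ∞ h Ω
  symm : ∀ y ∈ Ω, ∀ u v, h y u v = h y v u
  nondeg : ∀ y ∈ Ω, ∀ u, (∀ v, h y u v = 0) → u = 0

/-- The Christoffel symbols of the first kind, as a continuous trilinear form. -/
def christoffelFirstL (h : FormField d) (y : Model d) :
    Model d →L[ℝ] Model d →L[ℝ] Model d →L[ℝ] ℝ :=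
  (1 / 2 : ℝ) • (fderiv ℝ h y + (fderiv ℝ h y).flip
    - ((ContinuousLinearMap.flipₗᵢ ℝ (Model d) (Model d) ℝ :
        (Model d →L[ℝ] Model d →L[ℝ] ℝ) →L[ℝ] (Model d →L[ℝ] Model d →L[ℝ] ℝ)) ∘L
        (fderiv ℝ h y).flip))

/-- The Christoffel symbols of the second kind, as a continuous bilinear map. -/
def christoffelL (h : FormField d) (y : Model d) : Model d →L[ℝ] Model d →L[ℝ] Model d :=
  (ContinuousLinearMap.compL ℝ (Model d) (Model d →L[ℝ] ℝ) (Model d) (h y).inverse) ∘L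
    christoffelFirstL h y

theorem christoffelL_apply (h : FormField d) (y u v : Model d) :
    christoffelL h y u v = christoffel h y u v := rfl

/-- The covariant derivative `D_u ℓ` of a vector field `ℓ` along a map `Φ`. -/
def alongDeriv (h : FormField d) (Φ ℓ : Model m → Model d) (x u : Model m) : Model d :=
  fderiv ℝ ℓ x u + christoffel h (Φ x) (fderiv ℝ Φ x u) (ℓ x)

/-- The product rule for `z ↦ q_{Φ z}(ℓ z, k z)`. -/
theorem fderiv_form_apply {q : FormField d} {Φ ℓ k : Model m → Model d} {x : Model m}
    (hq : DifferentiableAt ℝ q (Φ x)) (hΦ : DifferentiableAt ℝ Φ x)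
    (hℓ : DifferentiableAt ℝ ℓ x) (hk : DifferentiableAt ℝ k x) (u : Model m) :
    fderiv ℝ (fun z => q (Φ z) (ℓ z) (k z)) x u
      = fderiv ℝ q (Φ x) (fderiv ℝ Φ x u) (ℓ x) (k x)
        + q (Φ x) (fderiv ℝ ℓ x u) (k x) + q (Φ x) (ℓ x) (fderiv ℝ k x u) := by
  have h1 : HasFDerivAt (fun z => q (Φ z)) ((fderiv ℝ q (Φ x)).comp (fderiv ℝ Φ x)) x :=
    HasFDerivAt.comp (g := q) x hq.hasFDerivAt hΦ.hasFDerivAt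
  have h2 := (h1.clm_apply hℓ.hasFDerivAt).clm_apply hk.hasFDerivAt
  rw [h2.fderiv]
  simp
  ring

namespace IsMetricOn

variable {h : FormField d} {Ω : Set (Model d)} (H : IsMetricOn h Ω)
include H

theorem contDiffAt {y : Model d} (hy : y ∈ Ω) : ContDiffAt ℝ ∞ h y :=
  H.smooth.contDiffAt (H.isOpen.mem_nhds hy)

theorem differentiableAt {y : Model d} (hy : y ∈ Ω) : DifferentiableAt ℝ h y :=
  (H.contDiffAt hy).differentiableAt (by simp)

theorem exists_equiv {y : Model d} (hy : y ∈ Ω) :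
    ∃ e : Model d ≃L[ℝ] (Model d →L[ℝ] ℝ), (e : Model d →L[ℝ] (Model d →L[ℝ] ℝ)) = h y := by
  have hinj : Function.Injective (h y : Model d →ₗ[ℝ] (Model d →L[ℝ] ℝ)) := by
    rw [← LinearMap.ker_eq_bot, LinearMap.ker_eq_bot']
    intro u hu
    exact H.nondeg y hy u fun v => by
      have := congrArg (fun α : Model d →L[ℝ] ℝ => α v) hu
      simpa using this
  have hfin : Module.finrank ℝ (Model d) = Module.finrank ℝ (Model d →L[ℝ] ℝ) :=
    (InnerProductSpace.toDual ℝ (Model d)).toLinearEquiv.finrank_eq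
  refine ⟨(LinearMap.linearEquivOfInjective _ hinj hfin).toContinuousLinearEquiv, ?_⟩
  ext u v
  rfl

theorem form_sharp {y : Model d} (hy : y ∈ Ω) (α : Model d →L[ℝ] ℝ) (v : Model d) :
    h y (sharp h y α) v = α v := by
  obtain ⟨e, he⟩ := H.exists_equiv hy
  rw [sharp, ← he, ContinuousLinearMap.inverse_equiv]
  simp

theorem form_ext {y : Model d} (hy : y ∈ Ω) {u v : Model d} (huv : ∀ w, h y u w = h y v w) :
    u = v := by
  rw [← sub_eq_zero]
  exact H.nondeg y hy _ fun w => by simp [huv w]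

theorem form_christoffel {y : Model d} (hy : y ∈ Ω) (u v w : Model d) :
    h y (christoffel h y u v) w
      = 1 / 2 * (fderiv ℝ h y u v w + fderiv ℝ h y v u w - fderiv ℝ h y w u v) := by
  rw [christoffel, H.form_sharp hy]
  rfl

theorem fderiv_symm {y : Model d} (hy : y ∈ Ω) (w u v : Model d) :
    fderiv ℝ h y w u v = fderiv ℝ h y w v u := by
  have h1 : ∀ u v, fderiv ℝ (fun z => h z u v) y w = fderiv ℝ h y w u v := by
    intro u v
    have := fderiv_form_apply (q := h) (Φ := fun z : Model d => z) (ℓ := fun _ => u)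
      (k := fun _ => v) (x := y) (H.differentiableAt hy) differentiableAt_id (by fun_prop)
      (by fun_prop) w
    simpa using this
  rw [← h1, ← h1]
  congr 1
  refine Filter.EventuallyEq.fderiv_eq ?_
  filter_upwards [H.isOpen.mem_nhds hy] with z hz using H.symm z hz u v

theorem christoffel_symm {y : Model d} (hy : y ∈ Ω) (u v : Model d) :
    christoffel h y u v = christoffel h y v u := by
  refine H.form_ext hy fun w => ?_
  rw [H.form_christoffel hy, H.form_christoffel hy, H.fderiv_symm hy w u v]
  ring

/-- The connection is compatible with the metric. -/
theorem fderiv_eq {y : Model d} (hy : y ∈ Ω) (w u v : Model d) :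
    fderiv ℝ h y w u v = h y (christoffel h y w u) v + h y u (christoffel h y w v) := by
  rw [H.symm y hy u, H.form_christoffel hy, H.form_christoffel hy, H.fderiv_symm hy w v u,
    H.fderiv_symm hy u w v, H.fderiv_symm hy v w u]
  ring

theorem contDiffAt_christoffelL {y : Model d} (hy : y ∈ Ω) :
    ContDiffAt ℝ ∞ (christoffelL h) y := by
  have h0 : ContDiffAt ℝ ∞ (fderiv ℝ h) y := (H.contDiffAt hy).fderiv_right (by simp)
  have h1 : ContDiffAt ℝ ∞ (fun z => (h z).inverse) y := by
    obtain ⟨e, he⟩ := H.exists_equiv hy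
    have := contDiffAt_map_inverse (n := ∞) e
    rw [he] at this
    exact this.comp y (H.contDiffAt hy)
  have hflip : ContDiffAt ℝ ∞ (fun z => (fderiv ℝ h z).flip) y :=
    (ContinuousLinearMap.flipₗᵢ ℝ (Model d) (Model d)
      (Model d →L[ℝ] ℝ)).toContinuousLinearEquiv.contDiff.contDiffAt.comp y h0
  have h2 : ContDiffAt ℝ ∞ (christoffelFirstL h) y :=
    ((h0.add hflip).sub (contDiffAt_const.clm_comp hflip)).const_smul (1 / 2 : ℝ)
  exact ((ContinuousLinearMap.compL ℝ (Model d) (Model d →L[ℝ] ℝ)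
    (Model d)).contDiff.contDiffAt.comp y h1).clm_comp h2

theorem fderiv_christoffel {y : Model d} (hy : y ∈ Ω) (u v w : Model d) :
    fderiv ℝ (fun z => christoffel h z v w) y u = fderiv ℝ (christoffelL h) y u v w := by
  have h1 : HasFDerivAt (christoffelL h) (fderiv ℝ (christoffelL h) y) y :=
    ((H.contDiffAt_christoffelL hy).differentiableAt (by simp)).hasFDerivAt
  have h2 := (h1.clm_apply (hasFDerivAt_const v y)).clm_apply (hasFDerivAt_const w y)
  have h3 : (fun z => christoffel h z v w) = fun z => christoffelL h z v w := rfl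
  rw [h3, h2.fderiv]
  simp

section Along

variable {Φ ℓ k : Model m → Model d} {x : Model m}

theorem fderiv_along (hx : Φ x ∈ Ω) (hΦ : DifferentiableAt ℝ Φ x)
    (hℓ : DifferentiableAt ℝ ℓ x) (hk : DifferentiableAt ℝ k x) (u : Model m) :
    fderiv ℝ (fun z => h (Φ z) (ℓ z) (k z)) x u
      = h (Φ x) (alongDeriv h Φ ℓ x u) (k x) + h (Φ x) (ℓ x) (alongDeriv h Φ k x u) := by
  rw [fderiv_form_apply (H.differentiableAt hx) hΦ hℓ hk, H.fderiv_eq hx, alongDeriv, alongDeriv]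
  simp only [map_add, add_apply]
  ring

omit H in
theorem fderiv_along_form {q : FormField d} (hq : DifferentiableAt ℝ q (Φ x))
    (hΦ : DifferentiableAt ℝ Φ x)
    (hℓ : DifferentiableAt ℝ ℓ x) (hk : DifferentiableAt ℝ k x) (u : Model m) :
    fderiv ℝ (fun z => q (Φ z) (ℓ z) (k z)) x u
      = covDerivForm h q (Φ x) (fderiv ℝ Φ x u) (ℓ x) (k x)
        + q (Φ x) (alongDeriv h Φ ℓ x u) (k x) + q (Φ x) (ℓ x) (alongDeriv h Φ k x u) := by
  rw [fderiv_form_apply hq hΦ hℓ hk, alongDeriv, alongDeriv, covDerivForm]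
  simp only [map_add, add_apply]
  ring

omit H in
theorem alongDeriv_tangent_eq (hΦ : ContDiffAt ℝ ∞ Φ x) (u v : Model m) :
    alongDeriv h Φ (fun z => fderiv ℝ Φ z v) x u = fderiv ℝ (fderiv ℝ Φ) x u v
      + christoffelL h (Φ x) (fderiv ℝ Φ x u) (fderiv ℝ Φ x v) := by
  have h1 : HasFDerivAt (fderiv ℝ Φ) (fderiv ℝ (fderiv ℝ Φ) x) x :=
    ((hΦ.fderiv_right (m := ∞) (by simp)).differentiableAt (by simp)).hasFDerivAt
  rw [alongDeriv, (h1.clm_apply (hasFDerivAt_const v x)).fderiv, christoffelL_apply]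
  simp

/-- The connection is torsion free. -/
theorem alongDeriv_tangent_symm (hx : Φ x ∈ Ω) (hΦ : ContDiffAt ℝ ∞ Φ x) (u v : Model m) :
    alongDeriv h Φ (fun z => fderiv ℝ Φ z v) x u
      = alongDeriv h Φ (fun z => fderiv ℝ Φ z u) x v := by
  rw [alongDeriv_tangent_eq hΦ, alongDeriv_tangent_eq hΦ, christoffelL_apply, christoffelL_apply,
    H.christoffel_symm hx, (hΦ.isSymmSndFDerivAt two_le_infty).eq u v]

theorem contDiffAt_alongDeriv (hx : Φ x ∈ Ω) (hΦ : ContDiffAt ℝ ∞ Φ x)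
    (hℓ : ContDiffAt ℝ ∞ ℓ x) (v : Model m) :
    ContDiffAt ℝ ∞ (fun z => alongDeriv h Φ ℓ z v) x := by
  have h1 : ContDiffAt ℝ ∞ (fun z => christoffelL h (Φ z)) x :=
    (H.contDiffAt_christoffelL hx).comp x hΦ
  exact ((hℓ.fderiv_right (m := ∞) (by simp)).clm_apply contDiffAt_const).add
    ((h1.clm_apply ((hΦ.fderiv_right (m := ∞) (by simp)).clm_apply contDiffAt_const)).clm_apply hℓ)

/-- The second covariant derivatives commute up to the curvature. -/
theorem alongDeriv_comm (hx : Φ x ∈ Ω) (hΦ : ContDiffAt ℝ ∞ Φ x)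
    (hℓ : ContDiffAt ℝ ∞ ℓ x) (u v : Model m) :
    alongDeriv h Φ (fun z => alongDeriv h Φ ℓ z v) x u
      - alongDeriv h Φ (fun z => alongDeriv h Φ ℓ z u) x v
      = curvature h (Φ x) (fderiv ℝ Φ x u) (fderiv ℝ Φ x v) (ℓ x) := by
  have hΓ : HasFDerivAt (fun z => christoffelL h (Φ z))
      ((fderiv ℝ (christoffelL h) (Φ x)).comp (fderiv ℝ Φ x)) x :=
    ((H.contDiffAt_christoffelL hx).differentiableAt (by simp)).hasFDerivAt.comp x
      (hΦ.differentiableAt (by simp)).hasFDerivAt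
  have hdΦ : HasFDerivAt (fderiv ℝ Φ) (fderiv ℝ (fderiv ℝ Φ) x) x :=
    ((hΦ.fderiv_right (m := ∞) (by simp)).differentiableAt (by simp)).hasFDerivAt
  have hdℓ : HasFDerivAt (fderiv ℝ ℓ) (fderiv ℝ (fderiv ℝ ℓ) x) x :=
    ((hℓ.fderiv_right (m := ∞) (by simp)).differentiableAt (by simp)).hasFDerivAt
  have hℓ' : HasFDerivAt ℓ (fderiv ℝ ℓ x) x := (hℓ.differentiableAt (by simp)).hasFDerivAt
  have key : ∀ u v, fderiv ℝ (fun z => alongDeriv h Φ ℓ z v) x u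
      = fderiv ℝ (fderiv ℝ ℓ) x u v
        + (fderiv ℝ (christoffelL h) (Φ x) (fderiv ℝ Φ x u) (fderiv ℝ Φ x v) (ℓ x)
        + christoffelL h (Φ x) (fderiv ℝ (fderiv ℝ Φ) x u v) (ℓ x)
        + christoffelL h (Φ x) (fderiv ℝ Φ x v) (fderiv ℝ ℓ x u)) := by
    intro u v
    have h1 := (hdℓ.clm_apply (hasFDerivAt_const v x)).add
      ((hΓ.clm_apply (hdΦ.clm_apply (hasFDerivAt_const v x))).clm_apply hℓ')
    have h2 : (fun z => alongDeriv h Φ ℓ z v) = (fun z => fderiv ℝ ℓ z v)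
      + fun z => christoffelL h (Φ z) (fderiv ℝ Φ z v) (ℓ z) := rfl
    rw [h2, h1.fderiv]
    simp
    abel
  have expand : ∀ u v, alongDeriv h Φ (fun z => alongDeriv h Φ ℓ z v) x u
      = fderiv ℝ (fun z => alongDeriv h Φ ℓ z v) x u
        + christoffel h (Φ x) (fderiv ℝ Φ x u) (alongDeriv h Φ ℓ x v) := fun _ _ => rfl
  rw [expand, expand, key, key, curvature, H.fderiv_christoffel hx,
    H.fderiv_christoffel hx, (hΦ.isSymmSndFDerivAt two_le_infty).eq u v,
    (hℓ.isSymmSndFDerivAt two_le_infty).eq u v, alongDeriv, alongDeriv]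
  simp only [← christoffelL_apply, map_add]
  abel

omit H in
theorem alongDeriv_smul {f : Model m → ℝ} (hf : DifferentiableAt ℝ f x)
    (hℓ : DifferentiableAt ℝ ℓ x) (u : Model m) :
    alongDeriv h Φ (fun z => f z • ℓ z) x u
      = fderiv ℝ f x u • ℓ x + f x • alongDeriv h Φ ℓ x u := by
  rw [alongDeriv, alongDeriv, (hf.hasFDerivAt.fun_smul hℓ.hasFDerivAt).fderiv,
    ← christoffelL_apply, ← christoffelL_apply]
  simp
  abel

omit H in
theorem alongDeriv_add (hℓ : DifferentiableAt ℝ ℓ x) (hk : DifferentiableAt ℝ k x)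
    (u : Model m) :
    alongDeriv h Φ (fun z => ℓ z + k z) x u = alongDeriv h Φ ℓ x u + alongDeriv h Φ k x u := by
  rw [alongDeriv, alongDeriv, alongDeriv, (hℓ.hasFDerivAt.fun_add hk.hasFDerivAt).fderiv,
    ← christoffelL_apply, ← christoffelL_apply, ← christoffelL_apply]
  simp
  abel

omit H in
theorem alongDeriv_sum {ι : Type*} (s : Finset ι) {K : ι → Model m → Model d}
    (hK : ∀ i ∈ s, DifferentiableAt ℝ (K i) x) (u : Model m) :
    alongDeriv h Φ (fun z => ∑ i ∈ s, K i z) x u = ∑ i ∈ s, alongDeriv h Φ (K i) x u := by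
  simp only [alongDeriv, ← christoffelL_apply]
  rw [(HasFDerivAt.fun_sum fun i hi => (hK i hi).hasFDerivAt).fderiv, Finset.sum_add_distrib]
  simp

end Along

section Transform

variable {h' : FormField d} {Ω' : Set (Model d)} {τ : Model d → Model d}

/-- The transformation law of the Christoffel symbols under an isometry `τ`. -/
theorem christoffel_transform (H' : IsMetricOn h' Ω') (hmaps : Set.MapsTo τ Ω Ω')
    (hτ : ContDiffOn ℝ ∞ τ Ω)
    (hiso : ∀ y ∈ Ω, ∀ u v, h y u v = h' (τ y) (fderiv ℝ τ y u) (fderiv ℝ τ y v))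
    {y : Model d} (hy : y ∈ Ω) (u v : Model d) :
    fderiv ℝ τ y (christoffel h y u v)
      = christoffel h' (τ y) (fderiv ℝ τ y u) (fderiv ℝ τ y v)
        + fderiv ℝ (fderiv ℝ τ) y u v := by
  have hτy : ContDiffAt ℝ ∞ τ y := hτ.contDiffAt (H.isOpen.mem_nhds hy)
  have hinj : Function.Injective (fderiv ℝ τ y : Model d →ₗ[ℝ] Model d) := by
    rw [← LinearMap.ker_eq_bot, LinearMap.ker_eq_bot']
    intro w hw
    refine H.nondeg y hy w fun v => ?_
    rw [hiso y hy]
    have hw' : fderiv ℝ τ y w = 0 := hw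
    simp [hw']
  have hsurj := LinearMap.injective_iff_surjective.1 hinj
  have hD : ∀ w u v, fderiv ℝ h y w u v
      = fderiv ℝ h' (τ y) (fderiv ℝ τ y w) (fderiv ℝ τ y u) (fderiv ℝ τ y v)
        + h' (τ y) (fderiv ℝ (fderiv ℝ τ) y w u) (fderiv ℝ τ y v)
        + h' (τ y) (fderiv ℝ τ y u) (fderiv ℝ (fderiv ℝ τ) y w v) := by
    intro w u v
    have hdτ : DifferentiableAt ℝ (fderiv ℝ τ) y :=
      (hτy.fderiv_right (m := ∞) (by simp)).differentiableAt (by simp)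
    have happ : ∀ u, HasFDerivAt (fun z => fderiv ℝ τ z u) ((fderiv ℝ (fderiv ℝ τ) y).flip u) y := by
      intro u
      simpa using hdτ.hasFDerivAt.clm_apply (hasFDerivAt_const u y)
    have h1 := fderiv_form_apply (q := h) (Φ := fun z : Model d => z) (ℓ := fun _ => u)
      (k := fun _ => v) (x := y) (H.differentiableAt hy) differentiableAt_id (by fun_prop)
      (by fun_prop) w
    have h2 := fderiv_form_apply (q := h') (Φ := τ) (ℓ := fun z => fderiv ℝ τ z u)
      (k := fun z => fderiv ℝ τ z v) (x := y) (H'.differentiableAt (hmaps hy))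
      (hτy.differentiableAt (by simp)) (happ u).differentiableAt (happ v).differentiableAt w
    have h3 : (fun z => h z u v) =ᶠ[nhds y]
        fun z => h' (τ z) (fderiv ℝ τ z u) (fderiv ℝ τ z v) := by
      filter_upwards [H.isOpen.mem_nhds hy] with z hz using hiso z hz u v
    rw [h3.fderiv_eq, h2, (happ u).fderiv, (happ v).fderiv] at h1
    simpa using h1.symm
  refine H'.form_ext (hmaps hy) fun w' => ?_
  obtain ⟨w, hw⟩ := hsurj w'
  have hw' : fderiv ℝ τ y w = w' := hw
  have hsymm := (hτy.isSymmSndFDerivAt two_le_infty).eq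
  rw [← hw', ← hiso y hy, H.form_christoffel hy, map_add, add_apply,
    H'.form_christoffel (hmaps hy), hD, hD, hD, hsymm v u, hsymm w u, hsymm w v,
    H'.symm _ (hmaps hy) (fderiv ℝ τ y u) (fderiv ℝ (fderiv ℝ τ) y v w),
    H'.symm _ (hmaps hy) (fderiv ℝ τ y v) (fderiv ℝ (fderiv ℝ τ) y u w)]
  ring

end Transform

end IsMetricOn

end Coord

namespace Coord
variable {m d : ℕ}

section Transform

variable {h h' : FormField d} {Ω Ω' : Set (Model d)} {τ : Model d → Model d}

/-- The covariant derivative along a map does not depend on the coordinates of the target. -/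
theorem alongDeriv_transform (H : IsMetricOn h Ω) (H' : IsMetricOn h' Ω')
    (hmaps : Set.MapsTo τ Ω Ω') (hτ : ContDiffOn ℝ ∞ τ Ω)
    (hiso : ∀ y ∈ Ω, ∀ u v, h y u v = h' (τ y) (fderiv ℝ τ y u) (fderiv ℝ τ y v))
    {Φ ℓ : Model m → Model d} {x : Model m} (hx : Φ x ∈ Ω) (hΦ : DifferentiableAt ℝ Φ x)
    (hℓ : DifferentiableAt ℝ ℓ x) (u : Model m) :
    alongDeriv h' (fun z => τ (Φ z)) (fun z => fderiv ℝ τ (Φ z) (ℓ z)) x u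
      = fderiv ℝ τ (Φ x) (alongDeriv h Φ ℓ x u) := by
  have hτx : ContDiffAt ℝ ∞ τ (Φ x) := hτ.contDiffAt (H.isOpen.mem_nhds hx)
  have h1 : HasFDerivAt (fun z => fderiv ℝ τ (Φ z))
      ((fderiv ℝ (fderiv ℝ τ) (Φ x)).comp (fderiv ℝ Φ x)) x :=
    HasFDerivAt.comp (g := fderiv ℝ τ) x
      ((hτx.fderiv_right (m := ∞) (by simp)).differentiableAt (by simp)).hasFDerivAt
      hΦ.hasFDerivAt
  have h2 : HasFDerivAt (fun z => τ (Φ z)) ((fderiv ℝ τ (Φ x)).comp (fderiv ℝ Φ x)) x :=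
    HasFDerivAt.comp (g := τ) x (hτx.differentiableAt (by simp)).hasFDerivAt hΦ.hasFDerivAt
  rw [alongDeriv, alongDeriv, (h1.clm_apply hℓ.hasFDerivAt).fderiv, h2.fderiv, map_add,
    H.christoffel_transform H' hmaps hτ hiso hx]
  simp
  abel

/-- The covariant derivative of a bilinear form does not depend on the coordinates. -/
theorem covDerivForm_transform (H : IsMetricOn h Ω) (H' : IsMetricOn h' Ω')
    (hmaps : Set.MapsTo τ Ω Ω') (hτ : ContDiffOn ℝ ∞ τ Ω)
    (hiso : ∀ y ∈ Ω, ∀ u v, h y u v = h' (τ y) (fderiv ℝ τ y u) (fderiv ℝ τ y v))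
    {q q' : FormField d}
    (hq : ∀ y ∈ Ω, ∀ u v, q y u v = q' (τ y) (fderiv ℝ τ y u) (fderiv ℝ τ y v))
    {y : Model d} (hy : y ∈ Ω) (hqd : DifferentiableAt ℝ q y) (hqd' : DifferentiableAt ℝ q' (τ y))
    (u v w : Model d) :
    covDerivForm h q y u v w
      = covDerivForm h' q' (τ y) (fderiv ℝ τ y u) (fderiv ℝ τ y v) (fderiv ℝ τ y w) := by
  have hτy : ContDiffAt ℝ ∞ τ y := hτ.contDiffAt (H.isOpen.mem_nhds hy)
  have hdτ : DifferentiableAt ℝ (fderiv ℝ τ) y :=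
    (hτy.fderiv_right (m := ∞) (by simp)).differentiableAt (by simp)
  have happ : ∀ u, HasFDerivAt (fun z => fderiv ℝ τ z u) ((fderiv ℝ (fderiv ℝ τ) y).flip u) y := by
    intro u
    simpa using hdτ.hasFDerivAt.clm_apply (hasFDerivAt_const u y)
  have h1 := fderiv_form_apply (q := q) (Φ := fun z : Model d => z) (ℓ := fun _ => v)
    (k := fun _ => w) (x := y) hqd differentiableAt_id (by fun_prop)
    (by fun_prop) u
  have h2 := fderiv_form_apply (q := q') (Φ := τ) (ℓ := fun z => fderiv ℝ τ z v)
    (k := fun z => fderiv ℝ τ z w) (x := y) hqd'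
    (hτy.differentiableAt (by simp)) (happ v).differentiableAt (happ w).differentiableAt u
  have h3 : (fun z => q z v w) =ᶠ[nhds y]
      fun z => q' (τ z) (fderiv ℝ τ z v) (fderiv ℝ τ z w) := by
    filter_upwards [H.isOpen.mem_nhds hy] with z hz using hq z hz v w
  have h4 : fderiv ℝ q y u v w = fderiv ℝ (fun z => q z v w) y u := by
    rw [h1]
    simp
  rw [covDerivForm, covDerivForm, h4, h3.fderiv_eq, h2, hq y hy, hq y hy,
    H.christoffel_transform H' hmaps hτ hiso hy, H.christoffel_transform H' hmaps hτ hiso hy,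
    (happ v).fderiv, (happ w).fderiv]
  simp
  ring

end Transform

theorem covDerivForm_alt {h q : FormField d} {Ω : Set (Model d)} (hΩ : IsOpen Ω)
    (hq : ∀ y ∈ Ω, ∀ u v, q y u v = - q y v u) {y : Model d} (hy : y ∈ Ω)
    (hqd : DifferentiableAt ℝ q y) (u v w : Model d) :
    covDerivForm h q y u v w = - covDerivForm h q y u w v := by
  have h1 : ∀ v w, fderiv ℝ (fun z => q z v w) y u = fderiv ℝ q y u v w := by
    intro v w
    have := fderiv_form_apply (q := q) (Φ := fun z : Model d => z) (ℓ := fun _ => v)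
      (k := fun _ => w) (x := y) hqd differentiableAt_id (by fun_prop)
      (by fun_prop) u
    simpa using this
  have h2 : (fun z => q z v w) =ᶠ[nhds y] fun z => - q z w v := by
    filter_upwards [hΩ.mem_nhds hy] with z hz using hq z hz v w
  rw [covDerivForm, covDerivForm, ← h1, ← h1, h2.fderiv_eq, fderiv_fun_neg,
    hq y hy (christoffel h y u v) w, hq y hy v]
  simp
  ring

/-! ### Spacelike submanifolds of codimension two with a parallel null frame, in coordinates -/

/-- The vectors of the coordinate frame. -/
def basisVec (a : Fin m) : Model m := EuclideanSpace.single a 1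

theorem sum_smul_basisVec (u : Model m) : ∑ a, u a • basisVec a = u := by
  have := (EuclideanSpace.basisFun (Fin m) ℝ).sum_repr u
  simpa [basisVec] using this

/-- A spacelike immersion `Φ : U → Ω` of codimension two into a space of constant curvature `κ`,
in coordinates, with a null frame `(ℓ, k)` of its normal bundle for which `ζ_ℓ = 0`. -/
structure IsParallelFrame (h : FormField d) (Ω : Set (Model d)) (κ : ℝ)
    (Φ ℓ k : Model m → Model d) (U : Set (Model m)) : Prop where
  metric : IsMetricOn h Ω
  curvature_eq : ∀ y ∈ Ω, ∀ u v w, curvature h y u v w = κ • (h y v w • u - h y u w • v)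
  dim_eq : d = m + 2
  isOpen : IsOpen U
  mapsTo : Set.MapsTo Φ U Ω
  smooth : ContDiffOn ℝ ∞ Φ U
  smooth_left : ContDiffOn ℝ ∞ ℓ U
  smooth_right : ContDiffOn ℝ ∞ k U
  pos : ∀ x ∈ U, ∀ u, u ≠ 0 → 0 < h (Φ x) (fderiv ℝ Φ x u) (fderiv ℝ Φ x u)
  normal_left : ∀ x ∈ U, ∀ u, h (Φ x) (ℓ x) (fderiv ℝ Φ x u) = 0
  normal_right : ∀ x ∈ U, ∀ u, h (Φ x) (k x) (fderiv ℝ Φ x u) = 0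
  null_left : ∀ x ∈ U, h (Φ x) (ℓ x) (ℓ x) = 0
  null_right : ∀ x ∈ U, h (Φ x) (k x) (k x) = 0
  pairing : ∀ x ∈ U, h (Φ x) (ℓ x) (k x) = -2
  torsion_eq : ∀ x ∈ U, ∀ u, h (Φ x) (alongDeriv h Φ ℓ x u) (k x) = 0

/-- The components `σ_ab` of the induced metric. -/
def gram (h : FormField d) (Φ : Model m → Model d) (x : Model m) : Matrix (Fin m) (Fin m) ℝ :=
  Matrix.of fun a b => h (Φ x) (fderiv ℝ Φ x (basisVec a)) (fderiv ℝ Φ x (basisVec b))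

/-- The components `χ_ab` of the second fundamental form with respect to `ℓ`. -/
def second (h : FormField d) (Φ ℓ : Model m → Model d) (x : Model m) :
    Matrix (Fin m) (Fin m) ℝ :=
  Matrix.of fun a b => h (Φ x) (alongDeriv h Φ ℓ x (basisVec a)) (fderiv ℝ Φ x (basisVec b))

/-- The components of the one-form `q(ℓ, ·)` on the submanifold. -/
def contract (q : FormField d) (Φ ℓ : Model m → Model d) (x : Model m) (a : Fin m) : ℝ :=
  q (Φ x) (ℓ x) (fderiv ℝ Φ x (basisVec a))

namespace IsParallelFrame

variable {h : FormField d} {Ω : Set (Model d)} {κ : ℝ} {Φ ℓ k : Model m → Model d}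
  {U : Set (Model m)} (P : IsParallelFrame h Ω κ Φ ℓ k U) {x : Model m}
include P

theorem contDiffAt (hx : x ∈ U) : ContDiffAt ℝ ∞ Φ x :=
  P.smooth.contDiffAt (P.isOpen.mem_nhds hx)
theorem contDiffAt_left (hx : x ∈ U) : ContDiffAt ℝ ∞ ℓ x :=
  P.smooth_left.contDiffAt (P.isOpen.mem_nhds hx)
theorem contDiffAt_right (hx : x ∈ U) : ContDiffAt ℝ ∞ k x :=
  P.smooth_right.contDiffAt (P.isOpen.mem_nhds hx)

theorem contDiffAt_tangent (hx : x ∈ U) (v : Model m) :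
    ContDiffAt ℝ ∞ (fun z => fderiv ℝ Φ z v) x :=
  ((P.contDiffAt hx).fderiv_right (m := ∞) (by simp)).clm_apply contDiffAt_const

theorem contDiffAt_form {q : FormField d} {a b : Model m → Model d}
    (hx : x ∈ U) (hq : ContDiffAt ℝ ∞ q (Φ x)) (ha : ContDiffAt ℝ ∞ a x)
    (hb : ContDiffAt ℝ ∞ b x) : ContDiffAt ℝ ∞ (fun z => q (Φ z) (a z) (b z)) x :=
  ((ContDiffAt.comp (g := q) x hq (P.contDiffAt hx)).clm_apply ha).clm_apply hb

theorem symm (hx : x ∈ U) (u v : Model d) : h (Φ x) u v = h (Φ x) v u :=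
  P.metric.symm _ (P.mapsTo hx) u v

theorem fderiv_form {a b : Model m → Model d} (hx : x ∈ U) (ha : ContDiffAt ℝ ∞ a x)
    (hb : ContDiffAt ℝ ∞ b x) (u : Model m) :
    fderiv ℝ (fun z => h (Φ z) (a z) (b z)) x u
      = h (Φ x) (alongDeriv h Φ a x u) (b x) + h (Φ x) (a x) (alongDeriv h Φ b x u) :=
  P.metric.fderiv_along (P.mapsTo hx) ((P.contDiffAt hx).differentiableAt (by simp))
    (ha.differentiableAt (by simp)) (hb.differentiableAt (by simp)) u

/-- Differentiating a constant scalar product. -/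
theorem form_alongDeriv_of_const {a b : Model m → Model d} (hx : x ∈ U)
    (ha : ContDiffAt ℝ ∞ a x) (hb : ContDiffAt ℝ ∞ b x) (c : ℝ)
    (hc : ∀ z ∈ U, h (Φ z) (a z) (b z) = c) (u : Model m) :
    h (Φ x) (alongDeriv h Φ a x u) (b x) = - h (Φ x) (a x) (alongDeriv h Φ b x u) := by
  have h1 := P.fderiv_form hx ha hb u
  have h2 : (fun z => h (Φ z) (a z) (b z)) =ᶠ[nhds x] fun _ => c := by
    filter_upwards [P.isOpen.mem_nhds hx] with z hz using hc z hz
  rw [h2.fderiv_eq] at h1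
  simp at h1
  linarith

theorem left_left (hx : x ∈ U) (u : Model m) : h (Φ x) (alongDeriv h Φ ℓ x u) (ℓ x) = 0 := by
  have h1 := P.form_alongDeriv_of_const hx (P.contDiffAt_left hx) (P.contDiffAt_left hx) 0
    P.null_left u
  rw [P.symm hx (ℓ x)] at h1
  linarith

theorem right_right (hx : x ∈ U) (u : Model m) : h (Φ x) (alongDeriv h Φ k x u) (k x) = 0 := by
  have h1 := P.form_alongDeriv_of_const hx (P.contDiffAt_right hx) (P.contDiffAt_right hx) 0
    P.null_right u
  rw [P.symm hx (k x)] at h1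
  linarith

theorem right_left (hx : x ∈ U) (u : Model m) : h (Φ x) (alongDeriv h Φ k x u) (ℓ x) = 0 := by
  have h1 := P.form_alongDeriv_of_const hx (P.contDiffAt_left hx) (P.contDiffAt_right hx) (-2)
    P.pairing u
  rw [P.torsion_eq x hx, P.symm hx (ℓ x)] at h1
  linarith

/-- Exchanging the two null fields. -/
theorem swap : IsParallelFrame h Ω κ Φ k ℓ U where
  metric := P.metric
  curvature_eq := P.curvature_eq
  dim_eq := P.dim_eq
  isOpen := P.isOpen
  mapsTo := P.mapsTo
  smooth := P.smooth
  smooth_left := P.smooth_right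
  smooth_right := P.smooth_left
  pos := P.pos
  normal_left := P.normal_right
  normal_right := P.normal_left
  null_left := P.null_right
  null_right := P.null_left
  pairing x hx := by rw [P.symm hx, P.pairing x hx]
  torsion_eq x hx u := P.right_left hx u

theorem left_tangent (hx : x ∈ U) (u v : Model m) :
    h (Φ x) (alongDeriv h Φ ℓ x u) (fderiv ℝ Φ x v)
      = - h (Φ x) (ℓ x) (alongDeriv h Φ (fun z => fderiv ℝ Φ z v) x u) :=
  P.form_alongDeriv_of_const hx (P.contDiffAt_left hx) (P.contDiffAt_tangent hx v) 0
    (fun z hz => P.normal_left z hz v) u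

theorem tangent_symm (hx : x ∈ U) (u v : Model m) :
    alongDeriv h Φ (fun z => fderiv ℝ Φ z v) x u = alongDeriv h Φ (fun z => fderiv ℝ Φ z u) x v :=
  P.metric.alongDeriv_tangent_symm (P.mapsTo hx) (P.contDiffAt hx) u v

theorem second_symm (hx : x ∈ U) (a b : Fin m) : second h Φ ℓ x a b = second h Φ ℓ x b a := by
  simp only [second, Matrix.of_apply]
  rw [P.left_tangent hx, P.left_tangent hx, P.tangent_symm hx]

theorem gram_symm (hx : x ∈ U) (a b : Fin m) : gram h Φ x a b = gram h Φ x b a :=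
  P.symm hx _ _

/-- The tangent vectors together with the two null normals span. -/
theorem exists_decomposition (hx : x ∈ U) (Y : Model d) :
    ∃ (u : Model m) (s t : ℝ), Y = fderiv ℝ Φ x u + s • ℓ x + t • k x := by
  let T : (Model m × ℝ × ℝ) →ₗ[ℝ] Model d :=
    ((fderiv ℝ Φ x : Model m →ₗ[ℝ] Model d).comp (LinearMap.fst ℝ _ _))
      + ((LinearMap.toSpanSingleton ℝ _ (ℓ x)).comp
          ((LinearMap.fst ℝ ℝ ℝ).comp (LinearMap.snd ℝ _ _)))
      + ((LinearMap.toSpanSingleton ℝ _ (k x)).comp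
          ((LinearMap.snd ℝ ℝ ℝ).comp (LinearMap.snd ℝ _ _)))
  have hT : ∀ u s t, T (u, s, t) = fderiv ℝ Φ x u + s • ℓ x + t • k x := fun u s t => rfl
  have hinj : Function.Injective T := by
    rw [← LinearMap.ker_eq_bot, LinearMap.ker_eq_bot']
    rintro ⟨u, s, t⟩ h0
    rw [hT] at h0
    have e1 := congrArg (fun Z => h (Φ x) (ℓ x) Z) h0
    have e2 := congrArg (fun Z => h (Φ x) (k x) Z) h0
    simp only [map_add, map_smul, smul_eq_mul, map_zero, P.normal_left x hx, P.normal_right x hx,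
      P.null_left x hx, P.null_right x hx, P.pairing x hx, P.symm hx (k x) (ℓ x)] at e1 e2
    have ht : t = 0 := by linarith
    have hs : s = 0 := by linarith
    subst ht hs
    have hu : u = 0 := by
      by_contra hu
      have := P.pos x hx u hu
      simp only [zero_smul, add_zero] at h0
      rw [h0] at this
      simp at this
    rw [hu]
    rfl
  have hfin : Module.finrank ℝ (Model m × ℝ × ℝ) = Module.finrank ℝ (Model d) := by
    rw [Module.finrank_prod, Module.finrank_prod, Module.finrank_self, finrank_euclideanSpace_fin,
      finrank_euclideanSpace_fin, P.dim_eq]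
  obtain ⟨⟨u, s, t⟩, hY⟩ := (LinearMap.injective_iff_surjective_of_finrank_eq_finrank hfin).1 hinj Y
  exact ⟨u, s, t, by rw [← hT, hY]⟩

theorem det_gram_pos (hx : x ∈ U) : 0 < (gram h Φ x).det := by
  have hpd : (gram h Φ x).PosDef := by
    refine Matrix.PosDef.of_dotProduct_mulVec_pos ?_ ?_
    · exact Matrix.ext fun a b => by
        simpa using P.gram_symm hx b a
    · intro v hv
      have h1 : (WithLp.toLp 2 v : Model m) ≠ 0 := by
        intro h0
        exact hv (by simpa using h0)
      have h2 := P.pos x hx _ h1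
      rw [← sum_smul_basisVec (WithLp.toLp 2 v : Model m)] at h2
      simp only [map_sum, map_smul, sum_apply, smul_apply, smul_eq_mul] at h2
      refine h2.trans_eq ?_
      simp only [dotProduct, Matrix.mulVec, gram, Matrix.of_apply, Finset.mul_sum]
      rw [Finset.sum_comm]
      refine Finset.sum_congr rfl fun a _ => Finset.sum_congr rfl fun b _ => ?_
      simp
      ring
  exact hpd.det_pos

theorem gram_inv_mul (hx : x ∈ U) : (gram h Φ x)⁻¹ * gram h Φ x = 1 :=
  Matrix.nonsing_inv_mul _ (P.det_gram_pos hx).ne'.isUnit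

theorem gram_mul_inv (hx : x ∈ U) : gram h Φ x * (gram h Φ x)⁻¹ = 1 :=
  Matrix.mul_nonsing_inv _ (P.det_gram_pos hx).ne'.isUnit

/-- The expansion of a tangent vector in the coordinate frame. -/
theorem eq_sum_of_tangent (hx : x ∈ U) {Y : Model d} (h1 : h (Φ x) Y (ℓ x) = 0)
    (h2 : h (Φ x) Y (k x) = 0) :
    Y = ∑ i, ∑ j, (h (Φ x) Y (fderiv ℝ Φ x (basisVec i)) * (gram h Φ x)⁻¹ i j) •
      fderiv ℝ Φ x (basisVec j) := by
  obtain ⟨u, s, t, rfl⟩ := P.exists_decomposition hx Y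
  have n1 : ∀ v, h (Φ x) (fderiv ℝ Φ x v) (ℓ x) = 0 := fun v => by
    rw [P.symm hx, P.normal_left x hx]
  have n2 : ∀ v, h (Φ x) (fderiv ℝ Φ x v) (k x) = 0 := fun v => by
    rw [P.symm hx, P.normal_right x hx]
  simp only [map_add, map_smul, add_apply, smul_apply, smul_eq_mul, n1, n2, P.null_left x hx,
    P.null_right x hx, P.pairing x hx, P.symm hx (k x) (ℓ x)] at h1 h2
  have ht : t = 0 := by linarith
  have hs : s = 0 := by linarith
  subst ht hs
  simp only [zero_smul, add_zero]
  have h3 : ∀ i, h (Φ x) (fderiv ℝ Φ x u) (fderiv ℝ Φ x (basisVec i))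
      = ∑ a, u a * gram h Φ x a i := by
    intro i
    conv_lhs => rw [← sum_smul_basisVec u]
    simp only [map_sum, map_smul, sum_apply, smul_apply, smul_eq_mul]
    rfl
  conv_lhs => rw [← sum_smul_basisVec u]
  rw [map_sum, Finset.sum_comm]
  refine Finset.sum_congr rfl fun j _ => ?_
  rw [map_smul, ← Finset.sum_smul]
  congr 1
  simp only [h3, Finset.sum_mul, mul_assoc]
  rw [Finset.sum_comm]
  simp only [← Finset.mul_sum, ← Matrix.mul_apply, P.gram_mul_inv hx]
  simp [Matrix.one_apply]

theorem form_eq_of_tangent (hx : x ∈ U) {Y : Model d} (h1 : h (Φ x) Y (ℓ x) = 0)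
    (h2 : h (Φ x) Y (k x) = 0) (α : Model d →L[ℝ] ℝ) :
    α Y = ∑ i, ∑ j, h (Φ x) Y (fderiv ℝ Φ x (basisVec i)) * (gram h Φ x)⁻¹ i j *
      α (fderiv ℝ Φ x (basisVec j)) := by
  conv_lhs => rw [P.eq_sum_of_tangent hx h1 h2]
  simp [map_sum]

/-- The normal curvature vanishes, by constant curvature and `ζ = 0`. -/
theorem commute_form (hx : x ∈ U) (u v : Model m) :
    h (Φ x) (alongDeriv h Φ ℓ x u) (alongDeriv h Φ k x v)
      = h (Φ x) (alongDeriv h Φ ℓ x v) (alongDeriv h Φ k x u) := by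
  have h1 : ∀ u v, h (Φ x) (alongDeriv h Φ (fun z => alongDeriv h Φ ℓ z v) x u) (k x)
      = - h (Φ x) (alongDeriv h Φ ℓ x v) (alongDeriv h Φ k x u) := fun u v =>
    P.form_alongDeriv_of_const hx (P.metric.contDiffAt_alongDeriv (P.mapsTo hx) (P.contDiffAt hx)
      (P.contDiffAt_left hx) v) (P.contDiffAt_right hx) 0 (fun z hz => P.torsion_eq z hz v) u
  have h2 := congrArg (fun Z => h (Φ x) Z (k x)) (P.metric.alongDeriv_comm (P.mapsTo hx)
    (P.contDiffAt hx) (P.contDiffAt_left hx) u v)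
  simp only [map_sub, sub_apply, h1, P.curvature_eq _ (P.mapsTo hx)] at h2
  rw [P.symm hx _ (ℓ x), P.symm hx _ (ℓ x), P.normal_left x hx, P.normal_left x hx] at h2
  simp at h2
  linarith

/-- The Ricci equation: in constant curvature and for a parallel null frame the two second
fundamental forms commute. -/
theorem second_commute (hx : x ∈ U) :
    second h Φ ℓ x * (gram h Φ x)⁻¹ * second h Φ k x
      = second h Φ k x * (gram h Φ x)⁻¹ * second h Φ ℓ x := by
  have h1 : ∀ a b, (second h Φ ℓ x * (gram h Φ x)⁻¹ * second h Φ k x) a b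
      = h (Φ x) (alongDeriv h Φ ℓ x (basisVec a)) (alongDeriv h Φ k x (basisVec b)) := by
    intro a b
    rw [P.symm hx, P.form_eq_of_tangent hx (P.left_left hx _) (P.torsion_eq x hx _)]
    simp only [Matrix.mul_apply, Finset.sum_mul]
    rw [Finset.sum_comm]
    refine Finset.sum_congr rfl fun i _ => Finset.sum_congr rfl fun j _ => ?_
    rw [P.swap.second_symm hx j b]
    rfl
  have h2 : ∀ a b, (second h Φ k x * (gram h Φ x)⁻¹ * second h Φ ℓ x) a b
      = h (Φ x) (alongDeriv h Φ k x (basisVec a)) (alongDeriv h Φ ℓ x (basisVec b)) := by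
    intro a b
    rw [P.symm hx, P.form_eq_of_tangent hx (P.right_left hx _) (P.right_right hx _)]
    simp only [Matrix.mul_apply, Finset.sum_mul]
    rw [Finset.sum_comm]
    refine Finset.sum_congr rfl fun i _ => Finset.sum_congr rfl fun j _ => ?_
    rw [P.second_symm hx j b]
    rfl
  refine Matrix.ext fun a b => ?_
  rw [h1, h2, P.commute_form hx, P.symm hx]

end IsParallelFrame

end Coord

namespace Coord
variable {m d : ℕ}

/-- The derivative `E_a + y D_a ℓ + z D_a k` of the (formal) parallel surface `Φ + y ℓ + z k`. -/
def movingVec (h : FormField d) (Φ ℓ k : Model m → Model d) (y z : ℝ) (a : Fin m) (x : Model m) :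
    Model d :=
  fderiv ℝ Φ x (basisVec a) + y • alongDeriv h Φ ℓ x (basisVec a)
    + z • alongDeriv h Φ k x (basisVec a)

/-- The components of `σ + y χ + z χ̲`. -/
def pencilAt (h : FormField d) (Φ ℓ k : Model m → Model d) (y z : ℝ) (x : Model m) :
    Matrix (Fin m) (Fin m) ℝ :=
  gram h Φ x + y • second h Φ ℓ x + z • second h Φ k x

/-- The inverse `det(σ)^{-1/2}` of the density of the induced measure. -/
def invDensity (h : FormField d) (Φ : Model m → Model d) (x : Model m) : ℝ :=
  (Real.sqrt (gram h Φ x).det)⁻¹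

namespace IsParallelFrame

variable {h : FormField d} {Ω : Set (Model d)} {κ : ℝ} {Φ ℓ k : Model m → Model d}
  {U : Set (Model m)} (P : IsParallelFrame h Ω κ Φ ℓ k U) {x : Model m} (y z : ℝ)
include P

theorem contDiffAt_alongDeriv_left (hx : x ∈ U) (v : Model m) :
    ContDiffAt ℝ ∞ (fun z => alongDeriv h Φ ℓ z v) x :=
  P.metric.contDiffAt_alongDeriv (P.mapsTo hx) (P.contDiffAt hx) (P.contDiffAt_left hx) v

theorem contDiffAt_alongDeriv_right (hx : x ∈ U) (v : Model m) :
    ContDiffAt ℝ ∞ (fun z => alongDeriv h Φ k z v) x :=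
  P.swap.contDiffAt_alongDeriv_left hx v

theorem contDiffAt_movingVec (hx : x ∈ U) (a : Fin m) :
    ContDiffAt ℝ ∞ (movingVec h Φ ℓ k y z a) x :=
  ((P.contDiffAt_tangent hx _).add ((P.contDiffAt_alongDeriv_left hx _).const_smul y)).add
    ((P.contDiffAt_alongDeriv_right hx _).const_smul z)

theorem contDiffAt_gram (hx : x ∈ U) (a b : Fin m) :
    ContDiffAt ℝ ∞ (fun w => gram h Φ w a b) x :=
  P.contDiffAt_form hx (P.metric.contDiffAt (P.mapsTo hx)) (P.contDiffAt_tangent hx _)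
    (P.contDiffAt_tangent hx _)

theorem contDiffAt_second (hx : x ∈ U) (a b : Fin m) :
    ContDiffAt ℝ ∞ (fun w => second h Φ ℓ w a b) x :=
  P.contDiffAt_form hx (P.metric.contDiffAt (P.mapsTo hx)) (P.contDiffAt_alongDeriv_left hx _)
    (P.contDiffAt_tangent hx _)

theorem movingVec_tangent_left (hx : x ∈ U) (a : Fin m) :
    h (Φ x) (movingVec h Φ ℓ k y z a x) (ℓ x) = 0 := by
  simp [movingVec, P.symm hx (fderiv ℝ Φ x _), P.normal_left x hx, P.left_left hx, P.right_left hx]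

theorem movingVec_tangent_right (hx : x ∈ U) (a : Fin m) :
    h (Φ x) (movingVec h Φ ℓ k y z a x) (k x) = 0 := by
  simp [movingVec, P.symm hx (fderiv ℝ Φ x _), P.normal_right x hx, P.torsion_eq x hx,
    P.right_right hx]

omit P in
theorem form_movingVec (a b : Fin m) :
    h (Φ x) (movingVec h Φ ℓ k y z a x) (fderiv ℝ Φ x (basisVec b))
      = pencilAt h Φ ℓ k y z x a b := by
  simp [movingVec, pencilAt, gram, second]

/-- The Codazzi equations for `χ` and `χ̲`. -/
theorem alongDeriv_movingVec_symm (hx : x ∈ U) (a b : Fin m) :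
    alongDeriv h Φ (movingVec h Φ ℓ k y z a) x (basisVec b)
      = alongDeriv h Φ (movingVec h Φ ℓ k y z b) x (basisVec a) := by
  have hcod : ∀ {ℓ k : Model m → Model d}, IsParallelFrame h Ω κ Φ ℓ k U →
      alongDeriv h Φ (fun w => alongDeriv h Φ ℓ w (basisVec a)) x (basisVec b)
      = alongDeriv h Φ (fun w => alongDeriv h Φ ℓ w (basisVec b)) x (basisVec a) := by
    intro ℓ k P
    rw [← sub_eq_zero, P.metric.alongDeriv_comm (P.mapsTo hx) (P.contDiffAt hx)
      (P.contDiffAt_left hx), P.curvature_eq _ (P.mapsTo hx), P.symm hx _ (ℓ x),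
      P.symm hx _ (ℓ x), P.normal_left x hx, P.normal_left x hx]
    simp
  have hexp : ∀ a b : Fin m, alongDeriv h Φ (movingVec h Φ ℓ k y z a) x (basisVec b)
      = alongDeriv h Φ (fun w => fderiv ℝ Φ w (basisVec a)) x (basisVec b)
        + y • alongDeriv h Φ (fun w => alongDeriv h Φ ℓ w (basisVec a)) x (basisVec b)
        + z • alongDeriv h Φ (fun w => alongDeriv h Φ k w (basisVec a)) x (basisVec b) := by
    intro a b
    have d1 := (P.contDiffAt_tangent hx (basisVec a)).differentiableAt (by simp)
    have d2 := (P.contDiffAt_alongDeriv_left hx (basisVec a)).differentiableAt (by simp)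
    have d3 := (P.contDiffAt_alongDeriv_right hx (basisVec a)).differentiableAt (by simp)
    have e1 := IsMetricOn.alongDeriv_add (h := h) (Φ := Φ) (d1.fun_add (d2.fun_const_smul y))
      (d3.fun_const_smul z) (basisVec b)
    have e2 := IsMetricOn.alongDeriv_add (h := h) (Φ := Φ) d1 (d2.fun_const_smul y) (basisVec b)
    have e3 := IsMetricOn.alongDeriv_smul (h := h) (Φ := Φ) (f := fun _ => y)
      (differentiableAt_const y) d2 (basisVec b)
    have e4 := IsMetricOn.alongDeriv_smul (h := h) (Φ := Φ) (f := fun _ => z)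
      (differentiableAt_const z) d3 (basisVec b)
    rw [e2, e3, e4] at e1
    simp only [fderiv_const_apply, zero_apply, zero_smul, zero_add] at e1
    exact e1
  rw [hexp, hexp, P.tangent_symm hx, hcod P, hcod P.swap]

theorem hasFDerivAt_det_gram (hx : x ∈ U) : HasFDerivAt (fun w => (gram h Φ w).det)
    (∑ i, ∑ j, (gram h Φ x).adjugate i j • fderiv ℝ (fun w => gram h Φ w j i) x) x :=
  HasFDerivAt.matrix_det fun i j =>
    ((P.contDiffAt_gram hx i j).differentiableAt (by simp)).hasFDerivAt

theorem fderiv_gram (hx : x ∈ U) (a b : Fin m) (u : Model m) :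
    fderiv ℝ (fun w => gram h Φ w a b) x u
      = h (Φ x) (alongDeriv h Φ (fun w => fderiv ℝ Φ w (basisVec a)) x u)
          (fderiv ℝ Φ x (basisVec b))
        + h (Φ x) (fderiv ℝ Φ x (basisVec a))
          (alongDeriv h Φ (fun w => fderiv ℝ Φ w (basisVec b)) x u) :=
  P.fderiv_form hx (P.contDiffAt_tangent hx _) (P.contDiffAt_tangent hx _) u

theorem inv_gram_symm (hx : x ∈ U) (i j : Fin m) :
    (gram h Φ x)⁻¹ i j = (gram h Φ x)⁻¹ j i := by
  have h1 : (gram h Φ x).transpose = gram h Φ x := Matrix.ext fun a b => P.gram_symm hx b a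
  have h2 : ((gram h Φ x)⁻¹).transpose = (gram h Φ x)⁻¹ := by rw [Matrix.transpose_nonsing_inv, h1]
  exact (congrFun (congrFun h2 i) j).symm

theorem adjugate_gram (hx : x ∈ U) (i j : Fin m) :
    (gram h Φ x).adjugate i j = (gram h Φ x).det * (gram h Φ x)⁻¹ i j := by
  rw [Matrix.inv_def, Ring.inverse_eq_inv', Matrix.smul_apply, smul_eq_mul,
    mul_inv_cancel_left₀ (P.det_gram_pos hx).ne']

theorem differentiableAt_invDensity (hx : x ∈ U) : DifferentiableAt ℝ (invDensity h Φ) x := by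
  have h1 := (P.hasFDerivAt_det_gram hx).differentiableAt
  exact (h1.sqrt (P.det_gram_pos hx).ne').inv (Real.sqrt_pos.2 (P.det_gram_pos hx)).ne'

theorem fderiv_invDensity (hx : x ∈ U) (u : Model m) :
    fderiv ℝ (invDensity h Φ) x u = - invDensity h Φ x * ∑ i, ∑ j, (gram h Φ x)⁻¹ i j *
      h (Φ x) (fderiv ℝ Φ x (basisVec j))
        (alongDeriv h Φ (fun w => fderiv ℝ Φ w (basisVec i)) x u) := by
  have hD := P.det_gram_pos hx
  have h1 : HasFDerivAt (invDensity h Φ) _ x :=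
    HasDerivAt.comp_hasFDerivAt (h₂ := fun t : ℝ => t⁻¹) x
      (hasDerivAt_inv (Real.sqrt_pos.2 hD).ne') ((P.hasFDerivAt_det_gram hx).sqrt hD.ne')
  have h2 : (∑ i, ∑ j, (gram h Φ x).adjugate i j • fderiv ℝ (fun w => gram h Φ w j i) x) u
      = 2 * (gram h Φ x).det * ∑ i, ∑ j, (gram h Φ x)⁻¹ i j *
      h (Φ x) (fderiv ℝ Φ x (basisVec j))
        (alongDeriv h Φ (fun w => fderiv ℝ Φ w (basisVec i)) x u) := by
    simp only [sum_apply, smul_apply, smul_eq_mul, P.fderiv_gram hx, P.adjugate_gram hx, mul_add,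
      Finset.sum_add_distrib]
    have h3 : ∑ i, ∑ j, (gram h Φ x).det * (gram h Φ x)⁻¹ i j *
          h (Φ x) (alongDeriv h Φ (fun w => fderiv ℝ Φ w (basisVec j)) x u)
            (fderiv ℝ Φ x (basisVec i))
        = ∑ i, ∑ j, (gram h Φ x).det * (gram h Φ x)⁻¹ i j *
          h (Φ x) (fderiv ℝ Φ x (basisVec j))
            (alongDeriv h Φ (fun w => fderiv ℝ Φ w (basisVec i)) x u) := by
      rw [Finset.sum_comm]
      refine Finset.sum_congr rfl fun i _ => Finset.sum_congr rfl fun j _ => ?_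
      rw [P.inv_gram_symm hx i j, P.symm hx]
    rw [h3, ← two_mul, mul_assoc]
    simp only [Finset.mul_sum, mul_assoc]
  rw [h1.fderiv, smul_apply, smul_apply, h2]
  simp only [smul_eq_mul, invDensity]
  have h4 : Real.sqrt (gram h Φ x).det ≠ 0 := (Real.sqrt_pos.2 hD).ne'
  have h5 := Real.sq_sqrt hD.le
  field_simp
  rw [h5]

/-- `adj(M)^{ij} ⟨𝓔_j, Y_i⟩ = det M σ^{ij} ⟨E_j, Y_i⟩`, because `𝓔` is the tangential frame `E`
composed with `σ⁻¹ M`. -/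
theorem sum_adjugate_form_movingVec (hx : x ∈ U) (Y : Fin m → Model d) :
    ∑ i, ∑ j, (pencilAt h Φ ℓ k y z x).adjugate i j *
        h (Φ x) (movingVec h Φ ℓ k y z j x) (Y i)
      = (pencilAt h Φ ℓ k y z x).det * ∑ i, ∑ j, (gram h Φ x)⁻¹ i j *
        h (Φ x) (fderiv ℝ Φ x (basisVec j)) (Y i) := by
  have h1 : ∀ i j, h (Φ x) (movingVec h Φ ℓ k y z j x) (Y i)
      = ∑ c, ∑ e, pencilAt h Φ ℓ k y z x j c * (gram h Φ x)⁻¹ c e *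
        h (Φ x) (fderiv ℝ Φ x (basisVec e)) (Y i) := by
    intro i j
    have := P.form_eq_of_tangent hx (P.movingVec_tangent_left y z hx j)
      (P.movingVec_tangent_right y z hx j) ((h (Φ x)).flip (Y i))
    simpa only [ContinuousLinearMap.flip_apply, form_movingVec] using this
  rw [Finset.mul_sum]
  refine Finset.sum_congr rfl fun i _ => ?_
  have h2 : ∀ c, ∑ j, (pencilAt h Φ ℓ k y z x).adjugate i j * pencilAt h Φ ℓ k y z x j c
      = if i = c then (pencilAt h Φ ℓ k y z x).det else 0 := by
    intro c
    rw [← Matrix.mul_apply, Matrix.adjugate_mul, Matrix.smul_apply, Matrix.one_apply]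
    simp
  simp only [h1, Finset.mul_sum]
  rw [Finset.sum_comm]
  have h3 : ∀ c, ∑ j, ∑ e, (pencilAt h Φ ℓ k y z x).adjugate i j *
      (pencilAt h Φ ℓ k y z x j c * (gram h Φ x)⁻¹ c e *
        h (Φ x) (fderiv ℝ Φ x (basisVec e)) (Y i))
      = if i = c then (pencilAt h Φ ℓ k y z x).det * ∑ e, (gram h Φ x)⁻¹ c e *
        h (Φ x) (fderiv ℝ Φ x (basisVec e)) (Y i) else 0 := by
    intro c
    rw [Finset.sum_comm, ← ite_zero_mul, ← h2 c, Finset.mul_sum]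
    refine Finset.sum_congr rfl fun e _ => ?_
    rw [Finset.sum_mul]
    exact Finset.sum_congr rfl fun j _ => by ring
  simp only [h3]
  simp [Finset.mul_sum]

theorem contDiffAt_pencilAt (hx : x ∈ U) (a b : Fin m) :
    ContDiffAt ℝ ∞ (fun w => pencilAt h Φ ℓ k y z w a b) x := by
  have := ((P.contDiffAt_gram hx a b).add ((P.contDiffAt_second hx a b).const_smul y)).add
    ((P.swap.contDiffAt_second hx a b).const_smul z)
  exact this

theorem hasFDerivAt_det_pencilAt (hx : x ∈ U) :
    HasFDerivAt (fun w => (pencilAt h Φ ℓ k y z w).det)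
    (∑ i, ∑ j, (pencilAt h Φ ℓ k y z x).adjugate i j •
      fderiv ℝ (fun w => pencilAt h Φ ℓ k y z w j i) x) x :=
  HasFDerivAt.matrix_det fun i j =>
    ((P.contDiffAt_pencilAt y z hx i j).differentiableAt (by simp)).hasFDerivAt

theorem fderiv_pencilAt (hx : x ∈ U) (a b : Fin m) (u : Model m) :
    fderiv ℝ (fun w => pencilAt h Φ ℓ k y z w a b) x u
      = h (Φ x) (alongDeriv h Φ (movingVec h Φ ℓ k y z a) x u) (fderiv ℝ Φ x (basisVec b))
        + h (Φ x) (movingVec h Φ ℓ k y z a x)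
          (alongDeriv h Φ (fun w => fderiv ℝ Φ w (basisVec b)) x u) := by
  rw [← P.fderiv_form hx (P.contDiffAt_movingVec y z hx a) (P.contDiffAt_tangent hx _) u]
  simp only [form_movingVec]

/-- The divergence of a tangential vector field `∑ v^b 𝓔_b`, where the Codazzi equations
`D_a 𝓔_b = D_b 𝓔_a` make all derivatives of the second fundamental forms disappear. -/
theorem sum_fderiv_density_mul (hx : x ∈ U) {v : Fin m → Model m → ℝ}
    (hv : ∀ b, DifferentiableAt ℝ (v b) x) :
    ∑ b, fderiv ℝ (fun w => invDensity h Φ w * ((pencilAt h Φ ℓ k y z w).det * v b w)) x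
        (basisVec b)
      = invDensity h Φ x * ∑ i, ∑ j, (pencilAt h Φ ℓ k y z x).adjugate i j *
        h (Φ x) (alongDeriv h Φ (fun w => ∑ b, v b w • movingVec h Φ ℓ k y z b w) x (basisVec j))
          (fderiv ℝ Φ x (basisVec i)) := by
  set s := invDensity h Φ x
  set D := (pencilAt h Φ ℓ k y z x).det with hD
  have h1 : ∀ b, fderiv ℝ (fun w => invDensity h Φ w * ((pencilAt h Φ ℓ k y z w).det * v b w)) x
        (basisVec b)
      = s * (v b x * ∑ i, ∑ j, (pencilAt h Φ ℓ k y z x).adjugate i j *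
          h (Φ x) (alongDeriv h Φ (movingVec h Φ ℓ k y z j) x (basisVec b))
            (fderiv ℝ Φ x (basisVec i)) + D * fderiv ℝ (v b) x (basisVec b)) := by
    intro b
    have hdet := P.hasFDerivAt_det_pencilAt y z hx
    have h2 : (∑ i, ∑ j, (pencilAt h Φ ℓ k y z x).adjugate i j •
        fderiv ℝ (fun w => pencilAt h Φ ℓ k y z w j i) x) (basisVec b)
        = ∑ i, ∑ j, (pencilAt h Φ ℓ k y z x).adjugate i j *
          h (Φ x) (alongDeriv h Φ (movingVec h Φ ℓ k y z j) x (basisVec b))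
            (fderiv ℝ Φ x (basisVec i))
          + D * ∑ i, ∑ j, (gram h Φ x)⁻¹ i j * h (Φ x) (fderiv ℝ Φ x (basisVec j))
            (alongDeriv h Φ (fun w => fderiv ℝ Φ w (basisVec i)) x (basisVec b)) := by
      rw [← P.sum_adjugate_form_movingVec y z hx]
      simp only [sum_apply, smul_apply, smul_eq_mul, P.fderiv_pencilAt y z hx, mul_add,
        Finset.sum_add_distrib]
    have h3 := (P.differentiableAt_invDensity hx).hasFDerivAt.fun_mul
      (hdet.fun_mul (hv b).hasFDerivAt)
    rw [h3.fderiv]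
    simp only [add_apply, smul_apply, smul_eq_mul, h2, P.fderiv_invDensity hx]
    ring
  have hdv : ∀ b, DifferentiableAt ℝ (movingVec h Φ ℓ k y z b) x := fun b =>
    (P.contDiffAt_movingVec y z hx b).differentiableAt (by simp)
  have h4 : ∀ i j, h (Φ x) (alongDeriv h Φ (fun w => ∑ b, v b w • movingVec h Φ ℓ k y z b w) x
        (basisVec j)) (fderiv ℝ Φ x (basisVec i))
      = ∑ b, (fderiv ℝ (v b) x (basisVec j) * pencilAt h Φ ℓ k y z x b i
        + v b x * h (Φ x) (alongDeriv h Φ (movingVec h Φ ℓ k y z j) x (basisVec b))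
            (fderiv ℝ Φ x (basisVec i))) := by
    intro i j
    rw [IsMetricOn.alongDeriv_sum (K := fun b w => v b w • movingVec h Φ ℓ k y z b w)
      Finset.univ fun b _ => (hv b).smul (hdv b)]
    simp only [map_sum, sum_apply]
    refine Finset.sum_congr rfl fun b _ => ?_
    rw [IsMetricOn.alongDeriv_smul (hv b) (hdv b), P.alongDeriv_movingVec_symm y z hx b j]
    simp only [map_add, map_smul, add_apply, smul_apply, smul_eq_mul, form_movingVec]
  have h5 : ∑ i, ∑ j, (pencilAt h Φ ℓ k y z x).adjugate i j *
      ∑ b, fderiv ℝ (v b) x (basisVec j) * pencilAt h Φ ℓ k y z x b i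
      = ∑ b, D * fderiv ℝ (v b) x (basisVec b) := by
    rw [Finset.sum_comm]
    refine Finset.sum_congr rfl fun j _ => ?_
    have h6 : ∀ b, ∑ i, pencilAt h Φ ℓ k y z x b i * (pencilAt h Φ ℓ k y z x).adjugate i j
        = if b = j then D else 0 := by
      intro b
      rw [← Matrix.mul_apply, Matrix.mul_adjugate, Matrix.smul_apply, Matrix.one_apply]
      simp [hD]
    simp only [Finset.mul_sum]
    rw [Finset.sum_comm]
    have h7 : ∀ b, ∑ i, (pencilAt h Φ ℓ k y z x).adjugate i j *
        (fderiv ℝ (v b) x (basisVec j) * pencilAt h Φ ℓ k y z x b i)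
        = fderiv ℝ (v b) x (basisVec j) * if b = j then D else 0 := by
      intro b
      rw [← h6 b, Finset.mul_sum]
      exact Finset.sum_congr rfl fun i _ => by ring
    simp only [h7]
    simp [mul_comm]
  have h8 : ∑ i, ∑ j, (pencilAt h Φ ℓ k y z x).adjugate i j * ∑ b,
        v b x * h (Φ x) (alongDeriv h Φ (movingVec h Φ ℓ k y z j) x (basisVec b))
            (fderiv ℝ Φ x (basisVec i))
      = ∑ b, v b x * ∑ i, ∑ j, (pencilAt h Φ ℓ k y z x).adjugate i j *
          h (Φ x) (alongDeriv h Φ (movingVec h Φ ℓ k y z j) x (basisVec b))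
            (fderiv ℝ Φ x (basisVec i)) := by
    simp only [Finset.mul_sum]
    rw [Finset.sum_comm (s := Finset.univ (α := Fin m))]
    conv_rhs => rw [Finset.sum_comm]; enter [2, i]; rw [Finset.sum_comm]
    rw [Finset.sum_comm]
    exact Finset.sum_congr rfl fun i _ => Finset.sum_congr rfl fun j _ =>
      Finset.sum_congr rfl fun b _ => by ring
  simp only [h1, h4]
  rw [← Finset.mul_sum, Finset.sum_add_distrib, ← h5, ← h8]
  simp only [Finset.sum_add_distrib, mul_add]
  ring

end IsParallelFrame

end Coord

/-! ### Families of polynomials depending smoothly on a parameter -/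

section SmoothPoly
open MvPolynomial
open scoped Pointwise

variable {E : Type*} [NormedAddCommGroup E] [NormedSpace ℝ E]

/-- A family of polynomials of bounded degree whose coefficients are smooth at `x`. -/
def SmoothPolyAt (p : E → MvPolynomial (Fin 2) ℝ) (x : E) : Prop :=
  (∃ K : Finset (Fin 2 →₀ ℕ), ∀ w, (p w).support ⊆ K) ∧
    ∀ e, ContDiffAt ℝ ∞ (fun w => coeff e (p w)) x

namespace SmoothPolyAt

variable {p q : E → MvPolynomial (Fin 2) ℝ} {x : E}

theorem const (p : MvPolynomial (Fin 2) ℝ) : SmoothPolyAt (fun _ : E => p) x :=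
  ⟨⟨p.support, fun _ => subset_rfl⟩, fun _ => contDiffAt_const⟩

theorem C_of {f : E → ℝ} (hf : ContDiffAt ℝ ∞ f x) : SmoothPolyAt (fun w => C (f w)) x := by
  classical
  refine ⟨⟨{0}, fun w => ?_⟩, fun e => ?_⟩
  · exact support_monomial_subset
  · simp only [coeff_C]
    split_ifs
    exacts [hf, contDiffAt_const]

theorem add (hp : SmoothPolyAt p x) (hq : SmoothPolyAt q x) :
    SmoothPolyAt (fun w => p w + q w) x := by
  classical
  obtain ⟨⟨K, hK⟩, h1⟩ := hp
  obtain ⟨⟨K', hK'⟩, h2⟩ := hq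
  refine ⟨⟨K ∪ K', fun w => support_add.trans (Finset.union_subset_union (hK w) (hK' w))⟩,
    fun e => ?_⟩
  simp only [coeff_add]
  exact (h1 e).add (h2 e)

theorem mul (hp : SmoothPolyAt p x) (hq : SmoothPolyAt q x) :
    SmoothPolyAt (fun w => p w * q w) x := by
  classical
  obtain ⟨⟨K, hK⟩, h1⟩ := hp
  obtain ⟨⟨K', hK'⟩, h2⟩ := hq
  refine ⟨⟨K + K', fun w => (support_mul _ _).trans (Finset.add_subset_add (hK w) (hK' w))⟩,
    fun e => ?_⟩
  simp only [coeff_mul]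
  exact ContDiffAt.sum fun i _ => (h1 _).mul (h2 _)

theorem sum {ι : Type*} (s : Finset ι) {p : ι → E → MvPolynomial (Fin 2) ℝ}
    (hp : ∀ i ∈ s, SmoothPolyAt (p i) x) : SmoothPolyAt (fun w => ∑ i ∈ s, p i w) x := by
  classical
  induction s using Finset.induction_on with
  | empty => simpa using const 0
  | insert a s ha ih =>
    simp only [Finset.sum_insert ha]
    exact (hp a (by simp)).add (ih fun i hi => hp i (by simp [hi]))

theorem prod {ι : Type*} (s : Finset ι) {p : ι → E → MvPolynomial (Fin 2) ℝ}
    (hp : ∀ i ∈ s, SmoothPolyAt (p i) x) : SmoothPolyAt (fun w => ∏ i ∈ s, p i w) x := by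
  classical
  induction s using Finset.induction_on with
  | empty => simpa using const 1
  | insert a s ha ih =>
    simp only [Finset.prod_insert ha]
    exact (hp a (by simp)).mul (ih fun i hi => hp i (by simp [hi]))

theorem det {m : ℕ} {M : E → Matrix (Fin m) (Fin m) (MvPolynomial (Fin 2) ℝ)}
    (hM : ∀ i j, SmoothPolyAt (fun w => M w i j) x) : SmoothPolyAt (fun w => (M w).det) x := by
  simp only [Matrix.det_apply']
  exact sum _ fun σ _ => (const _).mul (prod _ fun i _ => hM _ _)

theorem adjugate {m : ℕ} {M : E → Matrix (Fin m) (Fin m) (MvPolynomial (Fin 2) ℝ)}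
    (hM : ∀ i j, SmoothPolyAt (fun w => M w i j) x) (a b : Fin m) :
    SmoothPolyAt (fun w => (M w).adjugate a b) x := by
  simp only [Matrix.adjugate_apply]
  refine det fun i j => ?_
  by_cases hi : i = b
  · subst hi
    simpa only [Matrix.updateRow_self] using const _
  · simpa only [Matrix.updateRow_ne hi] using hM i j

/-- Evaluation commutes with differentiation in the parameter. -/
theorem exists_fderiv (hp : SmoothPolyAt p x) (u : E) : ∃ p' : MvPolynomial (Fin 2) ℝ,
    (∀ e, coeff e p' = fderiv ℝ (fun w => coeff e (p w)) x u) ∧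
    ∀ v, fderiv ℝ (fun w => eval v (p w)) x u = eval v p' := by
  classical
  obtain ⟨⟨K, hK⟩, h1⟩ := hp
  have hd : ∀ e, DifferentiableAt ℝ (fun w => coeff e (p w)) x := fun e =>
    (h1 e).differentiableAt (by simp)
  refine ⟨∑ e ∈ K, monomial e (fderiv ℝ (fun w => coeff e (p w)) x u), fun e => ?_, fun v => ?_⟩
  · simp only [coeff_sum, coeff_monomial, Finset.sum_ite_eq']
    split_ifs with he
    · rfl
    · have h0 : (fun w => coeff e (p w)) = fun _ => 0 := by
        funext w
        exact notMem_support_iff.1 fun h => he (hK w h)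
      simp [h0]
  · have h2 : (fun w => eval v (p w)) = fun w => ∑ e ∈ K, coeff e (p w) * ∏ i, v i ^ e i := by
      funext w
      rw [eval_eq']
      refine Finset.sum_subset (hK w) fun e _ he => ?_
      rw [notMem_support_iff.1 he, zero_mul]
    rw [h2, (HasFDerivAt.fun_sum fun e _ => ((hd e).hasFDerivAt.mul_const _)).fderiv]
    simp only [map_sum, eval_monomial, sum_apply, smul_apply, smul_eq_mul]
    refine Finset.sum_congr rfl fun e _ => ?_
    rw [mul_comm, Finsupp.prod_fintype _ _ (by simp)]

end SmoothPolyAt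

end SmoothPoly

namespace Coord
variable {m d : ℕ}

/-- `q` is a conformal Killing-Yano two-form for the metric `h` on `Ω`. -/
structure IsKillingYanoOn (h q : FormField d) (Ω : Set (Model d)) : Prop where
  smooth : ContDiffOn ℝ ∞ q Ω
  alt : ∀ y ∈ Ω, ∀ u v, q y u v = - q y v u
  eqn : ∀ y ∈ Ω, ∀ X Y Z, covDerivForm h q y X Y Z + covDerivForm h q y Y X Z
      = 2 / ((d : ℝ) - 1) * (h y X Y * h y (divForm h q y) Z
          - 1 / 2 * (h y X Z * h y (divForm h q y) Y)
          - 1 / 2 * (h y Y Z * h y (divForm h q y) X))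

/-- The field `∂/∂t = - (div q) / n`. -/
def timeVec (h q : FormField d) (y : Model d) : Model d :=
  (-(1 / ((d : ℝ) - 1))) • divForm h q y

namespace IsParallelFrame

variable {h q : FormField d} {Ω : Set (Model d)} {κ : ℝ} {Φ ℓ k : Model m → Model d}
  {U : Set (Model m)} (P : IsParallelFrame h Ω κ Φ ℓ k U) (hq : IsKillingYanoOn h q Ω)
  {x : Model m} (y z : ℝ)
include P

omit P in
theorem pencilAt_eq (w : Model m) : pencilAt h Φ ℓ k y z w
    = (pencil (gram h Φ w) (second h Φ ℓ w) (second h Φ k w)).map (MvPolynomial.eval ![y, z]) := by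
  rw [pencil.eval_map]
  rfl

theorem smoothPolyAt_adjugate_pencil (hx : x ∈ U) (a b : Fin m) :
    SmoothPolyAt (fun w => (pencil (gram h Φ w) (second h Φ ℓ w) (second h Φ k w)).adjugate a b)
      x := by
  refine SmoothPolyAt.adjugate (fun i j => ?_) a b
  exact ((SmoothPolyAt.C_of (P.contDiffAt_gram hx i j)).add
    ((SmoothPolyAt.const _).mul (SmoothPolyAt.C_of (P.contDiffAt_second hx i j)))).add
    ((SmoothPolyAt.const _).mul (SmoothPolyAt.C_of (P.swap.contDiffAt_second hx i j)))

theorem differentiableAt_adjugate (hx : x ∈ U) (a b : Fin m) :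
    DifferentiableAt ℝ (fun w => (pencilAt h Φ ℓ k y z w).adjugate a b) x := by
  simp only [Matrix.adjugate_apply]
  refine (HasFDerivAt.matrix_det (M' := fun i j => fderiv ℝ (fun w =>
    (pencilAt h Φ ℓ k y z w).updateRow b (Pi.single a 1) i j) x) fun i j => ?_).differentiableAt
  refine DifferentiableAt.hasFDerivAt ?_
  by_cases hi : i = b
  · subst hi
    simp only [Matrix.updateRow_self]
    exact differentiableAt_const _
  · simp only [Matrix.updateRow_ne hi]
    exact (P.contDiffAt_pencilAt y z hx i j).differentiableAt (by simp)

include hq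

theorem contDiffAt_contract (hx : x ∈ U) (a : Fin m) :
    ContDiffAt ℝ ∞ (fun w => contract q Φ ℓ w a) x :=
  P.contDiffAt_form hx (hq.smooth.contDiffAt (P.metric.isOpen.mem_nhds (P.mapsTo hx)))
    (P.contDiffAt_left hx) (P.contDiffAt_tangent hx _)

/-- The covariant derivative of the tangential field `W` dual to `q(ℓ, ·)`: the difference
between `⟨W, ·⟩` and `q(ℓ, ·)` is only seen by `k`, and the `k` component of `D_j E_i` is
`½ χ_ji`. -/
theorem form_alongDeriv_dual (hx : x ∈ U) {W : Model m → Model d} (hW : DifferentiableAt ℝ W x)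
    (h1 : ∀ᶠ w in nhds x, ∀ i, h (Φ w) (W w) (fderiv ℝ Φ w (basisVec i)) = contract q Φ ℓ w i)
    (h2 : h (Φ x) (W x) (ℓ x) = 0) (h3 : h (Φ x) (W x) (k x) = 0) (i j : Fin m) :
    h (Φ x) (alongDeriv h Φ W x (basisVec j)) (fderiv ℝ Φ x (basisVec i))
      = covDerivForm h q (Φ x) (fderiv ℝ Φ x (basisVec j)) (ℓ x) (fderiv ℝ Φ x (basisVec i))
        + q (Φ x) (alongDeriv h Φ ℓ x (basisVec j)) (fderiv ℝ Φ x (basisVec i))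
        + 1 / 2 * q (Φ x) (ℓ x) (k x) * second h Φ ℓ x j i := by
  have hqx : DifferentiableAt ℝ q (Φ x) :=
    (hq.smooth.contDiffAt (P.metric.isOpen.mem_nhds (P.mapsTo hx))).differentiableAt (by simp)
  have hΦ := (P.contDiffAt hx).differentiableAt (by simp : (∞ : WithTop ℕ∞) ≠ 0)
  have hE := (P.contDiffAt_tangent hx (basisVec i)).differentiableAt
    (by simp : (∞ : WithTop ℕ∞) ≠ 0)
  have hℓ := (P.contDiffAt_left hx).differentiableAt (by simp : (∞ : WithTop ℕ∞) ≠ 0)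
  have e1 := P.metric.fderiv_along (P.mapsTo hx) hΦ hW hE (basisVec j)
  have e2 := IsMetricOn.fderiv_along_form (h := h) hqx hΦ hℓ hE (basisVec j)
  have e3 : (fun w => h (Φ w) (W w) (fderiv ℝ Φ w (basisVec i)))
      =ᶠ[nhds x] fun w => q (Φ w) (ℓ w) (fderiv ℝ Φ w (basisVec i)) := by
    filter_upwards [h1] with w hw using hw i
  rw [e3.fderiv_eq, e2] at e1
  set Y := alongDeriv h Φ (fun w => fderiv ℝ Φ w (basisVec i)) x (basisVec j) with hY
  obtain ⟨u, s, t, hst⟩ := P.exists_decomposition hx Y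
  have e4 : second h Φ ℓ x j i = 2 * t := by
    have := P.left_tangent hx (basisVec j) (basisVec i)
    rw [← hY, hst] at this
    simp only [map_add, map_smul, smul_eq_mul, P.normal_left x hx, P.null_left x hx,
      P.pairing x hx] at this
    rw [second, Matrix.of_apply, this]
    ring
  have e5 : h (Φ x) (W x) (fderiv ℝ Φ x u) = q (Φ x) (ℓ x) (fderiv ℝ Φ x u) := by
    rw [← sum_smul_basisVec u]
    simp only [map_sum, map_smul, h1.self_of_nhds]
    rfl
  have e6 : q (Φ x) (ℓ x) (ℓ x) = 0 := by
    have := hq.alt _ (P.mapsTo hx) (ℓ x) (ℓ x)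
    linarith
  have e7 : q (Φ x) (ℓ x) Y - h (Φ x) (W x) Y = t * q (Φ x) (ℓ x) (k x) := by
    rw [hst]
    simp only [map_add, map_smul, smul_eq_mul, h2, h3, e5, e6]
    ring
  rw [e4]
  linarith

/-- The conformal Killing-Yano equation contracted with a symmetric matrix. -/
theorem sum_symm_mul_covDerivForm (hx : x ∈ U) {N : Matrix (Fin m) (Fin m) ℝ}
    (hN : ∀ i j, N i j = N j i) :
    ∑ i, ∑ j, N i j * covDerivForm h q (Φ x) (fderiv ℝ Φ x (basisVec j)) (ℓ x)
        (fderiv ℝ Φ x (basisVec i))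
      = h (Φ x) (ℓ x) (timeVec h q (Φ x)) * (N * gram h Φ x).trace := by
  have hqx : DifferentiableAt ℝ q (Φ x) :=
    (hq.smooth.contDiffAt (P.metric.isOpen.mem_nhds (P.mapsTo hx))).differentiableAt (by simp)
  have e1 : ∀ i j, covDerivForm h q (Φ x) (fderiv ℝ Φ x (basisVec j)) (ℓ x)
        (fderiv ℝ Φ x (basisVec i)) + covDerivForm h q (Φ x) (fderiv ℝ Φ x (basisVec i)) (ℓ x)
        (fderiv ℝ Φ x (basisVec j))
      = 2 * (h (Φ x) (ℓ x) (timeVec h q (Φ x)) * gram h Φ x j i) := by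
    intro i j
    rw [covDerivForm_alt P.metric.isOpen hq.alt (P.mapsTo hx) hqx _ (ℓ x),
      covDerivForm_alt P.metric.isOpen hq.alt (P.mapsTo hx) hqx _ (ℓ x)]
    have := hq.eqn _ (P.mapsTo hx) (fderiv ℝ Φ x (basisVec j)) (fderiv ℝ Φ x (basisVec i)) (ℓ x)
    rw [P.symm hx _ (ℓ x), P.symm hx _ (ℓ x), P.symm hx (fderiv ℝ Φ x (basisVec i)) (ℓ x),
      P.normal_left x hx, P.normal_left x hx] at this
    rw [← neg_add, this, timeVec, map_smul, gram, Matrix.of_apply, smul_eq_mul]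
    ring
  set S := ∑ i, ∑ j, N i j * covDerivForm h q (Φ x) (fderiv ℝ Φ x (basisVec j)) (ℓ x)
        (fderiv ℝ Φ x (basisVec i)) with hS
  have e2 : S = ∑ i, ∑ j, N i j * covDerivForm h q (Φ x) (fderiv ℝ Φ x (basisVec i)) (ℓ x)
        (fderiv ℝ Φ x (basisVec j)) := by
    rw [hS, Finset.sum_comm]
    exact Finset.sum_congr rfl fun i _ => Finset.sum_congr rfl fun j _ => by rw [hN i j]
  have e3 : S + S = 2 * (h (Φ x) (ℓ x) (timeVec h q (Φ x)) * (N * gram h Φ x).trace) := by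
    nth_rewrite 2 [e2]
    rw [hS]
    simp only [← Finset.sum_add_distrib, ← mul_add, e1, Matrix.trace, Matrix.diag,
      Matrix.mul_apply, Finset.mul_sum]
    exact Finset.sum_congr rfl fun i _ => Finset.sum_congr rfl fun j _ => by ring
  linarith

omit hq in
theorem pencilAt_symm (hx : x ∈ U) :
    (pencilAt h Φ ℓ k y z x).transpose = pencilAt h Φ ℓ k y z x := by
  refine Matrix.ext fun a b => ?_
  simp [pencilAt, P.gram_symm hx b a, P.second_symm hx b a, P.swap.second_symm hx b a]

omit hq in
theorem adjugate_pencilAt_symm (hx : x ∈ U) (i j : Fin m) :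
    (pencilAt h Φ ℓ k y z x).adjugate i j = (pencilAt h Φ ℓ k y z x).adjugate j i := by
  conv_lhs => rw [← P.pencilAt_symm y z hx, ← Matrix.adjugate_transpose]
  rfl

omit hq in
/-- `adj(M) χ σ⁻¹` is symmetric because `χ` and `χ̲` commute. -/
theorem adjugate_mul_second_symm (hx : x ∈ U) :
    ((pencilAt h Φ ℓ k y z x).adjugate * second h Φ ℓ x * (gram h Φ x)⁻¹).transpose
      = (pencilAt h Φ ℓ k y z x).adjugate * second h Φ ℓ x * (gram h Φ x)⁻¹ ∨
      (pencilAt h Φ ℓ k y z x).det = 0 := by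
  by_cases hdet : (pencilAt h Φ ℓ k y z x).det = 0
  · exact Or.inr hdet
  refine Or.inl ?_
  set M := pencilAt h Φ ℓ k y z x with hM
  set A := second h Φ ℓ x with hA
  set G := gram h Φ x with hG
  have hAt : A.transpose = A := Matrix.ext fun a b => P.second_symm hx b a
  have hGt : (G⁻¹).transpose = G⁻¹ := Matrix.ext fun a b => P.inv_gram_symm hx b a
  have hMt : M.adjugate.transpose = M.adjugate :=
    Matrix.ext fun a b => P.adjugate_pencilAt_symm y z hx b a
  have hcomm : A * G⁻¹ * M = M * G⁻¹ * A := by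
    rw [hM, pencilAt, ← hG, ← hA]
    simp only [Matrix.mul_add, Matrix.add_mul, Matrix.mul_smul, Matrix.smul_mul,
      P.second_commute hx, hA, hG]
    rw [Matrix.mul_assoc, P.gram_inv_mul hx, P.gram_mul_inv hx]
    simp
  rw [Matrix.transpose_mul, Matrix.transpose_mul, hAt, hGt, hMt]
  have h1 : M.adjugate * (A * G⁻¹ * M) * M.adjugate = M.adjugate * (M * G⁻¹ * A) * M.adjugate := by
    rw [hcomm]
  have h2 : M.adjugate * (A * G⁻¹ * M) * M.adjugate = M.det • (M.adjugate * A * G⁻¹) := by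
    rw [Matrix.mul_assoc, Matrix.mul_assoc (A * G⁻¹), Matrix.mul_adjugate]
    simp [Matrix.mul_assoc]
  have h3 : M.adjugate * (M * G⁻¹ * A) * M.adjugate = M.det • (G⁻¹ * (A * M.adjugate)) := by
    rw [Matrix.mul_assoc M, ← Matrix.mul_assoc M.adjugate, Matrix.adjugate_mul]
    simp [Matrix.mul_assoc]
  rw [h2, h3] at h1
  exact (smul_right_injective _ hdet h1).symm

/-- The derivative of `ℓ` in `q(ℓ, ·)` does not contribute to the divergence: it pairs the symmetric
`adj(M) χ σ⁻¹` with the antisymmetric `q`. -/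
theorem sum_adjugate_mul_form_left (hx : x ∈ U) (hdet : (pencilAt h Φ ℓ k y z x).det ≠ 0) :
    ∑ i, ∑ j, (pencilAt h Φ ℓ k y z x).adjugate i j *
      q (Φ x) (alongDeriv h Φ ℓ x (basisVec j)) (fderiv ℝ Φ x (basisVec i)) = 0 := by
  set X := (pencilAt h Φ ℓ k y z x).adjugate * second h Φ ℓ x * (gram h Φ x)⁻¹ with hX
  have hXt : ∀ i j, X i j = X j i := fun i j =>
    congrFun (congrFun ((P.adjugate_mul_second_symm y z hx).resolve_right hdet) j) i
  have e1 : ∀ i, ∑ j, (pencilAt h Φ ℓ k y z x).adjugate i j *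
      q (Φ x) (alongDeriv h Φ ℓ x (basisVec j)) (fderiv ℝ Φ x (basisVec i))
      = ∑ e, X i e * q (Φ x) (fderiv ℝ Φ x (basisVec e)) (fderiv ℝ Φ x (basisVec i)) := by
    intro i
    have e2 : ∀ j, q (Φ x) (alongDeriv h Φ ℓ x (basisVec j)) (fderiv ℝ Φ x (basisVec i))
        = ∑ c, ∑ e, second h Φ ℓ x j c * (gram h Φ x)⁻¹ c e *
          q (Φ x) (fderiv ℝ Φ x (basisVec e)) (fderiv ℝ Φ x (basisVec i)) := fun j =>
      P.form_eq_of_tangent hx (P.left_left hx _) (P.torsion_eq x hx _)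
        ((q (Φ x)).flip (fderiv ℝ Φ x (basisVec i)))
    simp only [e2, hX, Matrix.mul_apply, Finset.sum_mul, Finset.mul_sum]
    rw [Finset.sum_comm]
    conv_lhs => enter [2, c]; rw [Finset.sum_comm]
    rw [Finset.sum_comm]
    exact Finset.sum_congr rfl fun i _ => Finset.sum_congr rfl fun j _ =>
      Finset.sum_congr rfl fun b _ => by ring
  simp only [e1]
  set S := ∑ i, ∑ e, X i e * q (Φ x) (fderiv ℝ Φ x (basisVec e)) (fderiv ℝ Φ x (basisVec i))
    with hS
  have e3 : S = -S := by
    have e4 : S = ∑ i, ∑ e, X e i *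
        q (Φ x) (fderiv ℝ Φ x (basisVec i)) (fderiv ℝ Φ x (basisVec e)) := by
      rw [hS, Finset.sum_comm]
    conv_rhs => rw [hS]
    rw [e4, ← Finset.sum_neg_distrib]
    refine Finset.sum_congr rfl fun i _ => ?_
    rw [← Finset.sum_neg_distrib]
    refine Finset.sum_congr rfl fun j _ => ?_
    rw [hXt j i, hq.alt _ (P.mapsTo hx) (fderiv ℝ Φ x (basisVec i)) (fderiv ℝ Φ x (basisVec j))]
    ring
  linarith

/-- The divergence of `adj(M) q(ℓ, ·)` for fixed `(y, z)`. -/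
theorem sum_fderiv_adjugate (hx : x ∈ U) (hdet : (pencilAt h Φ ℓ k y z x).det ≠ 0) :
    ∑ b, fderiv ℝ (fun w => invDensity h Φ w * ∑ a, contract q Φ ℓ w a *
        (pencilAt h Φ ℓ k y z w).adjugate a b) x (basisVec b)
      = invDensity h Φ x * (h (Φ x) (ℓ x) (timeVec h q (Φ x)) *
          ((pencilAt h Φ ℓ k y z x).adjugate * gram h Φ x).trace
        + 1 / 2 * q (Φ x) (ℓ x) (k x) *
          ((pencilAt h Φ ℓ k y z x).adjugate * second h Φ ℓ x).trace) := by
  set v : Fin m → Model m → ℝ := fun b w => ((pencilAt h Φ ℓ k y z w).det)⁻¹ *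
    ∑ a, contract q Φ ℓ w a * (pencilAt h Φ ℓ k y z w).adjugate a b with hv
  have hdetd := (P.hasFDerivAt_det_pencilAt y z hx).differentiableAt
  have hvd : ∀ b, DifferentiableAt ℝ (v b) x := fun b =>
    (hdetd.inv hdet).mul (DifferentiableAt.fun_sum fun a _ =>
      ((P.contDiffAt_contract hq hx a).differentiableAt (by simp)).mul
        (P.differentiableAt_adjugate y z hx a b))
  have hev : ∀ᶠ w in nhds x, (pencilAt h Φ ℓ k y z w).det ≠ 0 :=
    hdetd.continuousAt.eventually_ne hdet
  set W : Model m → Model d := fun w => ∑ b, v b w • movingVec h Φ ℓ k y z b w with hW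
  have hWd : DifferentiableAt ℝ W x := DifferentiableAt.fun_sum fun b _ =>
    (hvd b).smul ((P.contDiffAt_movingVec y z hx b).differentiableAt (by simp))
  have hWt : ∀ᶠ w in nhds x, ∀ i, h (Φ w) (W w) (fderiv ℝ Φ w (basisVec i))
      = contract q Φ ℓ w i := by
    filter_upwards [hev] with w hw i
    simp only [hW, map_sum, map_smul, sum_apply, smul_apply, smul_eq_mul, form_movingVec, hv]
    have e1 : ∀ a, ∑ b, (pencilAt h Φ ℓ k y z w).adjugate a b * pencilAt h Φ ℓ k y z w b i
        = if a = i then (pencilAt h Φ ℓ k y z w).det else 0 := by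
      intro a
      rw [← Matrix.mul_apply, Matrix.adjugate_mul, Matrix.smul_apply, Matrix.one_apply]
      simp
    have e2 : ∑ b, ((pencilAt h Φ ℓ k y z w).det)⁻¹ * (∑ a, contract q Φ ℓ w a *
        (pencilAt h Φ ℓ k y z w).adjugate a b) * pencilAt h Φ ℓ k y z w b i
        = ((pencilAt h Φ ℓ k y z w).det)⁻¹ * ∑ a, contract q Φ ℓ w a *
          ∑ b, (pencilAt h Φ ℓ k y z w).adjugate a b * pencilAt h Φ ℓ k y z w b i := by
      simp only [Finset.mul_sum, Finset.sum_mul]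
      rw [Finset.sum_comm]
      exact Finset.sum_congr rfl fun i _ => Finset.sum_congr rfl fun j _ => by ring
    rw [e2]
    simp only [e1, mul_ite, mul_zero, Finset.sum_ite_eq', Finset.mem_univ, if_true]
    field_simp
  have hW1 : h (Φ x) (W x) (ℓ x) = 0 := by
    simp [hW, map_sum, P.movingVec_tangent_left y z hx]
  have hW2 : h (Φ x) (W x) (k x) = 0 := by
    simp [hW, map_sum, P.movingVec_tangent_right y z hx]
  have h1 : ∀ b, fderiv ℝ (fun w => invDensity h Φ w * ∑ a, contract q Φ ℓ w a *
        (pencilAt h Φ ℓ k y z w).adjugate a b) x (basisVec b)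
      = fderiv ℝ (fun w => invDensity h Φ w * ((pencilAt h Φ ℓ k y z w).det * v b w)) x
        (basisVec b) := by
    intro b
    congr 1
    refine Filter.EventuallyEq.fderiv_eq ?_
    filter_upwards [hev] with w hw
    rw [hv]
    simp only
    rw [mul_inv_cancel_left₀ hw]
  rw [Finset.sum_congr rfl fun b _ => h1 b, P.sum_fderiv_density_mul y z hx hvd]
  congr 1
  have h2 : ∀ i j, h (Φ x) (alongDeriv h Φ (fun w => ∑ b, v b w • movingVec h Φ ℓ k y z b w) x
      (basisVec j)) (fderiv ℝ Φ x (basisVec i)) = _ :=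
    P.form_alongDeriv_dual hq hx hWd hWt hW1 hW2
  simp only [h2, mul_add, Finset.sum_add_distrib]
  rw [P.sum_symm_mul_covDerivForm hq hx (P.adjugate_pencilAt_symm y z hx),
    P.sum_adjugate_mul_form_left hq y z hx hdet, add_zero]
  have h3 : ((pencilAt h Φ ℓ k y z x).adjugate * second h Φ ℓ x).trace
      = ∑ i, ∑ j, (pencilAt h Φ ℓ k y z x).adjugate i j * second h Φ ℓ x j i := rfl
  rw [h3]
  simp only [Finset.mul_sum]
  congr 1
  exact Finset.sum_congr rfl fun i _ => Finset.sum_congr rfl fun j _ => by ring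

open MvPolynomial in
/-- The coefficientwise form of `sum_fderiv_adjugate`. -/
theorem sum_fderiv_coeff_adjugate (hx : x ∈ U) (e : Fin 2 →₀ ℕ) :
    ∑ b, fderiv ℝ (fun w => invDensity h Φ w * ∑ a, contract q Φ ℓ w a *
        coeff e ((pencil (gram h Φ w) (second h Φ ℓ w) (second h Φ k w)).adjugate a b)) x
          (basisVec b)
      = invDensity h Φ x * (h (Φ x) (ℓ x) (timeVec h q (Φ x)) *
          coeff e ((pencil (gram h Φ x) (second h Φ ℓ x) (second h Φ k x)).adjugate
            * (gram h Φ x).map C).trace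
        + 1 / 2 * q (Φ x) (ℓ x) (k x) *
          coeff e ((pencil (gram h Φ x) (second h Φ ℓ x) (second h Φ k x)).adjugate
            * (second h Φ ℓ x).map C).trace) := by
  set pen : Model m → Matrix (Fin m) (Fin m) (MvPolynomial (Fin 2) ℝ) :=
    fun w => pencil (gram h Φ w) (second h Φ ℓ w) (second h Φ k w) with hpen
  have hD : ContDiffAt ℝ ∞ (invDensity h Φ) x := by
    have h1 : ContDiffAt ℝ ∞ (fun w => (gram h Φ w).det) x := by
      simp only [Matrix.det_apply']
      exact ContDiffAt.sum fun σ _ => contDiffAt_const.mul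
        (contDiffAt_prod fun i _ => P.contDiffAt_gram hx _ _)
    exact (h1.sqrt (P.det_gram_pos hx).ne').inv (Real.sqrt_pos.2 (P.det_gram_pos hx)).ne'
  set p : Fin m → Model m → MvPolynomial (Fin 2) ℝ := fun b w =>
    C (invDensity h Φ w) * ∑ a, C (contract q Φ ℓ w a) * (pen w).adjugate a b with hp
  have hps : ∀ b, SmoothPolyAt (p b) x := fun b =>
    (SmoothPolyAt.C_of hD).mul (SmoothPolyAt.sum _ fun a _ =>
      (SmoothPolyAt.C_of (P.contDiffAt_contract hq hx a)).mul
        (P.smoothPolyAt_adjugate_pencil hx a b))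
  choose p' hp1 hp2 using fun b => (hps b).exists_fderiv (basisVec b)
  set Rp : MvPolynomial (Fin 2) ℝ := C (invDensity h Φ x) *
    (C (h (Φ x) (ℓ x) (timeVec h q (Φ x))) * ((pen x).adjugate * (gram h Φ x).map C).trace
      + C (1 / 2 * q (Φ x) (ℓ x) (k x)) * ((pen x).adjugate * (second h Φ ℓ x).map C).trace)
    with hR
  have hadj : ∀ (v : Fin 2 → ℝ) w, ((pen w).adjugate).map (eval v)
      = (pencilAt h Φ ℓ k (v 0) (v 1) w).adjugate := by
    intro v w
    have hv : ![v 0, v 1] = v := by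
      funext i
      fin_cases i <;> rfl
    rw [pencilAt_eq, hv]
    exact (eval v).map_adjugate (pen w)
  have htr : ∀ (v : Fin 2 → ℝ) (N : Matrix (Fin m) (Fin m) ℝ),
      eval v ((pen x).adjugate * N.map C).trace
        = ((pencilAt h Φ ℓ k (v 0) (v 1) x).adjugate * N).trace := by
    intro v N
    rw [← hadj]
    simp [Matrix.trace, Matrix.mul_apply]
  have hpoly : ∑ b, p' b = Rp := by
    have hne : (pen x).det ≠ 0 := by
      intro h0
      have h1 := congrArg (eval (0 : Fin 2 → ℝ)) h0
      rw [RingHom.map_det, RingHom.mapMatrix_apply, pencil.eval_map] at h1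
      simp at h1
      exact (P.det_gram_pos hx).ne' h1
    -- After multiplication by `det M`, the identity of polynomials need only be checked at the
    -- points with `det M ≠ 0`.
    refine sub_eq_zero.1 ((mul_eq_zero.1 ?_).resolve_right hne)
    refine MvPolynomial.funext fun v => ?_
    by_cases hv : (pencilAt h Φ ℓ k (v 0) (v 1) x).det = 0
    · have h1 : eval v (pen x).det = 0 := by
        rw [RingHom.map_det, RingHom.mapMatrix_apply, pencil.eval_map]
        exact hv
      rw [map_mul, h1, mul_zero, map_zero]
    · have h1 := P.sum_fderiv_adjugate hq (v 0) (v 1) hx hv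
      have h2 : ∀ b, (fun w => invDensity h Φ w * ∑ a, contract q Φ ℓ w a *
          (pencilAt h Φ ℓ k (v 0) (v 1) w).adjugate a b) = fun w => eval v (p b w) := by
        intro b
        funext w
        simp only [hp, map_mul, map_sum, eval_C, ← hadj, Matrix.map_apply]
      simp only [h2, hp2] at h1
      rw [map_mul, map_sub, map_sum, h1, hR]
      simp only [map_mul, map_add, eval_C, htr, sub_self, zero_mul, map_zero]
  have hcoeff := congrArg (coeff e) hpoly
  rw [coeff_sum, hR, coeff_C_mul, coeff_add, coeff_C_mul, coeff_C_mul] at hcoeff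
  rw [← hcoeff]
  refine Finset.sum_congr rfl fun b _ => ?_
  rw [hp1]
  simp only [hp, hpen, coeff_C_mul, coeff_sum]

end IsParallelFrame

end Coord

namespace Coord
variable {m d : ℕ}

/-! ### The integral formula in coordinates -/

open MeasureTheory

theorem integrable_of_continuousOn {g : Model m → ℝ} {U K : Set (Model m)}
    (hg : ContinuousOn g U) (hK : IsCompact K) (hKU : K ⊆ U) (h0 : ∀ x ∉ K, g x = 0) :
    Integrable g := by
  rw [← integrableOn_iff_integrable_of_support_subset (s := K)]
  · exact (hg.mono hKU).integrableOn_compact hK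
  · intro x hx
    by_contra h
    exact hx (h0 x h)

/-- The integral of a partial derivative of a compactly supported function vanishes. -/
theorem integral_fderiv_eq_zero {g : Model m → ℝ} (hg : ContDiff ℝ ∞ g)
    (hc : HasCompactSupport g) (v : Model m) :
    Integrable (fun x => fderiv ℝ g x v) ∧ ∫ x, fderiv ℝ g x v = 0 := by
  have hd : Continuous fun x => fderiv ℝ g x v :=
    (hg.continuous_fderiv (by simp)).clm_apply continuous_const
  have h1 : Integrable (fun x => fderiv ℝ g x v) :=
    hd.integrable_of_hasCompactSupport (hc.fderiv_apply ℝ v)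
  refine ⟨h1, ?_⟩
  have h2 := integral_mul_fderiv_eq_neg_fderiv_mul_of_integrable (μ := volume)
    (f := fun _ : Model m => (1 : ℝ)) (g := g) (v := v)
    (by simp) (by simpa using h1)
    (by simpa using hg.continuous.integrable_of_hasCompactSupport hc)
    (fun x _ => differentiableAt_const _)
    (fun x _ => (hg.differentiable (by simp)).differentiableAt)
  simpa using h2

theorem IsMetricOn.contDiffAt_divForm {h q : FormField d} {Ω : Set (Model d)}
    (H : IsMetricOn h Ω) (hq : ContDiffOn ℝ ∞ q Ω) {y : Model d} (hy : y ∈ Ω) :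
    ContDiffAt ℝ ∞ (divForm h q) y := by
  have hqy : ContDiffAt ℝ ∞ q y := hq.contDiffAt (H.isOpen.mem_nhds hy)
  have h1 : ContDiffAt ℝ ∞ (fun z => (h z).inverse) y := by
    obtain ⟨e, he⟩ := H.exists_equiv hy
    have := contDiffAt_map_inverse (n := ∞) e
    rw [he] at this
    exact this.comp y (H.contDiffAt hy)
  have h2 : ∀ i, ContDiffAt ℝ ∞ (fun z => dualVec h z i) y := fun i =>
    h1.clm_apply contDiffAt_const
  have h3 := H.contDiffAt_christoffelL hy
  have h4 : ContDiffAt ℝ ∞ (fderiv ℝ q) y := hqy.fderiv_right (by simp)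
  have h5 : ∀ i j : Fin d, ContDiffAt ℝ ∞ (fun z => covDerivForm h q z (EuclideanSpace.single i 1)
      (dualVec h z i) (EuclideanSpace.single j 1)) y := fun i j =>
    ((((h4.clm_apply contDiffAt_const).clm_apply (h2 i)).clm_apply contDiffAt_const).sub
      ((hqy.clm_apply ((h3.clm_apply contDiffAt_const).clm_apply (h2 i))).clm_apply
        contDiffAt_const)).sub
      ((hqy.clm_apply (h2 i)).clm_apply ((h3.clm_apply contDiffAt_const).clm_apply
        contDiffAt_const))
  exact ContDiffAt.sum fun j _ => (ContDiffAt.sum fun i _ => h5 i j).smul (h2 j)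

/-- The density `det(σ)^{1/2}` of the induced measure. -/
def density (h : FormField d) (Φ : Model m → Model d) (x : Model m) : ℝ :=
  Real.sqrt (gram h Φ x).det

/-- `P_{r,s}(χ, χ̲)` in coordinates. -/
def mixedCurv (h : FormField d) (Φ ℓ k : Model m → Model d) (r s : ℕ) (x : Model m) : ℝ :=
  mixedCurvature (gram h Φ x) (second h Φ ℓ x) (second h Φ k x) r s

/-- `T_{r,s}^{ab}` in coordinates. -/
def newtonTensor (h : FormField d) (Φ ℓ k : Model m → Model d) (r s : ℕ) (a b : Fin m)
    (x : Model m) : ℝ :=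
  mixedNewton (gram h Φ x) (second h Φ ℓ x) (second h Φ k x) r s a b

namespace IsParallelFrame

variable {h q : FormField d} {Ω : Set (Model d)} {κ : ℝ} {Φ ℓ k : Model m → Model d}
  {U : Set (Model m)} (P : IsParallelFrame h Ω κ Φ ℓ k U) (hq : IsKillingYanoOn h q Ω)
  {x : Model m}
include P

theorem contDiffAt_det_gram (hx : x ∈ U) : ContDiffAt ℝ ∞ (fun w => (gram h Φ w).det) x := by
  simp only [Matrix.det_apply']
  exact ContDiffAt.sum fun σ _ => contDiffAt_const.mul
    (contDiffAt_prod fun i _ => P.contDiffAt_gram hx _ _)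

theorem contDiffAt_density (hx : x ∈ U) : ContDiffAt ℝ ∞ (density h Φ) x :=
  (P.contDiffAt_det_gram hx).sqrt (P.det_gram_pos hx).ne'

theorem smoothPolyAt_pencil (hx : x ∈ U) (i j : Fin m) : SmoothPolyAt
    (fun w => pencil (gram h Φ w) (second h Φ ℓ w) (second h Φ k w) i j) x :=
  ((SmoothPolyAt.C_of (P.contDiffAt_gram hx i j)).add
    ((SmoothPolyAt.const _).mul (SmoothPolyAt.C_of (P.contDiffAt_second hx i j)))).add
    ((SmoothPolyAt.const _).mul (SmoothPolyAt.C_of (P.swap.contDiffAt_second hx i j)))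

theorem contDiffAt_mixedCurv (r s : ℕ) (hx : x ∈ U) :
    ContDiffAt ℝ ∞ (mixedCurv h Φ ℓ k r s) x :=
  contDiffAt_const.mul (((SmoothPolyAt.det fun i j => P.smoothPolyAt_pencil hx i j).2 _).div
    (P.contDiffAt_det_gram hx) (P.det_gram_pos hx).ne')

theorem contDiffAt_newtonTensor (r s : ℕ) (a b : Fin m) (hx : x ∈ U) :
    ContDiffAt ℝ ∞ (newtonTensor h Φ ℓ k r s a b) x := by
  have h1 : newtonTensor h Φ ℓ k r s a b = fun w => _ := funext fun w =>
    pencil.mixedNewton_eq _ _ _ r s a b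
  rw [h1]
  exact contDiffAt_const.mul ((((SmoothPolyAt.const (MvPolynomial.X 0)).mul
    (SmoothPolyAt.adjugate (fun i j => P.smoothPolyAt_pencil hx i j) b a)).2 _).div
    (P.contDiffAt_det_gram hx) (P.det_gram_pos hx).ne')

theorem pencil_adjugate_symm (hx : x ∈ U) (a b : Fin m) :
    (pencil (gram h Φ x) (second h Φ ℓ x) (second h Φ k x)).adjugate a b
      = (pencil (gram h Φ x) (second h Φ ℓ x) (second h Φ k x)).adjugate b a := by
  have h1 : (pencil (gram h Φ x) (second h Φ ℓ x) (second h Φ k x)).transpose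
      = pencil (gram h Φ x) (second h Φ ℓ x) (second h Φ k x) := by
    refine Matrix.ext fun i j => ?_
    simp [pencil, P.gram_symm hx j i, P.second_symm hx j i, P.swap.second_symm hx j i]
  conv_lhs => rw [← h1, ← Matrix.adjugate_transpose]
  rfl

theorem newtonTensor_symm (r s : ℕ) (hx : x ∈ U) (a b : Fin m) :
    newtonTensor h Φ ℓ k r s a b x = newtonTensor h Φ ℓ k r s b a x := by
  rw [newtonTensor, newtonTensor, pencil.mixedNewton_eq, pencil.mixedNewton_eq,
    P.pencil_adjugate_symm hx]

include hq

theorem contDiffAt_time (hx : x ∈ U) :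
    ContDiffAt ℝ ∞ (fun w => h (Φ w) (ℓ w) (timeVec h q (Φ w))) x :=
  P.contDiffAt_form hx (P.metric.contDiffAt (P.mapsTo hx)) (P.contDiffAt_left hx)
    (ContDiffAt.comp (g := timeVec h q) x ((P.metric.contDiffAt_divForm
      hq.smooth (P.mapsTo hx)).const_smul (-(1 / ((d : ℝ) - 1)))) (P.contDiffAt hx))

/-- The divergence of the vector field `T_{r+1,s}(q(ℓ, ·))`. -/
theorem sum_fderiv_newtonTensor (hx : x ∈ U) (r s : ℕ) :
    ∑ b, fderiv ℝ (fun w => density h Φ w * ∑ a, contract q Φ ℓ w a *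
        newtonTensor h Φ ℓ k (r + 1) s a b w) x (basisVec b)
      = density h Φ x * ((r + 1) * (m - r - s) / (r + 1 + s) * (mixedCurv h Φ ℓ k r s x *
          h (Φ x) (ℓ x) (timeVec h q (Φ x)))
        + 1 / 2 * (r + 1) * (mixedCurv h Φ ℓ k (r + 1) s x * q (Φ x) (ℓ x) (k x))) := by
  have hD := P.det_gram_pos hx
  have hsq : ∀ {t : ℝ}, 0 < t → Real.sqrt t / t = (Real.sqrt t)⁻¹ := fun {t} ht => by
    have h1 : Real.sqrt t ≠ 0 := (Real.sqrt_pos.2 ht).ne'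
    nth_rewrite 2 [← Real.mul_self_sqrt ht.le]
    field_simp
  have h1 : ∀ b, fderiv ℝ (fun w => density h Φ w * ∑ a, contract q Φ ℓ w a *
        newtonTensor h Φ ℓ k (r + 1) s a b w) x (basisVec b)
      = mixedFactor (r + 1) s * fderiv ℝ (fun w => invDensity h Φ w * ∑ a, contract q Φ ℓ w a *
        MvPolynomial.coeff (expo r s)
          ((pencil (gram h Φ w) (second h Φ ℓ w) (second h Φ k w)).adjugate a b)) x
          (basisVec b) := by
    intro b
    have h2 : (fun w => density h Φ w * ∑ a, contract q Φ ℓ w a *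
        newtonTensor h Φ ℓ k (r + 1) s a b w) =ᶠ[nhds x] fun w => mixedFactor (r + 1) s *
        (invDensity h Φ w * ∑ a, contract q Φ ℓ w a *
        MvPolynomial.coeff (expo r s)
          ((pencil (gram h Φ w) (second h Φ ℓ w) (second h Φ k w)).adjugate a b)) := by
      filter_upwards [P.isOpen.mem_nhds hx] with w hw
      rw [invDensity, ← hsq (P.det_gram_pos hw), density]
      simp only [Finset.mul_sum]
      refine Finset.sum_congr rfl fun a _ => ?_
      rw [newtonTensor, pencil.mixedNewton_succ, P.pencil_adjugate_symm hw b a]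
      ring
    have h3 : DifferentiableAt ℝ (fun w => invDensity h Φ w * ∑ a, contract q Φ ℓ w a *
        MvPolynomial.coeff (expo r s)
          ((pencil (gram h Φ w) (second h Φ ℓ w) (second h Φ k w)).adjugate a b)) x :=
      (P.differentiableAt_invDensity hx).mul (DifferentiableAt.fun_sum fun a _ =>
        ((P.contDiffAt_contract hq hx a).differentiableAt (by simp)).mul
        (((SmoothPolyAt.adjugate (fun i j => P.smoothPolyAt_pencil hx i j) a b).2
          _).differentiableAt (by simp)))
    rw [h2.fderiv_eq, fderiv_const_mul h3, smul_apply, smul_eq_mul]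
  simp only [h1]
  rw [← Finset.mul_sum, P.sum_fderiv_coeff_adjugate hq hx, pencil.coeff_trace_mul_fst,
    pencil.coeff_trace_mul_snd, mixedCurv, mixedCurv, pencil.mixedCurvature_eq,
    pencil.mixedCurvature_eq, invDensity, ← hsq hD, density, mixedFactor_succ]
  ring

/-- The first integral formula in coordinates, for a test function with compact support. -/
theorem integral_formula (r s : ℕ) {f : Model m → ℝ} (hf : ContDiff ℝ ∞ f)
    (hfc : HasCompactSupport f) (hfU : tsupport f ⊆ U) :
    Integrable (fun x => density h Φ x * (f x * mixedCurv h Φ ℓ k (r - 1) s x *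
        h (Φ x) (ℓ x) (timeVec h q (Φ x)))) ∧
    Integrable (fun x => density h Φ x * (f x * mixedCurv h Φ ℓ k r s x *
        q (Φ x) (ℓ x) (k x))) ∧
    Integrable (fun x => density h Φ x * ∑ a, ∑ b, newtonTensor h Φ ℓ k r s a b x *
        fderiv ℝ f x (basisVec a) * contract q Φ ℓ x b) ∧
    (r : ℝ) * ((m : ℝ) + 1 - r - s) / ((r : ℝ) + s) *
        (∫ x, density h Φ x * (f x * mixedCurv h Φ ℓ k (r - 1) s x *
          h (Φ x) (ℓ x) (timeVec h q (Φ x))))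
      + 1 / 2 * (r : ℝ) * (∫ x, density h Φ x * (f x * mixedCurv h Φ ℓ k r s x *
        q (Φ x) (ℓ x) (k x)))
      + ∫ x, density h Φ x * ∑ a, ∑ b, newtonTensor h Φ ℓ k r s a b x *
        fderiv ℝ f x (basisVec a) * contract q Φ ℓ x b = 0 := by
  have hf0 : ∀ x ∉ tsupport f, f x = 0 := fun x hx => image_eq_zero_of_notMem_tsupport hx
  have hdf0 : ∀ x ∉ tsupport f, fderiv ℝ f x = 0 := fun x hx =>
    fderiv_of_notMem_tsupport ℝ hx
  have i1 : ∀ r', Integrable (fun x => density h Φ x * (f x * mixedCurv h Φ ℓ k r' s x *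
        h (Φ x) (ℓ x) (timeVec h q (Φ x)))) := fun r' =>
    integrable_of_continuousOn (U := U) (K := tsupport f) (fun x hx =>
      ((P.contDiffAt_density hx).mul ((hf.contDiffAt.mul (P.contDiffAt_mixedCurv r' s hx)).mul
        (P.contDiffAt_time hq hx))).continuousAt.continuousWithinAt) hfc hfU
      fun x hx => by simp [hf0 x hx]
  have i2 : Integrable (fun x => density h Φ x * (f x * mixedCurv h Φ ℓ k r s x *
        q (Φ x) (ℓ x) (k x))) :=
    integrable_of_continuousOn (U := U) (K := tsupport f) (fun x hx =>
      ((P.contDiffAt_density hx).mul ((hf.contDiffAt.mul (P.contDiffAt_mixedCurv r s hx)).mul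
        (P.contDiffAt_form hx (hq.smooth.contDiffAt (P.metric.isOpen.mem_nhds (P.mapsTo hx)))
          (P.contDiffAt_left hx)
          (P.contDiffAt_right hx)))).continuousAt.continuousWithinAt) hfc hfU
      fun x hx => by simp [hf0 x hx]
  have i3 : Integrable (fun x => density h Φ x * ∑ a, ∑ b, newtonTensor h Φ ℓ k r s a b x *
        fderiv ℝ f x (basisVec a) * contract q Φ ℓ x b) :=
    integrable_of_continuousOn (U := U) (K := tsupport f) (fun x hx =>
      ((P.contDiffAt_density hx).mul (ContDiffAt.sum fun a _ => ContDiffAt.sum fun b _ =>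
        ((P.contDiffAt_newtonTensor r s a b hx).mul
          ((hf.contDiffAt.fderiv_right (m := ∞) (by simp)).clm_apply contDiffAt_const)).mul
        (P.contDiffAt_contract hq hx b))).continuousAt.continuousWithinAt) hfc hfU
      fun x hx => by simp [hdf0 x hx]
  refine ⟨i1 _, i2, i3, ?_⟩
  cases r with
  | zero => simp [newtonTensor, pencil.mixedNewton_zero]
  | succ r =>
    set V : Fin m → Model m → ℝ := fun b w => density h Φ w * ∑ a, contract q Φ ℓ w a *
        newtonTensor h Φ ℓ k (r + 1) s a b w with hV
    have hVs : ∀ b, ∀ x ∈ U, ContDiffAt ℝ ∞ (V b) x := fun b x hx =>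
      (P.contDiffAt_density hx).mul (ContDiffAt.sum fun a _ => (P.contDiffAt_contract hq hx a).mul
        (P.contDiffAt_newtonTensor (r + 1) s a b hx))
    have hgs : ∀ b, ContDiff ℝ ∞ (fun w => f w * V b w) := by
      intro b
      rw [contDiff_iff_contDiffAt]
      intro x
      by_cases hx : x ∈ tsupport f
      · exact hf.contDiffAt.mul (hVs b x (hfU hx))
      · have h0 : (fun w => f w * V b w) =ᶠ[nhds x] fun _ => 0 := by
          filter_upwards [(isClosed_tsupport f).isOpen_compl.mem_nhds hx] with w hw
          rw [hf0 w hw, zero_mul]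
        exact contDiffAt_const.congr_of_eventuallyEq h0
    have hgc : ∀ b, HasCompactSupport (fun w => f w * V b w) := fun b => hfc.mul_right
    have hint : ∀ b, ∫ x, fderiv ℝ (fun w => f w * V b w) x (basisVec b) = 0 := fun b =>
      (integral_fderiv_eq_zero (hgs b) (hgc b) _).2
    have hinti : ∀ b, Integrable fun x => fderiv ℝ (fun w => f w * V b w) x (basisVec b) :=
      fun b => (integral_fderiv_eq_zero (hgs b) (hgc b) _).1
    have hsum : ∫ x, ∑ b, fderiv ℝ (fun w => f w * V b w) x (basisVec b) = 0 := by
      rw [integral_finsetSum _ fun b _ => hinti b]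
      simp [hint]
    have hpt : ∀ x, ∑ b, fderiv ℝ (fun w => f w * V b w) x (basisVec b)
        = ((r : ℝ) + 1) * ((m : ℝ) - r - s) / ((r : ℝ) + 1 + s) *
            (density h Φ x * (f x * mixedCurv h Φ ℓ k r s x *
              h (Φ x) (ℓ x) (timeVec h q (Φ x))))
          + 1 / 2 * ((r : ℝ) + 1) * (density h Φ x * (f x * mixedCurv h Φ ℓ k (r + 1) s x *
            q (Φ x) (ℓ x) (k x)))
          + density h Φ x * ∑ a, ∑ b, newtonTensor h Φ ℓ k (r + 1) s a b x *
            fderiv ℝ f x (basisVec a) * contract q Φ ℓ x b := by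
      intro x
      by_cases hx : x ∈ tsupport f
      · have hxU := hfU hx
        have h1 : ∀ b, fderiv ℝ (fun w => f w * V b w) x (basisVec b)
            = f x * fderiv ℝ (V b) x (basisVec b) + V b x * fderiv ℝ f x (basisVec b) := by
          intro b
          rw [((hf.contDiffAt.differentiableAt (by simp)).hasFDerivAt.fun_mul
            ((hVs b x hxU).differentiableAt (by simp)).hasFDerivAt).fderiv]
          simp
        have h2 : ∑ b, V b x * fderiv ℝ f x (basisVec b)
            = density h Φ x * ∑ a, ∑ b, newtonTensor h Φ ℓ k (r + 1) s a b x *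
            fderiv ℝ f x (basisVec a) * contract q Φ ℓ x b := by
          rw [Finset.mul_sum]
          refine Finset.sum_congr rfl fun a _ => ?_
          simp only [hV, Finset.mul_sum, Finset.sum_mul]
          refine Finset.sum_congr rfl fun b _ => ?_
          rw [P.newtonTensor_symm (r + 1) s hxU a b]
          ring
        simp only [h1, Finset.sum_add_distrib, ← Finset.mul_sum]
        rw [h2, P.sum_fderiv_newtonTensor hq hxU]
        ring
      · have h0 : ∀ b, (fun w => f w * V b w) =ᶠ[nhds x] fun _ => 0 := by
          intro b
          filter_upwards [(isClosed_tsupport f).isOpen_compl.mem_nhds hx] with w hw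
          rw [hf0 w hw, zero_mul]
        simp [(h0 _).fderiv_eq, hf0 x hx, hdf0 x hx]
    simp only [hpt] at hsum
    have j1 := (i1 r).const_mul (((r : ℝ) + 1) * ((m : ℝ) - r - s) / ((r : ℝ) + 1 + s))
    have j2 := i2.const_mul (1 / 2 * ((r : ℝ) + 1))
    rw [integral_add (by exact j1.add j2) i3, integral_add j1 j2, integral_const_mul,
      integral_const_mul] at hsum
    rw [← hsum]
    push_cast
    ring

end IsParallelFrame

end Coord

/-! ### Charts and coordinate changes -/

namespace ChartCalc

variable {k : ℕ} {M : Type*} [TopologicalSpace M] [ChartedSpace (Model k) M]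

/-- The derivative at `y` of the inverse of the chart around `c`, as an endomorphism of the model
space. -/
def inv (c : M) (y : Model k) : Model k →L[ℝ] Model k :=
  mfderiv 𝓘(ℝ, Model k) (𝓡 k) (extChartAt (𝓡 k) c).symm y

/-- The derivative at `x` of the chart around `c`, as an endomorphism of the model space. -/
def fwd (c x : M) : Model k →L[ℝ] Model k :=
  mfderiv (𝓡 k) 𝓘(ℝ, Model k) (extChartAt (𝓡 k) c) x

/-- The coordinate change from the chart around `c` to the chart around `c'`. -/
def trans (c c' : M) (y : Model k) : Model k :=
  extChartAt (𝓡 k) c' ((extChartAt (𝓡 k) c).symm y)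

/-- The domain of the coordinate change from the chart around `c` to the chart around `c'`. -/
def overlap (c c' : M) : Set (Model k) :=
  (extChartAt (𝓡 k) c).target ∩ (extChartAt (𝓡 k) c).symm ⁻¹' (extChartAt (𝓡 k) c').source

theorem isOpen_preimage_symm (c : M) {W : Set M} (hW : IsOpen W) :
    IsOpen ((extChartAt (𝓡 k) c).target ∩ (extChartAt (𝓡 k) c).symm ⁻¹' W) :=
  (continuousOn_extChartAt_symm c).isOpen_inter_preimage (isOpen_extChartAt_target c) hW

theorem isOpen_overlap (c c' : M) : IsOpen (overlap (k := k) c c') :=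
  isOpen_preimage_symm c (isOpen_extChartAt_source c')

theorem mapsTo_trans (c c' : M) :
    Set.MapsTo (trans (k := k) c c') (overlap c c') (extChartAt (𝓡 k) c').target :=
  fun _ hy => (extChartAt (𝓡 k) c').map_source hy.2

theorem mem_overlap {c c' x : M} (hx : x ∈ (extChartAt (𝓡 k) c).source)
    (hx' : x ∈ (extChartAt (𝓡 k) c').source) : extChartAt (𝓡 k) c x ∈ overlap (k := k) c c' :=
  ⟨(extChartAt (𝓡 k) c).map_source hx, by
    rw [Set.mem_preimage, (extChartAt (𝓡 k) c).left_inv hx]; exact hx'⟩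

theorem trans_apply {c c' x : M} (hx : x ∈ (extChartAt (𝓡 k) c).source) :
    trans c c' (extChartAt (𝓡 k) c x) = extChartAt (𝓡 k) c' x := by
  rw [trans, (extChartAt (𝓡 k) c).left_inv hx]

theorem symm_trans {c c' : M} {y : Model k} (hy : y ∈ overlap c c') :
    (extChartAt (𝓡 k) c').symm (trans c c' y) = (extChartAt (𝓡 k) c).symm y :=
  (extChartAt (𝓡 k) c').left_inv hy.2

section Smooth

variable [IsManifold (𝓡 k) ∞ M]

theorem contMDiffAt_symm {c : M} {y : Model k} (hy : y ∈ (extChartAt (𝓡 k) c).target) :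
    ContMDiffAt 𝓘(ℝ, Model k) (𝓡 k) ∞ (extChartAt (𝓡 k) c).symm y :=
  (contMDiffOn_extChartAt_symm c).contMDiffAt ((isOpen_extChartAt_target c).mem_nhds hy)

theorem contMDiffAt_chart {c x : M} (hx : x ∈ (extChartAt (𝓡 k) c).source) :
    ContMDiffAt (𝓡 k) 𝓘(ℝ, Model k) ∞ (extChartAt (𝓡 k) c) x :=
  contMDiffAt_extChartAt' (by rwa [extChartAt_source] at hx)

theorem fwd_inv {c : M} {y : Model k} (hy : y ∈ (extChartAt (𝓡 k) c).target) (u : Model k) :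
    fwd c ((extChartAt (𝓡 k) c).symm y) (inv c y u) = u := by
  have h := mfderiv_extChartAt_comp_mfderivWithin_extChartAt_symm (I := 𝓡 k) hy
  rw [ModelWithCorners.range_eq_univ, mfderivWithin_univ] at h
  exact DFunLike.congr_fun h u

theorem inv_fwd {c x : M} (hx : x ∈ (extChartAt (𝓡 k) c).source) (u : Model k) :
    inv c (extChartAt (𝓡 k) c x) (fwd c x u) = u := by
  have h := mfderivWithin_extChartAt_symm_comp_mfderiv_extChartAt' (I := 𝓡 k) hx
  rw [ModelWithCorners.range_eq_univ, mfderivWithin_univ] at h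
  exact DFunLike.congr_fun h u

theorem fwd_self (c : M) (u : Model k) : fwd c c u = u := by
  have h := mfderiv_extChartAt_self (I := 𝓡 k) (x := c)
  exact DFunLike.congr_fun h u

theorem contDiffOn_trans (c c' : M) : ContDiffOn ℝ ∞ (trans (k := k) c c') (overlap c c') := by
  intro y hy
  have h := (contMDiffAt_chart (k := k) hy.2).comp y (contMDiffAt_symm hy.1)
  exact (contMDiffAt_iff_contDiffAt.1 h).contDiffWithinAt

theorem fderiv_trans {c c' : M} {y : Model k} (hy : y ∈ overlap c c') (u : Model k) :
    fderiv ℝ (trans c c') y u = fwd c' ((extChartAt (𝓡 k) c).symm y) (inv c y u) := by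
  have h := mfderiv_comp (I := 𝓘(ℝ, Model k)) (I' := 𝓡 k) (I'' := 𝓘(ℝ, Model k)) y
    ((contMDiffAt_chart (k := k) hy.2).mdifferentiableAt (by simp))
    ((contMDiffAt_symm hy.1).mdifferentiableAt (by simp))
  rw [← mfderiv_eq_fderiv]
  exact DFunLike.congr_fun h u

theorem fderiv_trans_fwd {c c' x : M} (hx : x ∈ (extChartAt (𝓡 k) c).source)
    (hx' : x ∈ (extChartAt (𝓡 k) c').source) (u : Model k) :
    fderiv ℝ (trans c c') (extChartAt (𝓡 k) c x) (fwd c x u) = fwd c' x u := by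
  rw [fderiv_trans (mem_overlap hx hx'), inv_fwd hx, (extChartAt (𝓡 k) c).left_inv hx]

theorem inv_fderiv_trans {c c' : M} {y : Model k} (hy : y ∈ overlap c c') (u : Model k) :
    inv c' (trans c c' y) (fderiv ℝ (trans c c') y u) = inv c y u := by
  rw [fderiv_trans hy, trans, inv_fwd hy.2]

/-- The derivative of a map read in charts. -/
theorem fderiv_chart_comp {l : ℕ} {N : Type*} [TopologicalSpace N] [ChartedSpace (Model l) N]
    [IsManifold (𝓡 l) ∞ N] {F : M → N} (hF : ContMDiff (𝓡 k) (𝓡 l) ∞ F) {c : M} {b : N}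
    {y : Model k} (hy : y ∈ (extChartAt (𝓡 k) c).target)
    (hb : F ((extChartAt (𝓡 k) c).symm y) ∈ (extChartAt (𝓡 l) b).source) (u : Model k) :
    fderiv ℝ (fun z => extChartAt (𝓡 l) b (F ((extChartAt (𝓡 k) c).symm z))) y u
      = fwd b (F ((extChartAt (𝓡 k) c).symm y))
        (mfderiv (𝓡 k) (𝓡 l) F ((extChartAt (𝓡 k) c).symm y) (inv c y u)) := by
  have h1 := mfderiv_comp (I := 𝓘(ℝ, Model k)) (I' := 𝓡 k) (I'' := 𝓡 l) y
    ((hF _).mdifferentiableAt (by simp)) ((contMDiffAt_symm hy).mdifferentiableAt (by simp))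
  have h := mfderiv_comp (I := 𝓘(ℝ, Model k)) (I' := 𝓡 l) (I'' := 𝓘(ℝ, Model l)) y
    (f := F ∘ (extChartAt (𝓡 k) c).symm)
    ((contMDiffAt_chart (k := l) hb).mdifferentiableAt (by simp))
    (((hF _).comp y (contMDiffAt_symm hy)).mdifferentiableAt (by simp))
  rw [h1] at h
  rw [← mfderiv_eq_fderiv]
  exact DFunLike.congr_fun h u

theorem contDiffAt_chart_comp {l : ℕ} {N : Type*} [TopologicalSpace N] [ChartedSpace (Model l) N]
    [IsManifold (𝓡 l) ∞ N] {F : M → N} (hF : ContMDiff (𝓡 k) (𝓡 l) ∞ F) {c : M} {b : N}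
    {y : Model k} (hy : y ∈ (extChartAt (𝓡 k) c).target)
    (hb : F ((extChartAt (𝓡 k) c).symm y) ∈ (extChartAt (𝓡 l) b).source) :
    ContDiffAt ℝ ∞ (fun z => extChartAt (𝓡 l) b (F ((extChartAt (𝓡 k) c).symm z))) y :=
  contMDiffAt_iff_contDiffAt.1
    ((contMDiffAt_chart (k := l) hb).comp y ((hF _).comp y (contMDiffAt_symm hy)))

theorem fderiv_symm_comp {f : M → ℝ} (hf : ContMDiff (𝓡 k) 𝓘(ℝ, ℝ) ∞ f) {c : M}
    {y : Model k} (hy : y ∈ (extChartAt (𝓡 k) c).target) (u : Model k) :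
    fderiv ℝ (fun z => f ((extChartAt (𝓡 k) c).symm z)) y u
      = (mfderiv (𝓡 k) 𝓘(ℝ, ℝ) f ((extChartAt (𝓡 k) c).symm y) (inv c y u) : ℝ) := by
  have h := mfderiv_comp (I := 𝓘(ℝ, Model k)) (I' := 𝓡 k) (I'' := 𝓘(ℝ, ℝ)) y
    ((hf _).mdifferentiableAt (by simp)) ((contMDiffAt_symm hy).mdifferentiableAt (by simp))
  rw [← mfderiv_eq_fderiv]
  exact DFunLike.congr_fun h u

theorem contDiffOn_symm_comp {f : M → ℝ} (hf : ContMDiff (𝓡 k) 𝓘(ℝ, ℝ) ∞ f) (c : M) :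
    ContDiffOn ℝ ∞ (fun z => f ((extChartAt (𝓡 k) c).symm z)) (extChartAt (𝓡 k) c).target :=
  fun y hy => (contMDiffAt_iff_contDiffAt.1
    ((hf _).comp y (contMDiffAt_symm hy))).contDiffWithinAt

/-- A vector field along a map is smooth if and only if the map and the expressions of the field in
charts are. -/
theorem contMDiffAt_tangent_iff {l : ℕ} {N : Type*} [TopologicalSpace N] [ChartedSpace (Model l) N]
    {F : N → M} {L : ∀ p : N, TangentSpace (𝓡 k) (F p)} {p : N} {b : M}
    (hF : ContMDiffAt (𝓡 l) (𝓡 k) ∞ F p)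
    (hb : F p ∈ (extChartAt (𝓡 k) b).source) :
    ContMDiffAt (𝓡 l) (𝓡 k).tangent ∞ (fun q => (⟨F q, L q⟩ : TangentBundle (𝓡 k) M)) p
      ↔ ContMDiffAt (𝓡 l) 𝓘(ℝ, Model k) ∞ (fun q => fwd b (F q) (L q)) p := by
  have hb' : F p ∈ (chartAt (Model k) b).source := by rwa [extChartAt_source] at hb
  rw [(trivializationAt (Model k) (TangentSpace (𝓡 k)) b).contMDiffAt_iff
    (by simpa using hb')]
  have hev : (fun q => fwd b (F q) (L q)) =ᶠ[nhds p] fun q =>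
      ((trivializationAt (Model k) (TangentSpace (𝓡 k)) b)
        (⟨F q, L q⟩ : TangentBundle (𝓡 k) M)).2 := by
    filter_upwards [hF.continuousAt.preimage_mem_nhds
      ((chartAt (Model k) b).open_source.mem_nhds hb')] with q hq
    rw [← Bundle.Trivialization.continuousLinearMapAt_apply_of_mem (R := ℝ) _ (by simpa using hq),
      TangentBundle.continuousLinearMapAt_trivializationAt hq]
    rfl
  constructor
  · exact fun h => h.2.congr_of_eventuallyEq hev
  · exact fun h => ⟨hF, h.congr_of_eventuallyEq hev.symm⟩

end Smooth

end ChartCalc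

namespace ChartCalc

open Spacetime Coord

variable {d : ℕ} {V : Type*} [TopologicalSpace V] [ChartedSpace (Model d) V]
  {g Q : ∀ x : V, TangentSpace (𝓡 d) x →L[ℝ] TangentSpace (𝓡 d) x →L[ℝ] ℝ}

theorem chartForm_apply (b : ∀ x : V, TangentSpace (𝓡 d) x →L[ℝ] TangentSpace (𝓡 d) x →L[ℝ] ℝ)
    (c : V) (y u v : Model d) :
    chartForm b c y u v = b ((extChartAt (𝓡 d) c).symm y) (inv c y u) (inv c y v) := rfl

theorem isKillingYanoOn (hQ : IsConformalKillingYano g Q) (c : V) :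
    IsKillingYanoOn (chartForm g c) (chartForm Q c) (extChartAt (𝓡 d) c).target where
  smooth := hQ.smooth c
  alt _ _ _ _ := hQ.alt _ _ _
  eqn := hQ.eqn c

section Forms

variable [IsManifold (𝓡 d) ∞ V]

theorem chartForm_fwd (b : ∀ x : V, TangentSpace (𝓡 d) x →L[ℝ] TangentSpace (𝓡 d) x →L[ℝ] ℝ)
    {c x : V} (hx : x ∈ (extChartAt (𝓡 d) c).source) (u v : Model d) :
    chartForm b c (extChartAt (𝓡 d) c x) (fwd c x u) (fwd c x v) = b x u v := by
  rw [chartForm_apply, inv_fwd hx, inv_fwd hx]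
  let b' : V → Model d →L[ℝ] Model d →L[ℝ] ℝ := b
  exact congrArg (fun z => b' z u v) ((extChartAt (𝓡 d) c).left_inv hx)

theorem chartForm_trans (b : ∀ x : V, TangentSpace (𝓡 d) x →L[ℝ] TangentSpace (𝓡 d) x →L[ℝ] ℝ)
    {c c' : V} {y : Model d} (hy : y ∈ overlap c c') (u v : Model d) :
    chartForm b c y u v
      = chartForm b c' (trans c c' y) (fderiv ℝ (trans c c') y u) (fderiv ℝ (trans c c') y v) := by
  rw [chartForm_apply, chartForm_apply, inv_fderiv_trans hy, inv_fderiv_trans hy]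
  let b' : V → Model d →L[ℝ] Model d →L[ℝ] ℝ := b
  exact congrArg (fun z => b' z (inv c y u) (inv c y v)) (symm_trans hy).symm

theorem isMetricOn (hg : IsLorentzMetric g) (c : V) :
    IsMetricOn (chartForm g c) (extChartAt (𝓡 d) c).target where
  isOpen := isOpen_extChartAt_target c
  smooth := hg.smooth c
  symm _ _ _ _ := hg.symm _ _ _
  nondeg y hy u hu := by
    obtain ⟨t, _, h2⟩ := hg.signature ((extChartAt (𝓡 d) c).symm y)
    have hsurj : ∀ w : Model d,
        g ((extChartAt (𝓡 d) c).symm y) (inv c y u) w = 0 := by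
      intro w
      have h := hu (fwd c ((extChartAt (𝓡 d) c).symm y) w)
      rw [chartForm_apply] at h
      have h3 := inv_fwd (k := d) ((extChartAt (𝓡 d) c).map_target hy) w
      rw [(extChartAt (𝓡 d) c).right_inv hy] at h3
      rwa [h3] at h
    by_contra hne
    have hne' : inv c y u ≠ 0 := by
      intro h0
      have := fwd_inv hy u
      rw [h0, map_zero] at this
      exact hne this.symm
    have h4 := h2 (inv c y u) ((hg.symm _ _ _).trans (hsurj t)) hne'
    exact absurd (hsurj (inv c y u)) h4.ne'

/-- In the direction of `Z`, the divergence of a conformal Killing-Yano form is determined by one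
non-null vector `X` orthogonal to `Z`; its invariance under coordinate changes can thus be read off
from that of the covariant derivative. -/
theorem form_timeVec_trans (hg : IsLorentzMetric g) (hQ : IsConformalKillingYano g Q)
    (hd : (d : ℝ) ≠ 1) {c c' : V} {y : Model d} (hy : y ∈ overlap c c') {X Z : Model d}
    (hX : chartForm g c y X X ≠ 0) (hXZ : chartForm g c y X Z = 0) :
    chartForm g c y Z (timeVec (chartForm g c) (chartForm Q c) y)
      = chartForm g c' (trans c c' y) (fderiv ℝ (trans c c') y Z)
        (timeVec (chartForm g c') (chartForm Q c') (trans c c' y)) := by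
  have hd' : (d : ℝ) - 1 ≠ 0 := sub_ne_zero.2 hd
  have H := isMetricOn hg c
  have H' := isMetricOn hg c'
  have Ho : IsMetricOn (chartForm g c) (overlap c c') :=
    ⟨isOpen_overlap c c', H.smooth.mono Set.inter_subset_left, fun z hz => H.symm z hz.1,
      fun z hz => H.nondeg z hz.1⟩
  have hy' := mapsTo_trans c c' hy
  have key : ∀ {e : V} {z X Z : Model d}, z ∈ (extChartAt (𝓡 d) e).target →
      chartForm g e z X Z = 0 →
      chartForm g e z X X * chartForm g e z Z (timeVec (chartForm g e) (chartForm Q e) z)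
        = - covDerivForm (chartForm g e) (chartForm Q e) z X X Z := by
    intro e z X Z hz h0
    have h1 := hQ.eqn e z hz X X Z
    rw [h0] at h1
    have h2 : chartForm g e z Z (timeVec (chartForm g e) (chartForm Q e) z)
        = -(1 / ((d : ℝ) - 1)) *
          chartForm g e z (divForm (chartForm g e) (chartForm Q e) z) Z := by
      rw [(isMetricOn hg e).symm z hz, timeVec]
      simp
    rw [h2]
    have h3 : covDerivForm (chartForm g e) (chartForm Q e) z X X Z
        = 1 / ((d : ℝ) - 1) * (chartForm g e z X X *
          chartForm g e z (divForm (chartForm g e) (chartForm Q e) z) Z) := by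
      linear_combination (1 / 2 : ℝ) * h1
    rw [h3]
    ring
  have k1 := key hy.1 hXZ
  rw [chartForm_trans g hy] at hXZ hX
  have k2 := key hy' hXZ
  rw [covDerivForm_transform Ho H' (mapsTo_trans c c') (contDiffOn_trans c c')
    (fun z hz u v => chartForm_trans g hz u v) (fun z hz u v => chartForm_trans Q hz u v) hy
    (((hQ.smooth c).contDiffAt (H.isOpen.mem_nhds hy.1)).differentiableAt (by simp))
    (((hQ.smooth c').contDiffAt (H'.isOpen.mem_nhds hy')).differentiableAt (by simp)), ← k2,
    chartForm_trans g hy X X] at k1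
  exact mul_left_cancel₀ hX k1

theorem form_timeField (hg : IsLorentzMetric g) (hQ : IsConformalKillingYano g Q)
    (hd : (d : ℝ) ≠ 1) {c x : V} (hx : x ∈ (extChartAt (𝓡 d) c).source) {X Z : Model d}
    (hX : g x X X ≠ 0) (hXZ : g x X Z = 0) :
    g x Z (timeField g Q x) = chartForm g c (extChartAt (𝓡 d) c x) (fwd c x Z)
      (timeVec (chartForm g c) (chartForm Q c) (extChartAt (𝓡 d) c x)) := by
  have hxx := mem_extChartAt_source (I := 𝓡 d) x
  have h1 := form_timeVec_trans hg hQ hd (mem_overlap hxx hx) (X := X) (Z := Z)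
    (by rw [← fwd_self x X, chartForm_fwd g hxx]; exact hX)
    (by rw [← fwd_self x X, ← fwd_self x Z, chartForm_fwd g hxx]; exact hXZ)
  have h2 := fderiv_trans_fwd hxx hx Z
  rw [fwd_self] at h2
  rw [trans_apply hxx, h2] at h1
  rw [← h1]
  have h3 := chartForm_fwd g hxx Z
    (timeVec (chartForm g x) (chartForm Q x) (extChartAt (𝓡 d) x x))
  rw [fwd_self, fwd_self] at h3
  exact h3.symm

end Forms

/-! ### Submanifolds in charts -/

section Local

open Submanifold

variable {m : ℕ} {S : Type*} [TopologicalSpace S] [ChartedSpace (Model m) S]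
  {F : S → V}
  {L Lb : ∀ p : S, TangentSpace (𝓡 d) (F p)}

/-- The map `F` in the charts around `b` and `c`. -/
def localMap (F : S → V) (b : V) (c : S) (y : Model m) : Model d :=
  extChartAt (𝓡 d) b (F ((extChartAt (𝓡 m) c).symm y))

/-- The field `L` along `F` in the charts around `b` and `c`. -/
def localField (F : S → V) (L : ∀ p : S, TangentSpace (𝓡 d) (F p)) (b : V) (c : S)
    (y : Model m) : Model d :=
  fwd b (F ((extChartAt (𝓡 m) c).symm y)) (L ((extChartAt (𝓡 m) c).symm y))

/-- The set on which `F` can be read in the charts around `b` and `c`. -/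
def localDomain (F : S → V) (b : V) (c : S) : Set (Model m) :=
  (extChartAt (𝓡 m) c).target ∩
    (extChartAt (𝓡 m) c).symm ⁻¹' (F ⁻¹' (extChartAt (𝓡 d) b).source)

theorem isOpen_localDomain (hF : Continuous F) (b : V) (c : S) :
    IsOpen (localDomain (m := m) (d := d) F b c) :=
  isOpen_preimage_symm c ((isOpen_extChartAt_source b).preimage hF)

variable [IsManifold (𝓡 d) ∞ V] [IsManifold (𝓡 m) ∞ S]

theorem fderiv_localMap (hF : ContMDiff (𝓡 m) (𝓡 d) ∞ F) {b : V} {c : S} {y : Model m}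
    (hy : y ∈ localDomain (d := d) F b c) (u : Model m) :
    fderiv ℝ (localMap F b c) y u = fwd b (F ((extChartAt (𝓡 m) c).symm y))
      (mfderiv (𝓡 m) (𝓡 d) F ((extChartAt (𝓡 m) c).symm y) (inv c y u)) :=
  fderiv_chart_comp hF hy.1 hy.2 u

theorem contDiffAt_localMap (hF : ContMDiff (𝓡 m) (𝓡 d) ∞ F) {b : V} {c : S} {y : Model m}
    (hy : y ∈ localDomain (d := d) F b c) : ContDiffAt ℝ ∞ (localMap (d := d) F b c) y :=
  contDiffAt_chart_comp hF hy.1 hy.2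

theorem contDiffAt_localField (hF : ContMDiff (𝓡 m) (𝓡 d) ∞ F)
    (hL : ContMDiff (𝓡 m) (𝓡 d).tangent ∞ fun p => (⟨F p, L p⟩ : TangentBundle (𝓡 d) V))
    {b : V} {c : S} {y : Model m} (hy : y ∈ localDomain (d := d) F b c) :
    ContDiffAt ℝ ∞ (localField F L b c) y :=
  contMDiffAt_iff_contDiffAt.1 <|
    ((contMDiffAt_tangent_iff (hF _) hy.2).1 (hL _)).comp y (contMDiffAt_symm hy.1)

theorem covDeriv_eq_self (hF : ContMDiff (𝓡 m) (𝓡 d) ∞ F)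
    (hL : ContMDiff (𝓡 m) (𝓡 d).tangent ∞ fun p => (⟨F p, L p⟩ : TangentBundle (𝓡 d) V))
    {c : S} {y : Model m} (hy : y ∈ (extChartAt (𝓡 m) c).target) (u : Model m) :
    covDeriv g F L ((extChartAt (𝓡 m) c).symm y) (inv c y u)
      = alongDeriv (chartForm g (F ((extChartAt (𝓡 m) c).symm y)))
        (localMap F (F ((extChartAt (𝓡 m) c).symm y)) c)
        (localField F L (F ((extChartAt (𝓡 m) c).symm y)) c) y u := by
  set p := (extChartAt (𝓡 m) c).symm y with hp
  have hyd : y ∈ localDomain (d := d) F (F p) c := ⟨hy, mem_extChartAt_source (I := 𝓡 d) (F p)⟩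
  have h1 := mfderiv_comp (I := 𝓘(ℝ, Model m)) (I' := 𝓡 m) (I'' := 𝓘(ℝ, Model d)) y
    (g := fieldInChart F L p)
    (((contMDiffAt_tangent_iff (hF _) hyd.2).1 (hL _)).mdifferentiableAt (by simp))
    ((contMDiffAt_symm hy).mdifferentiableAt (by simp))
  have h2 : fderiv ℝ (localField F L (F p) c) y u
      = mfderiv (𝓡 m) 𝓘(ℝ, Model d) (fieldInChart F L p) p (inv c y u) := by
    rw [← mfderiv_eq_fderiv]
    exact DFunLike.congr_fun h1 u
  have h3 : localField F L (F p) c y = L p := fwd_self (F p) (L p)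
  have h4 : fderiv ℝ (localMap F (F p) c) y u = mfderiv (𝓡 m) (𝓡 d) F p (inv c y u) := by
    rw [fderiv_localMap hF hyd]
    exact fwd_self (F p) _
  rw [alongDeriv, h2, h3, h4]
  rfl

/-- The covariant derivative along `F` may be computed in any pair of charts. -/
theorem fwd_covDeriv (hg : IsLorentzMetric g) (hF : ContMDiff (𝓡 m) (𝓡 d) ∞ F)
    (hL : ContMDiff (𝓡 m) (𝓡 d).tangent ∞ fun p => (⟨F p, L p⟩ : TangentBundle (𝓡 d) V))
    {b : V} {c : S} {y : Model m} (hy : y ∈ localDomain (d := d) F b c) (u : Model m) :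
    fwd b (F ((extChartAt (𝓡 m) c).symm y))
        (covDeriv g F L ((extChartAt (𝓡 m) c).symm y) (inv c y u))
      = alongDeriv (chartForm g b) (localMap F b c) (localField F L b c) y u := by
  rw [covDeriv_eq_self hF hL hy.1]
  set p := (extChartAt (𝓡 m) c).symm y with hp
  have hpp := mem_extChartAt_source (I := 𝓡 d) (F p)
  have hyd : y ∈ localDomain (d := d) F (F p) c := ⟨hy.1, hpp⟩
  have hev : ∀ᶠ z in nhds y, z ∈ localDomain (d := d) F b c ∩ localDomain (d := d) F (F p) c :=
    ((isOpen_localDomain (d := d) hF.continuous b c).inter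
      (isOpen_localDomain (d := d) hF.continuous (F p) c)).mem_nhds ⟨hy, hyd⟩
  have hmap : localMap (d := d) F (F p) c =ᶠ[nhds y] fun z => trans b (F p) (localMap (d := d) F b c z) := by
    filter_upwards [hev] with z hz
    exact (trans_apply hz.1.2).symm
  have hfield : localField F L (F p) c =ᶠ[nhds y]
      fun z => fderiv ℝ (trans b (F p)) (localMap F b c z) (localField F L b c z) := by
    filter_upwards [hev] with z hz
    exact (fderiv_trans_fwd hz.1.2 hz.2.2 _).symm
  have hb := isMetricOn hg b
  have Ho : IsMetricOn (chartForm g b) (overlap b (F p)) :=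
    ⟨isOpen_overlap _ _, hb.smooth.mono Set.inter_subset_left, fun z hz => hb.symm z hz.1,
      fun z hz => hb.nondeg z hz.1⟩
  have key := alongDeriv_transform Ho (isMetricOn hg (F p)) (mapsTo_trans b (F p))
    (contDiffOn_trans b (F p)) (fun z hz u v => chartForm_trans g hz u v)
    (Φ := localMap F b c) (ℓ := localField F L b c) (x := y) (mem_overlap hy.2 hpp)
    ((contDiffAt_localMap hF hy).differentiableAt (by simp))
    ((contDiffAt_localField hF hL hy).differentiableAt (by simp)) u
  have h1 : alongDeriv (chartForm g (F p)) (localMap F (F p) c) (localField F L (F p) c) y u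
      = fderiv ℝ (trans b (F p)) (localMap F b c y)
        (alongDeriv (chartForm g b) (localMap F b c) (localField F L b c) y u) := by
    rw [← key, alongDeriv, alongDeriv, hmap.fderiv_eq, hfield.fderiv_eq, hmap.eq_of_nhds,
      hfield.eq_of_nhds]
  have hov : localMap F b c y ∈ overlap b (F p) := mem_overlap hy.2 hpp
  rw [h1, fderiv_trans hov]
  have hsymm : (extChartAt (𝓡 d) b).symm (localMap F b c y) = F p :=
    (extChartAt (𝓡 d) b).left_inv hy.2
  rw [hsymm, fwd_self, ← hsymm]
  exact fwd_inv hov.1 _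

/-- A torsion-free null frame, read in charts. -/
theorem isParallelFrame (hg : IsLorentzMetric g) {κ : ℝ} (hκ : HasConstantCurvature g κ)
    (hd : d = m + 2) (hF : IsSpacelikeImmersion (m := m) g F)
    (hL : IsNullFrame (m := m) g F L Lb) (ht : IsTorsionFree (m := m) g F L Lb) (b : V) (c : S) :
    IsParallelFrame (chartForm g b) (extChartAt (𝓡 d) b).target κ (localMap (d := d) F b c)
      (localField F L b c) (localField F Lb b c) (localDomain (m := m) (d := d) F b c) where
  metric := isMetricOn hg b
  curvature_eq := hκ b
  dim_eq := hd
  isOpen := isOpen_localDomain (d := d) hF.smooth.continuous b c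
  mapsTo := fun y hy => (extChartAt (𝓡 d) b).map_source hy.2
  smooth := fun y hy => (contDiffAt_localMap hF.smooth hy).contDiffWithinAt
  smooth_left := fun y hy => (contDiffAt_localField hF.smooth hL.smooth_left hy).contDiffWithinAt
  smooth_right := fun y hy => (contDiffAt_localField hF.smooth hL.smooth_right hy).contDiffWithinAt
  pos := fun y hy u hu => by
    rw [fderiv_localMap hF.smooth hy]
    refine (hF.pos _ (inv c y u) fun h0 => hu ?_).trans_eq (chartForm_fwd g hy.2 _ _).symm
    rw [← fwd_inv hy.1 u]
    exact (congrArg _ h0).trans (map_zero _)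
  normal_left := fun y hy u => by
    rw [fderiv_localMap hF.smooth hy]
    exact (chartForm_fwd g hy.2 _ _).trans (hL.normal_left _ _)
  normal_right := fun y hy u => by
    rw [fderiv_localMap hF.smooth hy]
    exact (chartForm_fwd g hy.2 _ _).trans (hL.normal_right _ _)
  null_left := fun y hy => (chartForm_fwd g hy.2 _ _).trans (hL.null_left _)
  null_right := fun y hy => (chartForm_fwd g hy.2 _ _).trans (hL.null_right _)
  pairing := fun y hy => (chartForm_fwd g hy.2 _ _).trans (hL.pairing _)
  torsion_eq := fun y hy u => by
    rw [← fwd_covDeriv hg hF.smooth hL.smooth_left hy]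
    have h := ht ((extChartAt (𝓡 m) c).symm y) (inv c y u)
    exact (chartForm_fwd g hy.2 _ _).trans ((mul_eq_zero.1 h).resolve_left (by norm_num))

end Local

end ChartCalc

/-! ### Curvature quantities in charts -/

namespace ChartCalc

open Spacetime Coord Submanifold

section Matrices

variable {m : ℕ}

/-- The matrix of an endomorphism of the model space. -/
def frameMatrix (A : Model m →L[ℝ] Model m) : Matrix (Fin m) (Fin m) ℝ :=
  Matrix.of fun i a => A (basisVec a) i

theorem apply_basisVec (A : Model m →L[ℝ] Model m) (a : Fin m) :
    A (basisVec a) = ∑ i, frameMatrix A i a • basisVec i :=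
  (sum_smul_basisVec _).symm

theorem det_frameMatrix_ne_zero {A B : Model m →L[ℝ] Model m} (hAB : ∀ u, A (B u) = u) :
    (frameMatrix A).det ≠ 0 := by
  have h : frameMatrix A * frameMatrix B = 1 := by
    ext i a
    rw [Matrix.mul_apply, Matrix.one_apply]
    have h1 := congrArg (fun v : Model m => v i) (hAB (basisVec a))
    rw [apply_basisVec B, map_sum] at h1
    simp only [map_smul] at h1
    have h2 : (∑ j, frameMatrix B j a • A (basisVec j)) i
        = ∑ j, frameMatrix A i j * frameMatrix B j a := by
      rw [WithLp.ofLp_sum, Finset.sum_apply]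
      exact Finset.sum_congr rfl fun j _ => mul_comm _ _
    rw [h2] at h1
    rw [h1]
    simp [basisVec]
  intro h0
  have := congrArg Matrix.det h
  rw [Matrix.det_mul, h0, zero_mul, Matrix.det_one] at this
  exact zero_ne_one this

theorem frameMatrix_congr (A : Model m →L[ℝ] Model m) (β : Model m →ₗ[ℝ] Model m →ₗ[ℝ] ℝ) :
    (Matrix.of fun a b => β (A (basisVec a)) (A (basisVec b)))
      = (frameMatrix A).transpose * (Matrix.of fun a b => β (basisVec a) (basisVec b))
        * frameMatrix A := by
  ext a b
  simp only [Matrix.of_apply, Matrix.mul_apply, Matrix.transpose_apply]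
  rw [apply_basisVec A a, apply_basisVec A b]
  simp only [map_sum, map_smul, LinearMap.sum_apply, LinearMap.smul_apply, smul_eq_mul,
    Finset.sum_mul, Finset.mul_sum]
  exact Finset.sum_congr rfl fun i _ => Finset.sum_congr rfl fun j _ => by ring

theorem sum_congruence (A : Matrix (Fin m) (Fin m) ℝ) (N : Fin m → Fin m → ℝ) (α β : Fin m → ℝ) :
    ∑ i, ∑ j, (∑ i', ∑ j', A i i' * A j j' * N i' j') * α i * β j
      = ∑ i', ∑ j', N i' j' * (∑ i, A i i' * α i) * (∑ j, A j j' * β j) := by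
  calc ∑ i, ∑ j, (∑ i', ∑ j', A i i' * A j j' * N i' j') * α i * β j
      = ∑ i, ∑ i', ∑ j, ∑ j', A i i' * A j j' * N i' j' * α i * β j := by
        simp only [Finset.sum_mul]
        exact Finset.sum_congr rfl fun i _ => Finset.sum_comm
    _ = ∑ i', ∑ i, ∑ j', ∑ j, A i i' * A j j' * N i' j' * α i * β j := by
        rw [Finset.sum_comm]
        exact Finset.sum_congr rfl fun i _ => Finset.sum_congr rfl fun j _ => Finset.sum_comm
    _ = _ := by
        refine Finset.sum_congr rfl fun i' _ => ?_
        rw [Finset.sum_comm]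
        refine Finset.sum_congr rfl fun j' _ => ?_
        rw [mul_assoc, Finset.sum_mul_sum, Finset.mul_sum]
        refine Finset.sum_congr rfl fun i _ => ?_
        rw [Finset.mul_sum]
        exact Finset.sum_congr rfl fun j _ => by ring

end Matrices

variable {m d : ℕ} {V : Type*} [TopologicalSpace V] [ChartedSpace (Model d) V]
  {g Q : ∀ x : V, TangentSpace (𝓡 d) x →L[ℝ] TangentSpace (𝓡 d) x →L[ℝ] ℝ}
  {S : Type*} [TopologicalSpace S] [ChartedSpace (Model m) S]
  {F : S → V} {L Lb : ∀ p : S, TangentSpace (𝓡 d) (F p)}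

/-- The null second fundamental form as a bilinear map. -/
def nullBilin (g : ∀ x : V, TangentSpace (𝓡 d) x →L[ℝ] TangentSpace (𝓡 d) x →L[ℝ] ℝ)
    (F : S → V) (L : ∀ p : S, TangentSpace (𝓡 d) (F p)) (p : S) :
    Model m →ₗ[ℝ] Model m →ₗ[ℝ] ℝ :=
  let G : Model d →L[ℝ] Model d →L[ℝ] ℝ := g (F p)
  let D : Model m →L[ℝ] Model d :=
    mfderiv (𝓡 m) 𝓘(ℝ, EuclideanSpace ℝ (Fin d)) (fieldInChart F L p) p
  let T : Model m →L[ℝ] Model d := mfderiv (𝓡 m) (𝓡 d) F p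
  let Γ := (christoffelL (chartForm g (F p)) (extChartAt (𝓡 d) (F p) (F p))).flip (L p)
  (ContinuousLinearMap.bilinearComp G (D + Γ ∘L T) T).toLinearMap₁₂

/-- The induced metric as a bilinear map. -/
def metricBilin (m : ℕ) [ChartedSpace (Model m) S]
    (g : ∀ x : V, TangentSpace (𝓡 d) x →L[ℝ] TangentSpace (𝓡 d) x →L[ℝ] ℝ)
    (F : S → V) (p : S) : Model m →L[ℝ] Model m →L[ℝ] ℝ :=
  inducedMetric (m := m) g F p

theorem inducedMetric_gradient (hg : IsLorentzMetric g) (hF : IsSpacelikeImmersion (m := m) g F)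
    (f : S → ℝ) (p : S) (X : TangentSpace (𝓡 m) p) :
    inducedMetric (m := m) g F p X (gradient m g F f p)
      = (mfderiv (𝓡 m) 𝓘(ℝ, ℝ) f p X : ℝ) := by
  have hsymm : ∀ u v, metricBilin m g F p u v = metricBilin m g F p v u :=
    fun u v => hg.symm _ _ _
  have H : IsMetricOn (fun _ : Model m => metricBilin m g F p) Set.univ :=
    { isOpen := isOpen_univ
      smooth := contDiffOn_const
      symm := fun _ _ u v => hsymm u v
      nondeg := fun _ _ u hu => by
        by_contra hne
        exact (hF.pos p u hne).ne' (hu u) }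
  have h := H.form_sharp (Set.mem_univ 0) (mfderiv (𝓡 m) 𝓘(ℝ, ℝ) f p) X
  exact (hsymm _ _).trans h

/-- The differential of `f` at `p`, as a linear form on the model space. -/
def modelDeriv (f : S → ℝ) (p : S) : Model m →L[ℝ] ℝ := mfderiv (𝓡 m) 𝓘(ℝ, ℝ) f p

/-- The one-form `Q(L, ·)` on the submanifold, as a linear form on the model space. -/
def contractForm (m : ℕ) [ChartedSpace (Model m) S]
    (Q : ∀ x : V, TangentSpace (𝓡 d) x →L[ℝ] TangentSpace (𝓡 d) x →L[ℝ] ℝ)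
    (F : S → V) (L : ∀ p : S, TangentSpace (𝓡 d) (F p)) (p : S) : Model m →L[ℝ] ℝ :=
  (Q (F p) (L p)).comp (mfderiv (𝓡 m) (𝓡 d) F p)

theorem modelDeriv_eq_zero {f : S → ℝ} {p : S} (hp : p ∉ tsupport f) :
    modelDeriv (m := m) f p = 0 := by
  have h : f =ᶠ[nhds p] fun _ => 0 := notMem_tsupport_iff_eventuallyEq.1 hp
  rw [modelDeriv, h.mfderiv_eq, mfderiv_const]
  rfl

theorem modelDeriv_sum {ι : Type*} (t : Finset ι) {f : ι → S → ℝ}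
    (hf : ∀ i ∈ t, ContMDiff (𝓡 m) 𝓘(ℝ, ℝ) ∞ (f i)) (p : S) :
    modelDeriv (m := m) (fun q => ∑ i ∈ t, f i q) p = ∑ i ∈ t, modelDeriv (f i) p := by
  classical
  induction t using Finset.induction_on with
  | empty =>
    simp only [Finset.sum_empty]
    rw [modelDeriv, mfderiv_const]
    rfl
  | insert i t hi ih =>
    have ht : ∀ j ∈ t, ContMDiff (𝓡 m) 𝓘(ℝ, ℝ) ∞ (f j) :=
      fun j hj => hf j (Finset.mem_insert_of_mem hj)
    rw [Finset.sum_insert hi, ← ih ht]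
    simp only [Finset.sum_insert hi]
    exact mfderiv_add (((hf i (Finset.mem_insert_self i t)) p).mdifferentiableAt (by simp))
      (((contMDiff_finsetSum fun j hj => ht j hj) p).mdifferentiableAt (by simp))

theorem form_newton_gradient (hg : IsLorentzMetric g) (hF : IsSpacelikeImmersion (m := m) g F)
    (f : S → ℝ) (r s : ℕ) (p : S) :
    Q (F p) (L p) (mfderiv (𝓡 m) (𝓡 d) F p (newton g F L Lb r s p (gradient m g F f p)))
      = ∑ i, ∑ j, mixedNewton (metricMatrix (m := m) g F p) (nullMatrix g F L p)
          (nullMatrix g F Lb p) r s i j * modelDeriv f p (basisVec i)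
            * contractForm m Q F L p (basisVec j) := by
  have h : newton g F L Lb r s p (gradient m g F f p)
      = (∑ i, ∑ j, (mixedNewton (metricMatrix (m := m) g F p) (nullMatrix g F L p)
        (nullMatrix g F Lb p) r s i j * modelDeriv f p (basisVec i)) •
          (basisVec j : Model m) : Model m) := by
    have h0 : newton g F L Lb r s p (gradient m g F f p)
        = (∑ i, ∑ j, (mixedNewton (metricMatrix (m := m) g F p) (nullMatrix g F L p)
          (nullMatrix g F Lb p) r s i j *
            inducedMetric (m := m) g F p (frame p i) (gradient m g F f p)) •
              (basisVec j : Model m) : Model m) := rfl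
    rw [h0]
    simp only [inducedMetric_gradient hg hF]
    rfl
  refine (congrArg (fun v : Model m => contractForm m Q F L p v) h).trans ?_
  simp only [map_sum, map_smul, smul_eq_mul]

variable [IsManifold (𝓡 d) ∞ V]

theorem form_localMap (b' : ∀ x : V, TangentSpace (𝓡 d) x →L[ℝ] TangentSpace (𝓡 d) x →L[ℝ] ℝ)
    {b : V} {c : S} {y : Model m} (hy : y ∈ localDomain (d := d) F b c) (u v : Model d) :
    chartForm b' b (localMap F b c y) (fwd b (F ((extChartAt (𝓡 m) c).symm y)) u)
        (fwd b (F ((extChartAt (𝓡 m) c).symm y)) v)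
      = b' (F ((extChartAt (𝓡 m) c).symm y)) u v :=
  chartForm_fwd b' hy.2 u v

theorem form_timeField_symm (hg : IsLorentzMetric g) (hQ : IsConformalKillingYano g Q)
    (hd : d = m + 2) (hm : 1 ≤ m) (hF : IsSpacelikeImmersion (m := m) g F)
    (hL : IsNullFrame (m := m) g F L Lb)
    {b : V} {c : S} {y : Model m} (hy : y ∈ localDomain (d := d) F b c) :
    g (F ((extChartAt (𝓡 m) c).symm y)) (L ((extChartAt (𝓡 m) c).symm y))
        (timeField g Q (F ((extChartAt (𝓡 m) c).symm y)))
      = chartForm g b (localMap F b c y) (localField F L b c y)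
        (timeVec (chartForm g b) (chartForm Q b) (localMap F b c y)) := by
  set p := (extChartAt (𝓡 m) c).symm y with hp
  have hd1 : (d : ℝ) ≠ 1 := by
    rw [hd]
    exact_mod_cast (by omega : m + 2 ≠ 1)
  have hne : (basisVec (⟨0, hm⟩ : Fin m) : Model m) ≠ 0 := by
    simp [basisVec]
  exact form_timeField hg hQ hd1 hy.2 (hF.pos p _ hne).ne'
    ((hg.symm _ _ _).trans (hL.normal_left p _))

variable [IsManifold (𝓡 m) ∞ S]

theorem gram_localMap (hF : ContMDiff (𝓡 m) (𝓡 d) ∞ F) {b : V} {c : S} {y : Model m}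
    (hy : y ∈ localDomain (d := d) F b c) :
    gram (chartForm g b) (localMap F b c) y
      = (frameMatrix (inv c y)).transpose
        * metricMatrix (m := m) g F ((extChartAt (𝓡 m) c).symm y) * frameMatrix (inv c y) := by
  have h := frameMatrix_congr (inv c y)
    (metricBilin m g F ((extChartAt (𝓡 m) c).symm y)).toLinearMap₁₂
  refine Eq.trans ?_ h
  ext i j
  rw [gram, Matrix.of_apply, fderiv_localMap hF hy, fderiv_localMap hF hy]
  exact form_localMap g hy _ _

theorem second_localMap (hg : IsLorentzMetric g) (hF : ContMDiff (𝓡 m) (𝓡 d) ∞ F)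
    (hL : ContMDiff (𝓡 m) (𝓡 d).tangent ∞ fun p => (⟨F p, L p⟩ : TangentBundle (𝓡 d) V))
    {b : V} {c : S} {y : Model m} (hy : y ∈ localDomain (d := d) F b c) :
    second (chartForm g b) (localMap F b c) (localField F L b c) y
      = (frameMatrix (inv c y)).transpose
        * nullMatrix (m := m) g F L ((extChartAt (𝓡 m) c).symm y) * frameMatrix (inv c y) := by
  have h := frameMatrix_congr (inv c y) (nullBilin g F L ((extChartAt (𝓡 m) c).symm y))
  refine Eq.trans ?_ h
  ext i j
  rw [second, Matrix.of_apply, fderiv_localMap hF hy, ← fwd_covDeriv hg hF hL hy]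
  exact form_localMap g hy _ _

theorem det_frameMatrix_inv {c : S} {y : Model m} (hy : y ∈ (extChartAt (𝓡 m) c).target) :
    (frameMatrix (inv c y)).det ≠ 0 := by
  refine det_frameMatrix_ne_zero (B := fwd c ((extChartAt (𝓡 m) c).symm y)) fun u => ?_
  have h := inv_fwd (k := m) ((extChartAt (𝓡 m) c).map_target hy) u
  rwa [(extChartAt (𝓡 m) c).right_inv hy] at h

theorem meanCurv_symm (hg : IsLorentzMetric g) (hF : ContMDiff (𝓡 m) (𝓡 d) ∞ F)
    (hL : IsNullFrame (m := m) g F L Lb) (r s : ℕ)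
    {b : V} {c : S} {y : Model m} (hy : y ∈ localDomain (d := d) F b c) :
    meanCurv m g F L Lb r s ((extChartAt (𝓡 m) c).symm y)
      = mixedCurv (chartForm g b) (localMap F b c) (localField F L b c) (localField F Lb b c)
        r s y := by
  rw [mixedCurv, gram_localMap hF hy, second_localMap hg hF hL.smooth_left hy,
    second_localMap hg hF hL.smooth_right hy,
    pencil.mixedCurvature_congr _ _ _ (det_frameMatrix_inv hy.1)]
  rfl

theorem form_newton_gradient_symm (hg : IsLorentzMetric g)
    (hF : IsSpacelikeImmersion (m := m) g F)
    (hL : IsNullFrame (m := m) g F L Lb) {f : S → ℝ} (hf : ContMDiff (𝓡 m) 𝓘(ℝ, ℝ) ∞ f)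
    (r s : ℕ) {b : V} {c : S} {y : Model m} (hy : y ∈ localDomain (d := d) F b c) :
    Q (F ((extChartAt (𝓡 m) c).symm y)) (L ((extChartAt (𝓡 m) c).symm y))
        (mfderiv (𝓡 m) (𝓡 d) F ((extChartAt (𝓡 m) c).symm y)
          (newton g F L Lb r s ((extChartAt (𝓡 m) c).symm y)
            (gradient m g F f ((extChartAt (𝓡 m) c).symm y))))
      = ∑ i, ∑ j, newtonTensor (chartForm g b) (localMap F b c) (localField F L b c)
          (localField F Lb b c) r s i j y
        * fderiv ℝ (fun z => f ((extChartAt (𝓡 m) c).symm z)) y (basisVec i)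
        * contract (chartForm Q b) (localMap F b c) (localField F L b c) y j := by
  set p := (extChartAt (𝓡 m) c).symm y with hp
  set A := inv c y with hA
  have h1 : ∀ i, fderiv ℝ (fun z => f ((extChartAt (𝓡 m) c).symm z)) y (basisVec i)
      = ∑ k, frameMatrix A k i * modelDeriv f p (basisVec k) := by
    intro i
    rw [fderiv_symm_comp hf hy.1]
    have h := congrArg (modelDeriv f p) (apply_basisVec A i)
    rw [map_sum] at h
    simpa only [map_smul, smul_eq_mul] using! h
  have h2 : ∀ i, contract (chartForm Q b) (localMap F b c) (localField F L b c) y i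
      = ∑ k, frameMatrix A k i * contractForm m Q F L p (basisVec k) := by
    intro i
    rw [contract, fderiv_localMap hF.smooth hy]
    refine (form_localMap Q hy _ _).trans ?_
    have h := congrArg (contractForm m Q F L p) (apply_basisVec A i)
    rw [map_sum] at h
    simpa only [map_smul, smul_eq_mul] using! h
  have h4 : ∀ i j, mixedNewton (metricMatrix (m := m) g F p) (nullMatrix g F L p)
      (nullMatrix g F Lb p) r s i j = ∑ i', ∑ j', frameMatrix A i i' * frameMatrix A j j' *
        newtonTensor (chartForm g b) (localMap F b c) (localField F L b c)
          (localField F Lb b c) r s i' j' y := by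
    intro i j
    rw [pencil.mixedNewton_congr _ _ _ (det_frameMatrix_inv hy.1)]
    simp only [newtonTensor]
    rw [gram_localMap hF.smooth hy, second_localMap hg hF.smooth hL.smooth_left hy,
      second_localMap hg hF.smooth hL.smooth_right hy]
  rw [form_newton_gradient hg hF]
  simp only [h4, h1, h2]
  exact sum_congruence _ _ _ _

end ChartCalc

/-! ### The Riemannian measure in charts -/

namespace ChartCalc

open Spacetime Coord Submanifold MeasureTheory

variable {m d : ℕ} {V : Type*} [TopologicalSpace V] [ChartedSpace (Model d) V]
  {g : ∀ x : V, TangentSpace (𝓡 d) x →L[ℝ] TangentSpace (𝓡 d) x →L[ℝ] ℝ}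
  {S : Type*} [TopologicalSpace S] [ChartedSpace (Model m) S]
  {F : S → V}

/-- The density `det(σ_ab)^{1/2}` of the Riemannian measure in the chart around `c`. -/
def chartDensity (m : ℕ) [ChartedSpace (Model m) S]
    (g : ∀ x : V, TangentSpace (𝓡 d) x →L[ℝ] TangentSpace (𝓡 d) x →L[ℝ] ℝ) (F : S → V) (c : S)
    (y : Model m) : ℝ :=
  Real.sqrt (Matrix.det (Matrix.of fun a b : Fin m =>
    chartForm (inducedMetric (m := m) g F) c y (basisVec a) (basisVec b)))

theorem det_frameMatrix (A : Model m →L[ℝ] Model m) : (frameMatrix A).det = A.det := by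
  rw [ContinuousLinearMap.det, ← LinearMap.det_toMatrix (EuclideanSpace.basisFun (Fin m) ℝ).toBasis]
  congr 1

theorem chartDensity_trans [IsManifold (𝓡 m) ∞ S] {c c' : S} {y : Model m} (hy : y ∈ overlap c c') :
    chartDensity m g F c y
      = |(fderiv ℝ (trans c c') y).det| * chartDensity m g F c' (trans c c' y) := by
  have h := frameMatrix_congr (fderiv ℝ (trans c c') y)
    (chartForm (inducedMetric (m := m) g F) c' (trans c c' y)).toLinearMap₁₂
  have h2 : (Matrix.of fun a b : Fin m =>
        chartForm (inducedMetric (m := m) g F) c y (basisVec a) (basisVec b))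
      = (frameMatrix (fderiv ℝ (trans c c') y)).transpose * (Matrix.of fun a b : Fin m =>
        chartForm (inducedMetric (m := m) g F) c' (trans c c' y) (basisVec a) (basisVec b))
        * frameMatrix (fderiv ℝ (trans c c') y) := by
    refine Eq.trans ?_ h
    ext a b
    exact chartForm_trans (inducedMetric (m := m) g F) hy _ _
  rw [chartDensity, h2, Matrix.det_mul, Matrix.det_mul, Matrix.det_transpose, det_frameMatrix,
    mul_right_comm, Real.sqrt_mul (mul_self_nonneg _), Real.sqrt_mul_self_eq_abs]
  rfl

section Measurable

variable [MeasurableSpace S] [BorelSpace S]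

theorem aemeasurable_symm (c : S) {ρ : Model m → ENNReal} :
    AEMeasurable (extChartAt (𝓡 m) c).symm
      (((volume : Measure (Model m)).restrict (extChartAt (𝓡 m) c).target).withDensity ρ) :=
  ((continuousOn_extChartAt_symm c).aemeasurable
    (isOpen_extChartAt_target c).measurableSet).mono_ac (withDensity_absolutelyContinuous _ _)

theorem measurableSet_preimage_symm (c : S) {A : Set S} (hA : MeasurableSet A) :
    MeasurableSet ((extChartAt (𝓡 m) c).target ∩ (extChartAt (𝓡 m) c).symm ⁻¹' A) := by
  have h := (continuousOn_iff_continuous_domRestrict.1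
    (continuousOn_extChartAt_symm (I := 𝓡 m) c)).measurable hA
  have h2 := (isOpen_extChartAt_target (I := 𝓡 m) c).measurableSet.subtype_image h
  convert! h2 using 1
  ext y
  simp [Set.domRestrict, and_comm]

theorem chartMeasure_apply (c : S) {A : Set S} (hA : MeasurableSet A) :
    chartMeasure m g F c A
      = ∫⁻ y in (extChartAt (𝓡 m) c).target ∩ (extChartAt (𝓡 m) c).symm ⁻¹' A,
        ENNReal.ofReal (chartDensity m g F c y) := by
  refine (Measure.map_apply_of_aemeasurable (aemeasurable_symm c) hA).trans ?_
  rw [withDensity_apply', Measure.restrict_restrict'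
    (isOpen_extChartAt_target (I := 𝓡 m) c).measurableSet, Set.inter_comm]
  rfl

theorem chartMeasure_compl_source (c : S) :
    chartMeasure m g F c (extChartAt (𝓡 m) c).sourceᶜ = 0 := by
  rw [chartMeasure_apply c (isOpen_extChartAt_source c).measurableSet.compl]
  have h : (extChartAt (𝓡 m) c).target ∩
      (extChartAt (𝓡 m) c).symm ⁻¹' (extChartAt (𝓡 m) c).sourceᶜ = ∅ := by
    ext y
    simp only [Set.mem_inter_iff, Set.mem_preimage, Set.mem_compl_iff, Set.mem_empty_iff_false,
      iff_false, not_and, not_not]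
    exact fun hy => (extChartAt (𝓡 m) c).map_target hy
  rw [h]
  simp

variable [IsManifold (𝓡 m) ∞ S]

/-- The chart measures agree on the overlaps of the charts. -/
theorem chartMeasure_eq (c c' : S) {A : Set S} (hA : MeasurableSet A)
    (hc : A ⊆ (extChartAt (𝓡 m) c).source) (hc' : A ⊆ (extChartAt (𝓡 m) c').source) :
    chartMeasure m g F c A = chartMeasure m g F c' A := by
  rw [chartMeasure_apply c hA, chartMeasure_apply c' hA]
  set B := (extChartAt (𝓡 m) c).target ∩ (extChartAt (𝓡 m) c).symm ⁻¹' A with hB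
  have hBo : B ⊆ overlap c c' := fun y hy => ⟨hy.1, hc' hy.2⟩
  have hBm : MeasurableSet B := measurableSet_preimage_symm c hA
  have himg : (extChartAt (𝓡 m) c').target ∩ (extChartAt (𝓡 m) c').symm ⁻¹' A
      = trans c c' '' B := by
    ext z
    constructor
    · rintro ⟨hz, hzA⟩
      have hzA' : (extChartAt (𝓡 m) c').symm z ∈ A := hzA
      refine ⟨extChartAt (𝓡 m) c ((extChartAt (𝓡 m) c').symm z),
        ⟨(extChartAt (𝓡 m) c).map_source (hc hzA), ?_⟩, ?_⟩
      · rw [Set.mem_preimage, (extChartAt (𝓡 m) c).left_inv (hc hzA)]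
        exact hzA
      · rw [trans_apply (hc hzA), (extChartAt (𝓡 m) c').right_inv hz]
    · rintro ⟨y, hy, rfl⟩
      refine ⟨mapsTo_trans c c' (hBo hy), ?_⟩
      rw [Set.mem_preimage, symm_trans (hBo hy)]
      exact hy.2
  have hinj : Set.InjOn (trans c c') B := by
    intro y hy z hz hyz
    have h := congrArg (extChartAt (𝓡 m) c').symm hyz
    rw [symm_trans (hBo hy), symm_trans (hBo hz)] at h
    rw [← (extChartAt (𝓡 m) c).right_inv hy.1, h, (extChartAt (𝓡 m) c).right_inv hz.1]
  have hder : ∀ y ∈ B, HasFDerivWithinAt (trans c c') (fderiv ℝ (trans c c') y) B y :=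
    fun y hy => (((contDiffOn_trans c c').contDiffAt
      ((isOpen_overlap c c').mem_nhds (hBo hy))).differentiableAt
        (by simp)).hasFDerivAt.hasFDerivWithinAt
  rw [himg, lintegral_image_eq_lintegral_abs_det_fderiv_mul volume hBm hder hinj]
  refine setLIntegral_congr_fun hBm fun y hy => ?_
  rw [chartDensity_trans (hBo hy), ENNReal.ofReal_mul (abs_nonneg _)]

theorem restrict_riemannianMeasure (c : S) :
    (riemannianMeasure m g F).restrict (extChartAt (𝓡 m) c).source = chartMeasure m g F c := by
  have hO : ∀ c : S, MeasurableSet (extChartAt (𝓡 m) c).source :=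
    fun c => (isOpen_extChartAt_source c).measurableSet
  -- An upper bound of all chart measures which is infinite off the domain of the chart around `c`.
  set ν : Measure S := chartMeasure m g F c
    + ((⊤ : ENNReal) • Measure.count).restrict (extChartAt (𝓡 m) c).sourceᶜ with hν
  have hle : riemannianMeasure m g F ≤ ν := by
    refine iSup_le fun c' => Measure.le_iff.2 fun A hA => ?_
    by_cases hAc : A ⊆ (extChartAt (𝓡 m) c).source
    · calc chartMeasure m g F c' A
          ≤ chartMeasure m g F c' (A ∩ (extChartAt (𝓡 m) c').source)
            + chartMeasure m g F c' (extChartAt (𝓡 m) c').sourceᶜ := by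
            refine (measure_mono ?_).trans (measure_union_le _ _)
            intro x hx
            by_cases hxs : x ∈ (extChartAt (𝓡 m) c').source
            · exact Or.inl ⟨hx, hxs⟩
            · exact Or.inr hxs
        _ = chartMeasure m g F c (A ∩ (extChartAt (𝓡 m) c').source) := by
            rw [chartMeasure_compl_source, add_zero]
            exact chartMeasure_eq c' c (hA.inter (hO c')) Set.inter_subset_right
              (Set.inter_subset_left.trans hAc)
        _ ≤ chartMeasure m g F c A := measure_mono Set.inter_subset_left
        _ ≤ ν A := by
            rw [hν, Measure.add_apply]
            exact le_self_add
    · obtain ⟨x, hxA, hx⟩ := Set.not_subset.1 hAc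
      have h : ν A = ⊤ := by
        rw [hν, Measure.add_apply, Measure.restrict_apply hA, Measure.smul_apply, smul_eq_mul,
          ENNReal.top_mul, add_top]
        rw [Measure.count_ne_zero_iff]
        exact ⟨x, hxA, hx⟩
      rw [h]
      exact le_top
  refine le_antisymm (Measure.le_iff.2 fun A hA => ?_) (Measure.le_iff.2 fun A hA => ?_)
  · rw [Measure.restrict_apply hA]
    refine (hle _).trans ?_
    rw [hν, Measure.add_apply, Measure.restrict_apply (hA.inter (hO c))]
    have h0 : A ∩ (extChartAt (𝓡 m) c).source ∩ (extChartAt (𝓡 m) c).sourceᶜ = ∅ := by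
      rw [Set.inter_assoc, Set.inter_compl_self, Set.inter_empty]
    rw [h0, measure_empty, add_zero]
    exact measure_mono Set.inter_subset_left
  · rw [Measure.restrict_apply hA]
    refine le_trans ?_ (le_iSup (fun c' => chartMeasure m g F c') c _)
    calc chartMeasure m g F c A ≤ chartMeasure m g F c (A ∩ (extChartAt (𝓡 m) c).source)
            + chartMeasure m g F c (extChartAt (𝓡 m) c).sourceᶜ := by
            refine (measure_mono ?_).trans (measure_union_le _ _)
            intro x hx
            by_cases hxs : x ∈ (extChartAt (𝓡 m) c).source
            · exact Or.inl ⟨hx, hxs⟩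
            · exact Or.inr hxs
        _ = _ := by rw [chartMeasure_compl_source, add_zero]

/-- Integration in a chart of a function which vanishes off the domain of the chart. -/
theorem integral_riemannianMeasure {c : S} {f : S → ℝ}
    (hf : ∀ p ∉ (extChartAt (𝓡 m) c).source, f p = 0)
    (hcont : ContinuousOn (chartDensity m g F c) (extChartAt (𝓡 m) c).target)
    (hint : IntegrableOn (fun y => chartDensity m g F c y * f ((extChartAt (𝓡 m) c).symm y))
      (extChartAt (𝓡 m) c).target) :
    Integrable f (riemannianMeasure m g F) ∧ ∫ p, f p ∂(riemannianMeasure m g F)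
      = ∫ y in (extChartAt (𝓡 m) c).target,
        chartDensity m g F c y * f ((extChartAt (𝓡 m) c).symm y) := by
  have hT := (isOpen_extChartAt_target (I := 𝓡 m) c).measurableSet
  set μ := (volume : Measure (Model m)).restrict (extChartAt (𝓡 m) c).target with hμ
  set ρ : Model m → NNReal := fun y => (chartDensity m g F c y).toNNReal with hρ
  have hρm : AEMeasurable ρ μ := (hcont.aemeasurable hT).real_toNNReal
  have hcm : chartMeasure m g F c
      = Measure.map (extChartAt (𝓡 m) c).symm (μ.withDensity fun y => ρ y) := rfl
  have hsm : ∀ y, ρ y • f ((extChartAt (𝓡 m) c).symm y)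
      = chartDensity m g F c y * f ((extChartAt (𝓡 m) c).symm y) := by
    intro y
    rw [NNReal.smul_def, smul_eq_mul]
    exact congrArg (· * _) (Real.coe_toNNReal _ (Real.sqrt_nonneg _))
  have hcomp : Integrable (f ∘ (extChartAt (𝓡 m) c).symm) (μ.withDensity fun y => ρ y) := by
    rw [integrable_withDensity_iff_integrable_smul₀ hρm]
    simpa only [Function.comp_apply, hsm] using! hint
  have hsymm := aemeasurable_symm c (ρ := fun y => (ρ y : ENNReal))
  have hφ : AEMeasurable (extChartAt (𝓡 m) c) (chartMeasure m g F c) := by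
    rw [← restrict_riemannianMeasure]
    exact (continuousOn_extChartAt c).aemeasurable (isOpen_extChartAt_source c).measurableSet
  have hmap : Measure.map (extChartAt (𝓡 m) c) (chartMeasure m g F c)
      = μ.withDensity fun y => ρ y := by
    rw [hcm] at hφ ⊢
    rw [AEMeasurable.map_map_of_aemeasurable hφ hsymm]
    refine (Measure.map_congr ?_).trans Measure.map_id
    refine (withDensity_absolutelyContinuous _ _).ae_le ?_
    filter_upwards [ae_restrict_mem hT] with y hy
    exact (extChartAt (𝓡 m) c).right_inv hy
  have hfm : AEStronglyMeasurable f (chartMeasure m g F c) := by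
    have h1 : AEStronglyMeasurable ((f ∘ (extChartAt (𝓡 m) c).symm) ∘ extChartAt (𝓡 m) c)
        (chartMeasure m g F c) := by
      refine AEStronglyMeasurable.comp_aemeasurable ?_ hφ
      rw [hmap]
      exact hcomp.aestronglyMeasurable
    refine h1.congr ?_
    rw [← restrict_riemannianMeasure]
    filter_upwards [ae_restrict_mem (isOpen_extChartAt_source c).measurableSet] with p hp
    exact congrArg f ((extChartAt (𝓡 m) c).left_inv hp)
  have hfc : Integrable f (chartMeasure m g F c) := by
    rw [hcm] at hfm ⊢
    exact (integrable_map_measure hfm hsymm).2 hcomp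
  constructor
  · rw [← restrict_riemannianMeasure] at hfc
    exact (integrableOn_iff_integrable_of_support_subset
      fun p hp => by_contra fun h => hp (hf p h)).1 hfc
  · rw [← setIntegral_eq_integral_of_forall_compl_eq_zero hf, restrict_riemannianMeasure]
    rw [hcm] at hfm ⊢
    rw [integral_map hsymm hfm, integral_withDensity_eq_integral_smul₀ hρm]
    simp only [hsm]

end Measurable

end ChartCalc

/-! ### The integral formula on the submanifold -/

namespace ChartCalc

open Spacetime Coord Submanifold MeasureTheory

variable {m d : ℕ} {V : Type*} [TopologicalSpace V] [ChartedSpace (Model d) V]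
  {g Q : ∀ x : V, TangentSpace (𝓡 d) x →L[ℝ] TangentSpace (𝓡 d) x →L[ℝ] ℝ}
  {S : Type*} [TopologicalSpace S] [ChartedSpace (Model m) S]
  {F : S → V} {L Lb : ∀ p : S, TangentSpace (𝓡 d) (F p)}

/-- The part of the submanifold which can be read in the charts around `b` and `c`. -/
def chartDomain (F : S → V) (b : V) (c : S) : Set S :=
  (extChartAt (𝓡 m) c).source ∩ F ⁻¹' (extChartAt (𝓡 d) b).source

/-- The function `f` in the chart around `c`, extended by zero. -/
def localFun (f : S → ℝ) (c : S) : Model m → ℝ :=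
  (extChartAt (𝓡 m) c).target.indicator fun y => f ((extChartAt (𝓡 m) c).symm y)

section LocalFun

variable {f : S → ℝ} {b : V} {c : S}

theorem isCompact_image_tsupport [CompactSpace S]
    (hfs : tsupport f ⊆ chartDomain (m := m) (d := d) F b c) :
    IsCompact (extChartAt (𝓡 m) c '' tsupport f) :=
  (isClosed_tsupport f).isCompact.image_of_continuousOn
    ((continuousOn_extChartAt c).mono fun _ hp => (hfs hp).1)

theorem image_tsupport_subset (hfs : tsupport f ⊆ chartDomain (m := m) (d := d) F b c) :
    extChartAt (𝓡 m) c '' tsupport f ⊆ localDomain (d := d) F b c := by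
  rintro _ ⟨p, hp, rfl⟩
  refine ⟨(extChartAt (𝓡 m) c).map_source (hfs hp).1, ?_⟩
  rw [Set.mem_preimage, (extChartAt (𝓡 m) c).left_inv (hfs hp).1]
  exact (hfs hp).2

theorem localFun_eq_zero {y : Model m} (hy : y ∉ extChartAt (𝓡 m) c '' tsupport f) :
    localFun (m := m) f c y = 0 := by
  by_cases hyt : y ∈ (extChartAt (𝓡 m) c).target
  · rw [localFun, Set.indicator_of_mem hyt]
    refine image_eq_zero_of_notMem_tsupport fun h => hy ⟨_, h, ?_⟩
    exact (extChartAt (𝓡 m) c).right_inv hyt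
  · rw [localFun, Set.indicator_of_notMem hyt]

theorem tsupport_localFun [CompactSpace S]
    (hfs : tsupport f ⊆ chartDomain (m := m) (d := d) F b c) :
    tsupport (localFun (m := m) f c) ⊆ extChartAt (𝓡 m) c '' tsupport f := by
  refine closure_minimal (fun y hy => ?_) (isCompact_image_tsupport hfs).isClosed
  by_contra h
  exact hy (localFun_eq_zero h)

theorem localFun_eventuallyEq {y : Model m} (hy : y ∈ (extChartAt (𝓡 m) c).target) :
    localFun (m := m) f c =ᶠ[nhds y] fun z => f ((extChartAt (𝓡 m) c).symm z) := by
  filter_upwards [(isOpen_extChartAt_target c).mem_nhds hy] with z hz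
  exact Set.indicator_of_mem hz _

theorem contDiff_localFun [CompactSpace S] [IsManifold (𝓡 m) ∞ S]
    (hf : ContMDiff (𝓡 m) 𝓘(ℝ, ℝ) ∞ f)
    (hfs : tsupport f ⊆ chartDomain (m := m) (d := d) F b c) : ContDiff ℝ ∞ (localFun (m := m) f c) := by
  rw [contDiff_iff_contDiffAt]
  intro y
  by_cases hy : y ∈ (extChartAt (𝓡 m) c).target
  · exact (((contDiffOn_symm_comp hf c).contDiffAt
      ((isOpen_extChartAt_target c).mem_nhds hy))).congr_of_eventuallyEq (localFun_eventuallyEq hy)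
  · have hK := (isCompact_image_tsupport hfs).isClosed
    have hyK : y ∉ extChartAt (𝓡 m) c '' tsupport f :=
      fun h => hy (image_tsupport_subset hfs h).1
    refine (contDiffAt_const (c := (0 : ℝ))).congr_of_eventuallyEq ?_
    filter_upwards [hK.isOpen_compl.mem_nhds hyK] with z hz
    exact localFun_eq_zero hz

end LocalFun

variable [IsManifold (𝓡 d) ∞ V] [IsManifold (𝓡 m) ∞ S]

theorem chartDensity_eq (hF : ContMDiff (𝓡 m) (𝓡 d) ∞ F) {b : V} {c : S} {y : Model m}
    (hy : y ∈ localDomain (d := d) F b c) :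
    chartDensity m g F c y = density (chartForm g b) (localMap F b c) y := by
  rw [chartDensity, density]
  congr 2
  ext i j
  rw [gram, Matrix.of_apply, Matrix.of_apply, fderiv_localMap hF hy, fderiv_localMap hF hy]
  exact (form_localMap g hy _ _).symm

theorem continuousOn_chartDensity (hg : IsLorentzMetric g) {κ : ℝ}
    (hκ : HasConstantCurvature g κ) (hd : d = m + 2) (hF : IsSpacelikeImmersion (m := m) g F)
    (hL : IsNullFrame (m := m) g F L Lb) (ht : IsTorsionFree (m := m) g F L Lb) (c : S) :
    ContinuousOn (chartDensity m g F c) (extChartAt (𝓡 m) c).target := by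
  intro y hy
  have hyd : y ∈ localDomain (d := d) F (F ((extChartAt (𝓡 m) c).symm y)) c :=
    ⟨hy, mem_extChartAt_source (I := 𝓡 d) _⟩
  have P := isParallelFrame hg hκ hd hF hL ht (F ((extChartAt (𝓡 m) c).symm y)) c
  refine ((P.contDiffAt_density hyd).continuousAt.congr ?_).continuousWithinAt
  filter_upwards [P.isOpen.mem_nhds hyd] with z hz
  exact (chartDensity_eq hF.smooth hz).symm

variable [MeasurableSpace S] [BorelSpace S]

/-- Transfer of an integral to coordinates. -/
theorem integral_eq_of_local {b : V} {c : S} (hF : ContMDiff (𝓡 m) (𝓡 d) ∞ F) {J : S → ℝ}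
    {I : Model m → ℝ}
    (hcont : ContinuousOn (chartDensity m g F c) (extChartAt (𝓡 m) c).target)
    (hJ : ∀ p ∉ chartDomain (m := m) (d := d) F b c, J p = 0)
    (hI : ∀ y ∈ localDomain (d := d) F b c, I y = density (chartForm g b) (localMap F b c) y
      * J ((extChartAt (𝓡 m) c).symm y))
    (hI0 : ∀ y ∉ localDomain (d := d) F b c, I y = 0) (hint : Integrable I) :
    Integrable J (riemannianMeasure m g F) ∧
      ∫ p, J p ∂(riemannianMeasure m g F) = ∫ y, I y := by
  have hT := (isOpen_extChartAt_target (I := 𝓡 m) c).measurableSet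
  have hIe : ∀ y ∈ (extChartAt (𝓡 m) c).target,
      chartDensity m g F c y * J ((extChartAt (𝓡 m) c).symm y) = I y := by
    intro y hy
    by_cases hyd : y ∈ localDomain (d := d) F b c
    · rw [hI y hyd, chartDensity_eq hF hyd]
    · rw [hI0 y hyd, hJ _ fun h => hyd ⟨hy, h.2⟩, mul_zero]
  have h := integral_riemannianMeasure (g := g) (F := F) (f := J) (c := c)
    (fun p hp => hJ p fun h => hp h.1) hcont
    ((hint.integrableOn (s := (extChartAt (𝓡 m) c).target)).congr_fun
      (fun y hy => (hIe y hy).symm) hT)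
  refine ⟨h.1, h.2.trans ?_⟩
  rw [setIntegral_congr_fun hT hIe]
  exact setIntegral_eq_integral_of_forall_compl_eq_zero
    fun y hy => hI0 y fun h => hy h.1

/-- The first integral formula, for a function supported in the domain of a pair of charts,
together with the integrability of its three terms. -/
theorem integral_formula_of_tsupport_subset [CompactSpace S] (hg : IsLorentzMetric g) {κ : ℝ}
    (hκ : HasConstantCurvature g κ) (hQ : IsConformalKillingYano g Q) (hd : d = m + 2)
    (hm : 1 ≤ m) (hF : IsSpacelikeImmersion (m := m) g F) (hL : IsNullFrame (m := m) g F L Lb)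
    (ht : IsTorsionFree (m := m) g F L Lb) (r s : ℕ) {f : S → ℝ}
    (hf : ContMDiff (𝓡 m) 𝓘(ℝ, ℝ) ∞ f) {b : V} {c : S}
    (hfs : tsupport f ⊆ chartDomain (m := m) (d := d) F b c) :
    Integrable (fun p => f p * meanCurv m g F L Lb (r - 1) s p
        * g (F p) (L p) (timeField g Q (F p))) (riemannianMeasure m g F) ∧
    Integrable (fun p => f p * meanCurv m g F L Lb r s p * Q (F p) (L p) (Lb p))
      (riemannianMeasure m g F) ∧
    Integrable (fun p => Q (F p) (L p) (mfderiv (𝓡 m) (𝓡 d) F p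
        (newton g F L Lb r s p (gradient m g F f p)))) (riemannianMeasure m g F) ∧
    (r : ℝ) * ((m : ℝ) + 1 - r - s) / ((r : ℝ) + s)
          * (∫ p, f p * meanCurv m g F L Lb (r - 1) s p * g (F p) (L p) (timeField g Q (F p))
            ∂(riemannianMeasure m g F))
        + 1 / 2 * (r : ℝ) * (∫ p, f p * meanCurv m g F L Lb r s p * Q (F p) (L p) (Lb p)
            ∂(riemannianMeasure m g F))
        + ∫ p, Q (F p) (L p) (mfderiv (𝓡 m) (𝓡 d) F p
            (newton g F L Lb r s p (gradient m g F f p))) ∂(riemannianMeasure m g F) = 0 := by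
  have P := isParallelFrame hg hκ hd hF hL ht b c
  have hK := isCompact_image_tsupport hfs
  have hts := tsupport_localFun hfs
  have hsub := image_tsupport_subset hfs
  have hcs : HasCompactSupport (localFun (m := m) f c) := hK.of_isClosed_subset
    (isClosed_tsupport _) hts
  have hcont := continuousOn_chartDensity hg hκ hd hF hL ht c
  obtain ⟨i1, i2, i3, hsum⟩ := P.integral_formula (isKillingYanoOn hQ b) r s
    (contDiff_localFun hf hfs) hcs (hts.trans hsub)
  have hf0 : ∀ p ∉ chartDomain (m := m) (d := d) F b c, p ∉ tsupport f :=
    fun p hp h => hp (hfs h)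
  have hl0 : ∀ y ∉ localDomain (d := d) F b c, y ∉ tsupport (localFun (m := m) f c) :=
    fun y hy h => hy (hsub (hts h))
  have hl : ∀ y ∈ localDomain (d := d) F b c,
      localFun f c y = f ((extChartAt (𝓡 m) c).symm y) := fun y hy => Set.indicator_of_mem hy.1 _
  have e1 := integral_eq_of_local (g := g) (b := b) hF.smooth hcont
    (J := fun p => f p * meanCurv m g F L Lb (r - 1) s p * g (F p) (L p) (timeField g Q (F p)))
    (fun p hp => by
      simp only [image_eq_zero_of_notMem_tsupport (hf0 p hp), zero_mul])
    (fun y hy => by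
      rw [form_timeField_symm hg hQ hd hm hF hL hy, meanCurv_symm hg hF.smooth hL _ _ hy,
        ← hl y hy])
    (fun y hy => by
      simp only [image_eq_zero_of_notMem_tsupport (hl0 y hy), zero_mul, mul_zero]) i1
  have e2 := integral_eq_of_local (g := g) (b := b) hF.smooth hcont
    (J := fun p => f p * meanCurv m g F L Lb r s p * Q (F p) (L p) (Lb p))
    (fun p hp => by
      simp only [image_eq_zero_of_notMem_tsupport (hf0 p hp), zero_mul])
    (fun y hy => by
      rw [meanCurv_symm hg hF.smooth hL _ _ hy, ← hl y hy]
      exact congrArg (fun t => _ * (_ * t)) (form_localMap Q hy _ _))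
    (fun y hy => by
      simp only [image_eq_zero_of_notMem_tsupport (hl0 y hy), zero_mul, mul_zero]) i2
  have e3 := integral_eq_of_local (g := g) (b := b) hF.smooth hcont
    (J := fun p => Q (F p) (L p) (mfderiv (𝓡 m) (𝓡 d) F p
        (newton g F L Lb r s p (gradient m g F f p))))
    (fun p hp => by
      rw [form_newton_gradient hg hF]
      simp [modelDeriv_eq_zero (hf0 p hp)])
    (fun y hy => by
      rw [form_newton_gradient_symm hg hF hL hf r s hy,
        (localFun_eventuallyEq (f := f) hy.1).fderiv_eq])
    (fun y hy => by simp [fderiv_of_notMem_tsupport ℝ (hl0 y hy)]) i3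
  refine ⟨e1.1, e2.1, e3.1, ?_⟩
  rw [e1.2, e2.2, e3.2]
  exact hsum

/-- The first integral formula. -/
theorem integral_formula [T2Space S] [CompactSpace S] (hg : IsLorentzMetric g) {κ : ℝ}
    (hκ : HasConstantCurvature g κ) (hQ : IsConformalKillingYano g Q) (hd : d = m + 2)
    (hm : 1 ≤ m) (hF : IsSpacelikeImmersion (m := m) g F) (hL : IsNullFrame (m := m) g F L Lb)
    (ht : IsTorsionFree (m := m) g F L Lb) (r s : ℕ) {f : S → ℝ}
    (hf : ContMDiff (𝓡 m) 𝓘(ℝ, ℝ) ∞ f) :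
    (r : ℝ) * ((m : ℝ) + 1 - r - s) / ((r : ℝ) + s)
          * (∫ p, f p * meanCurv m g F L Lb (r - 1) s p * g (F p) (L p) (timeField g Q (F p))
            ∂(riemannianMeasure m g F))
        + 1 / 2 * (r : ℝ) * (∫ p, f p * meanCurv m g F L Lb r s p * Q (F p) (L p) (Lb p)
            ∂(riemannianMeasure m g F))
        + ∫ p, Q (F p) (L p) (mfderiv (𝓡 m) (𝓡 d) F p
            (newton g F L Lb r s p (gradient m g F f p))) ∂(riemannianMeasure m g F) = 0 := by
  have hopen : ∀ c : S, IsOpen (chartDomain (m := m) (d := d) F (F c) c) := fun c =>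
    (isOpen_extChartAt_source c).inter
      ((isOpen_extChartAt_source (F c)).preimage hF.smooth.continuous)
  have hmem : ∀ c : S, c ∈ chartDomain (m := m) (d := d) F (F c) c := fun c =>
    ⟨mem_extChartAt_source (I := 𝓡 m) c, mem_extChartAt_source (I := 𝓡 d) (F c)⟩
  obtain ⟨T, hT⟩ := isCompact_univ.elim_nhds_subcover
    (fun c => chartDomain (m := m) (d := d) F (F c) c) fun c _ => (hopen c).mem_nhds (hmem c)
  obtain ⟨ρ, hρ⟩ := SmoothPartitionOfUnity.exists_isSubordinate (𝓡 m) isClosed_univ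
    (fun c : T => chartDomain (m := m) (d := d) F (F c) (c : S)) (fun c => hopen c)
    (by
      rw [Set.iUnion_subtype]
      exact hT.2)
  have hsum1 : ∀ p, ∑ c : T, ρ c p = 1 := fun p => by
    rw [← finsum_eq_sum_of_fintype]
    exact ρ.sum_eq_one (Set.mem_univ p)
  set w : T → S → ℝ := fun c p => ρ c p * f p with hw
  have hw_s : ∀ c, ContMDiff (𝓡 m) 𝓘(ℝ, ℝ) ∞ (w c) := fun c => (ρ c).contMDiff.mul hf
  have hfw : f = fun p => ∑ c, w c p := by
    funext p
    rw [← Finset.sum_mul, hsum1, one_mul]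
  have hw_t : ∀ c, tsupport (w c) ⊆ chartDomain (m := m) (d := d) F (F c) (c : S) := fun c =>
    (tsupport_mul_subset_left).trans (hρ c)
  have key := fun c => integral_formula_of_tsupport_subset hg hκ hQ hd hm hF hL ht r s (hw_s c)
    (hw_t c)
  have s1 : (∫ p, f p * meanCurv m g F L Lb (r - 1) s p * g (F p) (L p) (timeField g Q (F p))
        ∂(riemannianMeasure m g F))
      = ∑ c, ∫ p, w c p * meanCurv m g F L Lb (r - 1) s p
          * g (F p) (L p) (timeField g Q (F p)) ∂(riemannianMeasure m g F) := by
    rw [← integral_finsetSum _ fun c _ => (key c).1]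
    congr 1
    funext p
    rw [← Finset.sum_mul, ← Finset.sum_mul, ← congrFun hfw p]
  have s2 : (∫ p, f p * meanCurv m g F L Lb r s p * Q (F p) (L p) (Lb p)
        ∂(riemannianMeasure m g F))
      = ∑ c, ∫ p, w c p * meanCurv m g F L Lb r s p * Q (F p) (L p) (Lb p)
        ∂(riemannianMeasure m g F) := by
    rw [← integral_finsetSum _ fun c _ => (key c).2.1]
    congr 1
    funext p
    rw [← Finset.sum_mul, ← Finset.sum_mul, ← congrFun hfw p]
  have s3 : (∫ p, Q (F p) (L p) (mfderiv (𝓡 m) (𝓡 d) F p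
        (newton g F L Lb r s p (gradient m g F f p))) ∂(riemannianMeasure m g F))
      = ∑ c, ∫ p, Q (F p) (L p) (mfderiv (𝓡 m) (𝓡 d) F p
        (newton g F L Lb r s p (gradient m g F (w c) p))) ∂(riemannianMeasure m g F) := by
    rw [← integral_finsetSum _ fun c _ => (key c).2.2.1]
    congr 1
    funext p
    have hD : modelDeriv (m := m) f p = ∑ c, modelDeriv (w c) p := by
      conv_lhs => rw [hfw]
      exact modelDeriv_sum _ (fun c _ => hw_s c) p
    simp only [form_newton_gradient hg hF, hD]
    symm
    refine Finset.sum_comm.trans (Finset.sum_congr rfl fun i _ => ?_)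
    refine Finset.sum_comm.trans (Finset.sum_congr rfl fun j _ => ?_)
    rw [← Finset.sum_mul, ← Finset.mul_sum, sum_apply]
  rw [s1, s2, s3, Finset.mul_sum, Finset.mul_sum, ← Finset.sum_add_distrib,
    ← Finset.sum_add_distrib]
  exact Finset.sum_eq_zero fun c _ => (key c).2.2.2

end ChartCalc

/-! ### Changes of the null frame -/

namespace ChartCalc

open Spacetime Coord Submanifold MeasureTheory

variable {m d : ℕ} {V : Type*} [TopologicalSpace V] [ChartedSpace (Model d) V]
  [IsManifold (𝓡 d) ∞ V]
  {g Q : ∀ x : V, TangentSpace (𝓡 d) x →L[ℝ] TangentSpace (𝓡 d) x →L[ℝ] ℝ}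
  {S : Type*} [TopologicalSpace S] [ChartedSpace (Model m) S] [IsManifold (𝓡 m) ∞ S]
  {F : S → V} {L Lb : ∀ p : S, TangentSpace (𝓡 d) (F p)}

omit [IsManifold (𝓡 m) ∞ S] in
theorem isNullFrame_swap (hg : IsLorentzMetric g) (hL : IsNullFrame (m := m) g F L Lb) :
    IsNullFrame (m := m) g F Lb L where
  smooth_left := hL.smooth_right
  smooth_right := hL.smooth_left
  normal_left := hL.normal_right
  normal_right := hL.normal_left
  null_left := hL.null_right
  null_right := hL.null_left
  pairing := fun p => (hg.symm _ _ _).trans (hL.pairing p)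

/-- Every point and every tangent vector is the image of a point and a vector of the model space
under the inverse of a chart. -/
theorem exists_chart_eq (p : S) :
    ∃ c : S, ∃ y ∈ (extChartAt (𝓡 m) c).target, (extChartAt (𝓡 m) c).symm y = p ∧
      ∀ X : Model m, ∃ u, inv c y u = X :=
  ⟨p, extChartAt (𝓡 m) p p, mem_extChartAt_target p, extChartAt_to_inv p,
    fun X => ⟨fwd p p X, inv_fwd (mem_extChartAt_source p) X⟩⟩

theorem isTorsionFree_swap (hg : IsLorentzMetric g) {κ : ℝ} (hκ : HasConstantCurvature g κ)
    (hd : d = m + 2) (hF : IsSpacelikeImmersion (m := m) g F)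
    (hL : IsNullFrame (m := m) g F L Lb) (ht : IsTorsionFree (m := m) g F L Lb) :
    IsTorsionFree (m := m) g F Lb L := by
  intro p X
  obtain ⟨c, y, hy, rfl, hX⟩ := exists_chart_eq (m := m) p
  obtain ⟨u, rfl⟩ := hX X
  have hyd : y ∈ localDomain (d := d) F (F ((extChartAt (𝓡 m) c).symm y)) c :=
    ⟨hy, mem_extChartAt_source (I := 𝓡 d) _⟩
  have h := (isParallelFrame hg hκ hd hF hL ht _ c).right_left hyd u
  rw [← fwd_covDeriv hg hF.smooth hL.smooth_right hyd] at h
  have h2 := (form_localMap g hyd _ _).symm.trans h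
  exact (congrArg (1 / 2 * ·) h2).trans (mul_zero _)

omit [IsManifold (𝓡 m) ∞ S] in
theorem contMDiff_smul_field {u : S → ℝ} (hu : ContMDiff (𝓡 m) 𝓘(ℝ, ℝ) ∞ u)
    (hF : ContMDiff (𝓡 m) (𝓡 d) ∞ F)
    (hL : ContMDiff (𝓡 m) (𝓡 d).tangent ∞ fun p => (⟨F p, L p⟩ : TangentBundle (𝓡 d) V)) :
    ContMDiff (𝓡 m) (𝓡 d).tangent ∞ fun p => (⟨F p, u p • L p⟩ : TangentBundle (𝓡 d) V) := by
  intro p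
  have hb := mem_extChartAt_source (I := 𝓡 d) (F p)
  rw [contMDiffAt_tangent_iff (hF p) hb]
  have h := (hu p).smul ((contMDiffAt_tangent_iff (hF p) hb).1 (hL p))
  refine h.congr_of_eventuallyEq (Filter.Eventually.of_forall fun q => ?_)
  exact (fwd (F p) (F q)).map_smul (u q) (L q)

omit [IsManifold (𝓡 m) ∞ S] in
theorem isNullFrame_smul {u : S → ℝ} (hu : ContMDiff (𝓡 m) 𝓘(ℝ, ℝ) ∞ u)
    (hu' : ContMDiff (𝓡 m) 𝓘(ℝ, ℝ) ∞ fun p => (u p)⁻¹) (hu0 : ∀ p, u p ≠ 0)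
    (hF : ContMDiff (𝓡 m) (𝓡 d) ∞ F) (hL : IsNullFrame (m := m) g F L Lb) :
    IsNullFrame (m := m) g F (fun p => u p • L p) (fun p => (u p)⁻¹ • Lb p) where
  smooth_left := contMDiff_smul_field hu hF hL.smooth_left
  smooth_right := contMDiff_smul_field hu' hF hL.smooth_right
  normal_left := fun p X => by simp [hL.normal_left p X]
  normal_right := fun p X => by simp [hL.normal_right p X]
  null_left := fun p => by simp [hL.null_left p]
  null_right := fun p => by simp [hL.null_right p]
  pairing := fun p => by
    simp [hL.pairing p, hu0 p]

/-- Rescaling `L` by `u` changes the connection one-form by `- d log u`. -/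
theorem torsion_smul (hg : IsLorentzMetric g) {u : S → ℝ}
    (hu : ContMDiff (𝓡 m) 𝓘(ℝ, ℝ) ∞ u) (hu0 : ∀ p, u p ≠ 0)
    (hF : ContMDiff (𝓡 m) (𝓡 d) ∞ F) (hL : IsNullFrame (m := m) g F L Lb)
    (p : S) (X : TangentSpace (𝓡 m) p) :
    torsion g F (fun p => u p • L p) (fun p => (u p)⁻¹ • Lb p) p X
      = torsion g F L Lb p X - (u p)⁻¹ * modelDeriv u p X := by
  obtain ⟨c, y, hy, rfl, hX⟩ := exists_chart_eq (m := m) p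
  obtain ⟨v, rfl⟩ := hX X
  have hyd : y ∈ localDomain (d := d) F (F ((extChartAt (𝓡 m) c).symm y)) c :=
    ⟨hy, mem_extChartAt_source (I := 𝓡 d) _⟩
  set p := (extChartAt (𝓡 m) c).symm y with hp
  have hfield : localField F (fun p => u p • L p) (F p) c
      = fun z => u ((extChartAt (𝓡 m) c).symm z) • localField F L (F p) c z := by
    funext z
    exact (fwd (F p) _).map_smul (u _) (L _)
  have h1 := fwd_covDeriv hg hF (contMDiff_smul_field hu hF hL.smooth_left) hyd v
  have h2 := fwd_covDeriv hg hF hL.smooth_left hyd v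
  rw [hfield, IsMetricOn.alongDeriv_smul
    (((contDiffOn_symm_comp hu c).contDiffAt
      ((isOpen_extChartAt_target c).mem_nhds hy)).differentiableAt (by simp))
    ((contDiffAt_localField hF hL.smooth_left hyd).differentiableAt (by simp)), ← h2,
    fderiv_symm_comp hu hy] at h1
  replace h1 := ((fwd_self (F p) _).symm.trans h1).trans
    (congrArg₂ (fun a b : Model d => modelDeriv u p (inv c y v) • a + u p • b)
      (fwd_self (F p) (L p)) (fwd_self (F p) (covDeriv g F L p (inv c y v))))
  let G : Model d →L[ℝ] Model d →L[ℝ] ℝ := g (F p)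
  let ℓ : Model d := L p
  let k : Model d := Lb p
  have hG : G ℓ k = -2 := hL.pairing p
  have h2' : ∀ D : ℝ, ∀ w : Model d,
      1 / 2 * G (D • ℓ + u p • w) ((u p)⁻¹ • k) = 1 / 2 * G w k - (u p)⁻¹ * D := by
    intro D w
    have hup := hu0 p
    simp only [map_add, map_smul, add_apply, smul_apply, smul_eq_mul, hG]
    field_simp
    ring
  exact (congrArg (fun w => 1 / 2 * G w ((u p)⁻¹ • k)) h1).trans (h2' _ _)

/-- The scaling function is `exp h`, where `ζ = dh`. -/
theorem exists_isTorsionFree_smul (hg : IsLorentzMetric g)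
    (hF : ContMDiff (𝓡 m) (𝓡 d) ∞ F) (hL : IsNullFrame (m := m) g F L Lb)
    (hexact : IsExactOneForm (m := m) (torsion g F L Lb)) :
    ∃ u : S → ℝ, (∀ p, 0 < u p) ∧
      IsNullFrame (m := m) g F (fun p => u p • L p) (fun p => (u p)⁻¹ • Lb p) ∧
      IsTorsionFree (m := m) g F (fun p => u p • L p) (fun p => (u p)⁻¹ • Lb p) := by
  obtain ⟨h, hh, hdh⟩ := hexact
  have hu : ContMDiff (𝓡 m) 𝓘(ℝ, ℝ) ∞ fun p => Real.exp (h p) :=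
    Real.contDiff_exp.contMDiff.comp hh
  have hu' : ContMDiff (𝓡 m) 𝓘(ℝ, ℝ) ∞ fun p => (Real.exp (h p))⁻¹ := by
    simp only [← Real.exp_neg]
    exact Real.contDiff_exp.contMDiff.comp hh.neg
  have hu0 : ∀ p, Real.exp (h p) ≠ 0 := fun p => Real.exp_ne_zero _
  refine ⟨fun p => Real.exp (h p), fun p => Real.exp_pos _,
    isNullFrame_smul hu hu' hu0 hF hL, fun p X => ?_⟩
  have hd : modelDeriv (m := m) (fun p => Real.exp (h p)) p X
      = Real.exp (h p) * modelDeriv (m := m) h p X := by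
    have h1 := mfderiv_comp (I := 𝓡 m) (I' := 𝓘(ℝ, ℝ)) (I'' := 𝓘(ℝ, ℝ)) p (g := Real.exp)
      ((Real.contDiff_exp (n := ∞)).contMDiff.contMDiffAt.mdifferentiableAt (by simp))
      ((hh p).mdifferentiableAt (by simp))
    rw [mfderiv_eq_fderiv, (Real.hasDerivAt_exp (h p)).hasFDerivAt.fderiv] at h1
    refine (DFunLike.congr_fun h1 X).trans ?_
    exact mul_comm (modelDeriv (m := m) h p X) (Real.exp (h p))
  have hζ : torsion g F L Lb p X = modelDeriv (m := m) h p X := (hdh p X).symm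
  rw [torsion_smul hg hu hu0 hF hL, hζ]
  refine (congrArg (fun t => _ - _ * t) hd).trans ?_
  rw [inv_mul_cancel_left₀ (hu0 p), sub_self]

/-- The second integral formula. -/
theorem integral_formula_bar [MeasurableSpace S] [BorelSpace S] [T2Space S] [CompactSpace S]
    (hg : IsLorentzMetric g) {κ : ℝ}
    (hκ : HasConstantCurvature g κ) (hQ : IsConformalKillingYano g Q) (hd : d = m + 2)
    (hm : 1 ≤ m) (hF : IsSpacelikeImmersion (m := m) g F) (hL : IsNullFrame (m := m) g F L Lb)
    (ht : IsTorsionFree (m := m) g F L Lb) (r s : ℕ) {f : S → ℝ}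
    (hf : ContMDiff (𝓡 m) 𝓘(ℝ, ℝ) ∞ f) :
    (s : ℝ) * ((m : ℝ) + 1 - r - s) / ((r : ℝ) + s)
          * (∫ p, f p * meanCurv m g F L Lb r (s - 1) p * g (F p) (Lb p) (timeField g Q (F p))
            ∂(riemannianMeasure m g F))
        - 1 / 2 * (s : ℝ) * (∫ p, f p * meanCurv m g F L Lb r s p * Q (F p) (L p) (Lb p)
            ∂(riemannianMeasure m g F))
        + ∫ p, Q (F p) (Lb p) (mfderiv (𝓡 m) (𝓡 d) F p
            (newtonBar g F L Lb r s p (gradient m g F f p))) ∂(riemannianMeasure m g F) = 0 := by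
  have h := integral_formula hg hκ hQ hd hm hF (isNullFrame_swap hg hL)
    (isTorsionFree_swap hg hκ hd hF hL ht) s r hf
  have hP : ∀ r s p, meanCurv m g F Lb L s r p = meanCurv m g F L Lb r s p :=
    fun r s p => pencil.mixedCurvature_swap _ _ _ _ _
  have hN : ∀ p X, newton g F Lb L s r p X = newtonBar (m := m) g F L Lb r s p X := by
    intro p X
    rw [newton, newtonBar]
    congr 1
    funext a b
    exact (pencil.mixedNewtonBar_eq _ _ _ _ _ _ _).symm
  have hQs : ∀ p, f p * meanCurv m g F L Lb r s p * Q (F p) (Lb p) (L p)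
      = -(f p * meanCurv m g F L Lb r s p * Q (F p) (L p) (Lb p)) := fun p => by
    rw [hQ.alt, mul_neg]
  simp only [hP, hN, hQs, integral_neg] at h
  rw [← h, add_comm (s : ℝ) r]
  ring

end ChartCalc

end

theorem theorem4p6 (n : ℕ) (hn : 1 ≤ n)
    {V : Type*} [TopologicalSpace V] [ChartedSpace (EuclideanSpace ℝ (Fin (n + 1))) V]
    [IsManifold (𝓡 (n + 1)) ∞ V]
    {S : Type*} [TopologicalSpace S] [T2Space S] [CompactSpace S]
    [ChartedSpace (EuclideanSpace ℝ (Fin (n - 1))) S] [IsManifold (𝓡 (n - 1)) ∞ S]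
    [MeasurableSpace S] [BorelSpace S]
    (g : ∀ x : V, TangentSpace (𝓡 (n + 1)) x →L[ℝ] TangentSpace (𝓡 (n + 1)) x →L[ℝ] ℝ)
    (hg : Spacetime.IsLorentzMetric g)
    (κ : ℝ) (hκ : Spacetime.HasConstantCurvature g κ)
    (Q : ∀ x : V, TangentSpace (𝓡 (n + 1)) x →L[ℝ] TangentSpace (𝓡 (n + 1)) x →L[ℝ] ℝ)
    (hQ : Spacetime.IsConformalKillingYano g Q)
    (F : S → V) (hF : Submanifold.IsSpacelikeImmersion (m := n - 1) g F)
    (L₀ Lb₀ : ∀ p : S, TangentSpace (𝓡 (n + 1)) (F p))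
    (hL₀ : Submanifold.IsNullFrame (m := n - 1) g F L₀ Lb₀)
    (hclosed : Submanifold.IsClosedOneForm (m := n - 1) (Submanifold.torsion g F L₀ Lb₀))
    (hexact : Submanifold.IsExactOneForm (m := n - 1) (Submanifold.torsion g F L₀ Lb₀)) :
    (∃ u : S → ℝ, (∀ p, 0 < u p) ∧
      Submanifold.IsNullFrame (m := n - 1) g F (fun p => u p • L₀ p) (fun p => (u p)⁻¹ • Lb₀ p) ∧
      Submanifold.IsTorsionFree (m := n - 1) g F
        (fun p => u p • L₀ p) (fun p => (u p)⁻¹ • Lb₀ p)) ∧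
    ∀ L Lb : (∀ p : S, TangentSpace (𝓡 (n + 1)) (F p)),
      Submanifold.IsNullFrame (m := n - 1) g F L Lb →
      Submanifold.IsTorsionFree (m := n - 1) g F L Lb →
      ∀ f : S → ℝ, ContMDiff (𝓡 (n - 1)) 𝓘(ℝ, ℝ) ∞ f →
      ∀ r s : ℕ, 1 ≤ r + s → r + s ≤ n - 1 →
        ((r : ℝ) * ((n : ℝ) - r - s) / ((r : ℝ) + s)
              * ∫ p, f p * Submanifold.meanCurv (n - 1) g F L Lb (r - 1) s p
                  * g (F p) (L p) (Spacetime.timeField g Q (F p))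
                ∂(Submanifold.riemannianMeasure (n - 1) g F)
            + 1 / 2 * (r : ℝ)
              * ∫ p, f p * Submanifold.meanCurv (n - 1) g F L Lb r s p * Q (F p) (L p) (Lb p)
                ∂(Submanifold.riemannianMeasure (n - 1) g F)
            + ∫ p, Q (F p) (L p) (mfderiv (𝓡 (n - 1)) (𝓡 (n + 1)) F p
                  (Submanifold.newton g F L Lb r s p (Submanifold.gradient (n - 1) g F f p)))
                ∂(Submanifold.riemannianMeasure (n - 1) g F) = 0) ∧
        ((s : ℝ) * ((n : ℝ) - r - s) / ((r : ℝ) + s)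
              * ∫ p, f p * Submanifold.meanCurv (n - 1) g F L Lb r (s - 1) p
                  * g (F p) (Lb p) (Spacetime.timeField g Q (F p))
                ∂(Submanifold.riemannianMeasure (n - 1) g F)
            - 1 / 2 * (s : ℝ)
              * ∫ p, f p * Submanifold.meanCurv (n - 1) g F L Lb r s p * Q (F p) (L p) (Lb p)
                ∂(Submanifold.riemannianMeasure (n - 1) g F)
            + ∫ p, Q (F p) (Lb p) (mfderiv (𝓡 (n - 1)) (𝓡 (n + 1)) F p
                  (Submanifold.newtonBar g F L Lb r s p
                    (Submanifold.gradient (n - 1) g F f p)))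
                ∂(Submanifold.riemannianMeasure (n - 1) g F) = 0) := by
  have hd : n + 1 = n - 1 + 2 := by omega
  refine ⟨ChartCalc.exists_isTorsionFree_smul hg hF.smooth hL₀ hexact,
    fun L Lb hL ht f hf r s h1 h2 => ?_⟩
  have hm : 1 ≤ n - 1 := h1.trans h2
  have hn' : ((n - 1 : ℕ) : ℝ) + 1 = n := by
    rw [Nat.cast_sub hn]
    simp
  have e1 := ChartCalc.integral_formula hg hκ hQ hd hm hF hL ht r s hf
  have e2 := ChartCalc.integral_formula_bar hg hκ hQ hd hm hF hL ht r s hf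
  rw [hn'] at e1 e2
  exact ⟨e1, e2⟩
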